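/- A graph (finite, simple, nonempty) is \emph{chordal} if it has no induced cycle of length at least $4$, and \emph{m-decyclable} if its edge set can be partitioned into a matching $M$ and a set $F$ of edges that contains no cycle. M-decyclable chordal graphs can be recognized in $O(n)$ time: there are a program for a unit-cost random access machine and a constant $C$ such that, for every graph $G$ on $n\ge 1$ vertices, given by adjacency lists, the program halts after at most $C\,n$ steps and accepts if and only if $G$ is chordal and m-decyclable. (The machine has addition, truncated subtraction, comparisons and indirect addressing; the adjacency lists are stored one after the other in an array, in an arbitrary order within each list, preceded by $n$ and the starting address of each list; every number that is computed is at most $C$ times the number of words of the input. In particular, given a chordal graph, the program decides in $O(n)$ time whether it is m-decyclable.) -/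

import Mathlib

/-! ### Graphs -/

/-- A graph is chordal if no cycle of length at least four (square or hole) is an induced
subgraph of it. -/
def SimpleGraph.IsChordal {V : Type*} (G : SimpleGraph V) : Prop :=
  ∀ k : ℕ, 4 ≤ k → ¬ (SimpleGraph.cycleGraph k).IsIndContained G

/-- A graph is m-decyclable if its edge set splits into a matching and an acyclic set of edges. -/
def SimpleGraph.IsMDecyclable {V : Type*} (G : SimpleGraph V) : Prop :=
  ∃ M : G.Subgraph, M.IsMatching ∧ (G.deleteEdges M.edgeSet).IsAcyclic

/-! ### A unit-cost random access machine with bounded words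

Programs are structured (sequences, branches, loops); every elementary instruction and every
evaluation of a test costs one step. The only arithmetic is addition and truncated subtraction.
Registers are named by fixed numbers in the program; memory cells are addressed by the content
of a register. -/

namespace RAM

/-- A machine state: contents of the registers and of the memory cells. -/
structure State where
  reg : ℕ → ℕ
  mem : ℕ → ℕ

/-- Right-hand sides of register assignments; the arguments of all constructors but `const`
are names of registers. -/
inductive Rhs where
  | const (k : ℕ)
  | copy (a : ℕ)
  | add (a b : ℕ)
  | sub (a b : ℕ)
  | load (a : ℕ)

/-- The word computed by a right-hand side. -/
def Rhs.value (s : State) : Rhs → ℕ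
  | .const k => k
  | .copy a => s.reg a
  | .add a b => s.reg a + s.reg b
  | .sub a b => s.reg a - s.reg b
  | .load a => s.mem (s.reg a)

/-- Comparisons of two registers. -/
inductive Test where
  | eq (a b : ℕ)
  | ne (a b : ℕ)
  | lt (a b : ℕ)
  | le (a b : ℕ)

/-- The truth of a test in a state. -/
def Test.Holds (s : State) : Test → Prop
  | .eq a b => s.reg a = s.reg b
  | .ne a b => s.reg a ≠ s.reg b
  | .lt a b => s.reg a < s.reg b
  | .le a b => s.reg a ≤ s.reg b

/-- Programs. `store a b` writes the content of register `b` to the memory cell whose address is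
the content of register `a`. -/
inductive Program where
  | skip
  | assign (r : ℕ) (e : Rhs)
  | store (a b : ℕ)
  | seq (p q : Program)
  | ite (c : Test) (p q : Program)
  | while (c : Test) (p : Program)

/-- `Exec B p s t s'`: started in state `s`, the program `p` halts after exactly `t` steps in
state `s'`, and no word computed on the way exceeds `B`. The rules are deterministic; a program
that would compute a word larger than `B`, or that does not halt, has no such execution. -/
inductive Exec (B : ℕ) : Program → State → ℕ → State → Prop where
  | skip (s : State) : Exec B .skip s 1 s
  | assign (r : ℕ) (e : Rhs) (s : State) (h : e.value s ≤ B) :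
      Exec B (.assign r e) s 1 ⟨Function.update s.reg r (e.value s), s.mem⟩
  | store (a b : ℕ) (s : State) :
      Exec B (.store a b) s 1 ⟨s.reg, Function.update s.mem (s.reg a) (s.reg b)⟩
  | seq {p q : Program} {s s' s'' : State} {t t' : ℕ}
      (hp : Exec B p s t s') (hq : Exec B q s' t' s'') : Exec B (.seq p q) s (t + t') s''
  | ite_true {c : Test} {p q : Program} {s s' : State} {t : ℕ}
      (hc : c.Holds s) (hp : Exec B p s t s') : Exec B (.ite c p q) s (1 + t) s'
  | ite_false {c : Test} {p q : Program} {s s' : State} {t : ℕ}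
      (hc : ¬ c.Holds s) (hq : Exec B q s t s') : Exec B (.ite c p q) s (1 + t) s'
  | while_true {c : Test} {p : Program} {s s' s'' : State} {t t' : ℕ}
      (hc : c.Holds s) (hp : Exec B p s t s') (hw : Exec B (.while c p) s' t' s'') :
      Exec B (.while c p) s (1 + t + t') s''
  | while_false {c : Test} {p : Program} {s : State}
      (hc : ¬ c.Holds s) : Exec B (.while c p) s 1 s

/-- The initial state on an input: the input stands in memory from address `0` on, and all other
cells and all registers are zero. -/
def init (w : List ℕ) : State := ⟨fun _ => 0, fun i => w.getD i 0⟩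

end RAM

/-! ### Graphs as inputs -/

/-- `L v` lists the neighbours of `v`, each once, in an arbitrary order. -/
def IsAdjacencyLists {n : ℕ} (G : SimpleGraph (Fin n)) (L : Fin n → List (Fin n)) : Prop :=
  ∀ v, (L v).Nodup ∧ ∀ u, u ∈ L v ↔ G.Adj v u

/-- Adjacency lists as an array of words: first the number `n` of vertices, then for
`i = 0, …, n` the address at which the list of vertex `i` begins (for `i = n`: the address
after the last list), then the lists of the vertices `0, …, n - 1` one after the other. A graph
with `m` edges gives `n + 2 + 2 * m` words. -/
def encodeLists {n : ℕ} (L : Fin n → List (Fin n)) : List ℕ :=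
  n :: (List.range (n + 1)).map
      (fun i => n + 2 + (((List.finRange n).take i).map fun v => (L v).length).sum)
    ++ (List.finRange n).flatMap fun v => (L v).map Fin.val

/-! The algorithm is a depth-first search that keeps three bits per vertex.

In a decycling matching every triangle and every square contains a matched edge. Hence a diamond is
matched perfectly with its hubs not matched to each other (`Decyc.diamond`), and neither a `K₄` nor
three consecutive triangles around a vertex can occur. In a chordal graph this excludes all cycles
of length at least five (`Decyc.no_long_cycle`). Visited neighbours of a newly visited vertex `v`
always lie on the search path, so they are among its last three vertices `p`, `g`, `q`, or the graph
is bad (`not_good_of_far`).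

In a chordal graph an edge in no triangle is a bridge (`SimpleGraph.IsChordal.isBridge`), and a
bridge may be removed from the matching at will. The path therefore falls into groups of consecutive
vertices linked by edges in triangles. The invariant `Labelled` says which sets `R` of path vertices
can be left uncovered by a decycling matching of the visited part: exactly those with at most one
vertex in each group and none in a saturated group (`Sparse`). It is strong enough to be carried
along:

A vertex adjacent to `p` only changes nothing. A triangle on a bridge `p g` joins two groups: with
`v` there are up to three free vertices, and two of them get matched. A triangle on an edge that is
in a triangle already forces `v` to be matched into that group, which becomes saturated. If `v` is
adjacent to `p`, `g` and `q`, the two old edges must be bridges, and all four vertices get matched.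
The lemmas `avoid_pendant`, `avoid_triangle_of_isBridge`, `avoid_triangle_of_common` and
`avoid_diamond` prove these transitions as equivalences. So a failing test (`Accepts`) shows that
the graph is bad, and a successful one restores the invariant; `Labelled.push` combines the two.
When a vertex leaves the path, its group hands its saturation to the parent (`Labelled.pop`). At the
end the path is empty, and the invariant for `R = ∅` yields a matching (`Labelled.good`).

The running time is bounded by a potential made up of untried roots, path length and unread list
entries. It is linear in the input, not yet in `n`. But an m-decyclable graph is a forest plus a
matching, with degree sum at most `3 * n`, so the program looks up the input length first and
refuses longer inputs without searching them. -/

open SimpleGraph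

/-! ### Cycles, chords and bridges in chordal graphs. -/

section Graphs

variable {V : Type*}

/-- The first `k` values of `f` form a cycle of `G`. -/
structure IsCyc (G : SimpleGraph V) (f : ℕ → V) (k : ℕ) : Prop where
  inj : ∀ i < k, ∀ j < k, f i = f j → i = j
  adj : ∀ i, i + 1 < k → G.Adj (f i) (f (i + 1))
  close : G.Adj (f (k - 1)) (f 0)

/-- Without a chord, `f` itself embeds `cycleGraph k` as an induced subgraph. The pair `(0, k - 1)`
is excluded because it is the closing edge. -/
theorem SimpleGraph.IsChordal.exists_chord {G : SimpleGraph V} (hG : G.IsChordal) {f : ℕ → V} {k : ℕ}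
    (hk : 4 ≤ k) (hf : IsCyc G f k) :
    ∃ i j, i + 2 ≤ j ∧ j < k ∧ ¬ (i = 0 ∧ j = k - 1) ∧ G.Adj (f i) (f j) := by
  by_contra! hno
  refine hG k hk ⟨⟨⟨fun i => f i, fun i j h => Fin.ext (hf.inj _ i.2 _ j.2 h)⟩, ?_⟩⟩
  have key : ∀ i j : Fin k, i < j →
      (G.Adj (f i) (f j) ↔ (cycleGraph k).Adj i j) := by
    intro i j hij
    have hij' : i.val < j.val := hij
    rw [cycleGraph_adj']
    have h1 : (j - i).val = j.val - i.val := Fin.sub_val_of_le hij.le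
    have h2 : (i - j).val = k - (j.val - i.val) := by
      rw [Fin.sub_def]; simp only
      rw [show k - j.val + i.val = k - (j.val - i.val) by omega]
      exact Nat.mod_eq_of_lt (by omega)
    rw [h1, h2]
    constructor
    · intro h
      by_contra hc
      exact hno i j (by omega) j.2 (by omega) h
    · intro h
      rcases h with h | h
      · have h0 : i.val = 0 := by omega
        have h0' : j.val = k - 1 := by omega
        rw [h0, h0']; exact hf.close.symm
      · have h0 : j.val = i.val + 1 := by omega
        rw [h0]; exact hf.adj _ (by omega)
  intro i j
  rcases lt_trichotomy i j with h | h | h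
  · exact key i j h
  · subst h; simp
  · rw [G.adj_comm, (cycleGraph k).adj_comm]; exact key j i h

/-- The part of a cycle outside a chord. -/
theorem IsCyc.outer {G : SimpleGraph V} {f : ℕ → V} {k i j : ℕ} (hf : IsCyc G f k)
    (hij : i + 2 ≤ j) (hj : j < k) (h : G.Adj (f i) (f j)) :
    IsCyc G (fun s => if s ≤ i then f s else f (s + (j - i - 1))) (k - (j - i) + 1) := by
  refine ⟨?_, ?_, ?_⟩
  · intro a ha b hb hab
    beta_reduce at hab
    split_ifs at hab
    all_goals have := hf.inj _ (by omega) _ (by omega) hab; omega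
  · intro a ha
    split_ifs with h1 h2 h2
    · exact hf.adj _ (by omega)
    · have : a = i := by omega
      subst this
      rw [show a + 1 + (j - a - 1) = j by omega]; exact h
    · omega
    · rw [show a + 1 + (j - i - 1) = (a + (j - i - 1)) + 1 by omega]
      exact hf.adj _ (by omega)
  · simp only [Nat.zero_le, if_true]
    rw [if_neg (by omega), show k - (j - i) + 1 - 1 + (j - i - 1) = k - 1 by omega]
    exact hf.close

/-- The part of a cycle inside a chord. -/
theorem IsCyc.inner {G : SimpleGraph V} {f : ℕ → V} {k i j : ℕ} (hf : IsCyc G f k)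
    (hij : i + 2 ≤ j) (hj : j < k) (h : G.Adj (f i) (f j)) :
    IsCyc G (fun s => f (i + s)) (j - i + 1) := by
  refine ⟨?_, ?_, ?_⟩
  · intro a ha b hb hab
    have := hf.inj _ (by omega) _ (by omega) hab; omega
  · intro a ha
    exact hf.adj _ (by omega)
  · rw [show i + (j - i + 1 - 1) = j by omega]
    exact h.symm

/-- A chord splits the cycle, and the part that keeps the closing edge is shorter; the induction
ends at a triangle on that edge. So an edge on a cycle of a chordal graph is in a triangle. -/
theorem SimpleGraph.IsChordal.exists_common_of_isCyc {G : SimpleGraph V} (hG : G.IsChordal) :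
    ∀ (k : ℕ) (f : ℕ → V), 3 ≤ k → IsCyc G f k →
      ∃ w, G.Adj w (f (k - 1)) ∧ G.Adj w (f 0) := by
  intro k
  induction k using Nat.strong_induction_on with
  | _ k ih =>
    intro f hk hf
    rcases Nat.lt_or_ge k 4 with h4 | h4
    · obtain rfl : k = 3 := by omega
      exact ⟨f 1, hf.adj 1 (by omega), (hf.adj 0 (by omega)).symm⟩
    · obtain ⟨i, j, hij, hj, hne, h⟩ := hG.exists_chord h4 hf
      have := ih (k - (j - i) + 1) (by omega) _ (by omega) (hf.outer hij hj h)
      simp only [Nat.zero_le, if_true] at this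
      rwa [if_neg (by omega), show k - (j - i) + 1 - 1 + (j - i - 1) = k - 1 by omega] at this

theorem SimpleGraph.Walk.IsPath.isCyc {G H : SimpleGraph V} (hHG : H ≤ G) {u v : V} {w : H.Walk u v}
    (hw : w.IsPath) (h : G.Adj u v) : IsCyc G w.getVert (w.length + 1) := by
  refine ⟨?_, ?_, ?_⟩
  · intro i hi j hj hij
    exact hw.getVert_injOn (by simp; omega) (by simp; omega) hij
  · intro i hi
    exact hHG (w.adj_getVert_succ (by omega))
  · simpa using h.symm

/-- A second route between the ends would close up to a cycle through the edge, hence to a triangle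
on it. This lets a local label certify the global property used when matchings are modified. -/
theorem SimpleGraph.IsChordal.isBridge {G : SimpleGraph V} (hG : G.IsChordal) {a b : V}
    (h : G.Adj a b) (hno : ∀ w, G.Adj w a → ¬ G.Adj w b) : G.IsBridge s(a, b) := by
  classical
  rw [isBridge_iff]
  intro hr
  obtain ⟨w, hw⟩ := hr.exists_isPath
  have hc := hw.isCyc (deleteEdges_le _) h
  have hl : 3 ≤ w.length + 1 := by
    by_contra hl
    have : w.length = 0 ∨ w.length = 1 := by omega
    rcases this with h0 | h0
    · exact h.ne (Walk.eq_of_length_eq_zero h0)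
    · have := Walk.adj_of_length_eq_one h0
      simp at this
  obtain ⟨x, hx⟩ := hG.exists_common_of_isCyc _ _ hl hc
  simp at hx
  exact hno x hx.2 hx.1

/-! ### Attaching one vertex while preserving chordality. -/

/-- The subgraph of `G` induced on `S`, with the other vertices kept as isolated ones. -/
def res (G : SimpleGraph V) (S : Set V) : SimpleGraph V where
  Adj u v := G.Adj u v ∧ u ∈ S ∧ v ∈ S
  symm := ⟨fun _ _ h => ⟨h.1.symm, h.2.2, h.2.1⟩⟩
  loopless := ⟨fun _ h => h.1.ne rfl⟩

theorem res_adj {G : SimpleGraph V} {S : Set V} {u v : V} :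
    (res G S).Adj u v ↔ G.Adj u v ∧ u ∈ S ∧ v ∈ S := Iff.rfl

theorem res_le (G : SimpleGraph V) (S : Set V) : res G S ≤ G := fun _ _ h => h.1

theorem res_univ (G : SimpleGraph V) : res G Set.univ = G := by
  ext; simp [res_adj]

theorem cycleGraph_adj_add_one {k : ℕ} (hk : 4 ≤ k) (i : Fin k) :
    have : NeZero k := ⟨by omega⟩
    (cycleGraph k).Adj i (i + 1) ∧ (cycleGraph k).Adj i (i - 1) ∧
      ¬ (cycleGraph k).Adj (i + 1) (i - 1) ∧ i + 1 ≠ i - 1 := by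
  obtain ⟨m, rfl⟩ : ∃ m, k = m + 4 := ⟨k - 4, by omega⟩
  have e1 : (1 : Fin (m + 4)).val = 1 := by simp
  refine ⟨?_, ?_, ?_, ?_⟩
  · rw [cycleGraph_adj]; right; abel
  · rw [cycleGraph_adj]; left; abel
  · rw [cycleGraph_adj]
    rintro (h | h)
    · have h1 : (1 : Fin (m + 4)) + 1 = 1 := by rw [← h]; abel_nf; simp_all
      simp at h1
    · have h1 : (1 : Fin (m + 4)) + 1 + 1 = 0 := by
        nth_rw 3 [← h]; abel
      have := congrArg Fin.val h1
      simp [Fin.val_add] at this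
      rw [Nat.mod_eq_of_lt (by omega)] at this
      omega
  · intro h
    have h1 : (1 : Fin (m + 4)) + 1 = 0 := by
      calc (1 : Fin (m+4)) + 1 = (i + 1) - (i - 1) := by abel
        _ = 0 := by rw [h]; abel
    have := congrArg Fin.val h1
    simp [Fin.val_add] at this
    rw [Nat.mod_eq_of_lt (by omega)] at this
    omega

/-- `G` arises from `H` by joining the isolated vertex `v` to the vertices satisfying `N`. -/
structure Extends (H G : SimpleGraph V) (v : V) (N : V → Prop) : Prop where
  iso : ∀ x, ¬ H.Adj v x
  old : ∀ x y, x ≠ v → y ≠ v → (G.Adj x y ↔ H.Adj x y)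
  nbr : ∀ x, G.Adj v x ↔ N x

theorem Extends.le {H G : SimpleGraph V} {v : V} {N : V → Prop} (h : Extends H G v N) : H ≤ G := by
  intro x y hxy
  refine (h.old x y ?_ ?_).2 hxy
  · rintro rfl; exact h.iso _ hxy
  · rintro rfl; exact h.iso _ hxy.symm

theorem extends_res (G : SimpleGraph V) {S : Set V} {v : V} (hv : v ∉ S) :
    Extends (res G S) (res G (insert v S)) v (fun x => G.Adj v x ∧ x ∈ S) := by
  refine ⟨fun x h => hv h.2.1, ?_, ?_⟩
  · intro x y hx hy; simp [res_adj, hx, hy]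
  · intro x; simp only [res_adj, Set.mem_insert_iff, true_or, true_and]
    constructor
    · rintro ⟨h, rfl | h'⟩
      · exact absurd rfl h.ne
      · exact ⟨h, h'⟩
    · rintro ⟨h, h'⟩; exact ⟨h, Or.inr h'⟩

theorem Extends.embedding_of_not_mem {H G : SimpleGraph V} {v : V} {N : V → Prop} (h : Extends H G v N)
    (hH : H.IsChordal) {k : ℕ} (hk : 4 ≤ k) (φ : cycleGraph k ↪g G) : ∃ i, φ i = v := by
  by_contra! hno
  refine hH k hk ⟨⟨φ.toEmbedding, ?_⟩⟩
  intro i j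
  rw [← φ.map_rel_iff]
  exact (h.old _ _ (hno i) (hno j)).symm

/-- Adding a simplicial vertex keeps a graph chordal. -/
theorem Extends.isChordal_of_clique {H G : SimpleGraph V} {v : V} {N : V → Prop} (h : Extends H G v N)
    (hH : H.IsChordal) (hN : ∀ x y, N x → N y → x ≠ y → G.Adj x y) : G.IsChordal := by
  rintro k hk ⟨φ⟩
  have : NeZero k := ⟨by omega⟩
  obtain ⟨i, rfl⟩ := h.embedding_of_not_mem hH hk φ
  obtain ⟨h1, h2, h3, h4⟩ := cycleGraph_adj_add_one hk i
  refine h3 (φ.map_rel_iff.1 (hN _ _ ((h.nbr _).1 (φ.map_rel_iff.2 h1)) ((h.nbr _).1 (φ.map_rel_iff.2 h2)) ?_))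
  exact fun he => h4 (φ.injective he)

/-- Adding a vertex `v` that forms a diamond with two consecutive bridges keeps a graph chordal. -/
theorem Extends.isChordal_of_diamond {H G : SimpleGraph V} {v p g q : V}
    (h : Extends H G v (fun x => x = p ∨ x = g ∨ x = q))
    (hH : H.IsChordal) (hpg : H.Adj p g) (hgq : H.Adj g q)
    (hn1 : ∀ w, H.Adj w p → ¬ H.Adj w g) (hn2 : ∀ w, H.Adj w q → ¬ H.Adj w g) : G.IsChordal := by
  rintro k hk ⟨φ⟩
  have : NeZero k := ⟨by omega⟩
  obtain ⟨i, hi⟩ := h.embedding_of_not_mem hH hk φ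
  obtain ⟨h1, h2, h3, h4⟩ := cycleGraph_adj_add_one hk i
  have a1 := (h.nbr (φ (i + 1))).1 (hi ▸ φ.map_rel_iff.2 h1)
  have a2 := (h.nbr (φ (i - 1))).1 (hi ▸ φ.map_rel_iff.2 h2)
  have a3 : ¬ G.Adj (φ (i + 1)) (φ (i - 1)) := fun hh => h3 (φ.map_rel_iff.1 hh)
  have a4 : φ (i + 1) ≠ φ (i - 1) := fun he => h4 (φ.injective he)
  have gpg := h.le hpg
  have ggq := h.le hgq
  have b1 : φ (i + 1) ≠ g := by
    intro e; rw [e] at a3 a4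
    rcases a2 with e' | e' | e' <;> rw [e'] at a3 a4
    · exact a3 gpg.symm
    · exact a4 rfl
    · exact a3 ggq
  have b2 : φ (i - 1) ≠ g := by
    intro e; rw [e] at a3 a4
    rcases a1 with e' | e' | e' <;> rw [e'] at a3 a4
    · exact a3 gpg
    · exact a4 rfl
    · exact a3 ggq.symm
  -- Both cycle neighbours of `v` are now among `p` and `q`, hence adjacent to `g` in `H`, so `g`
  -- can take the place of `v` on the cycle.
  have c1 : H.Adj g (φ (i + 1)) ∧ ∀ w, H.Adj w g → ¬ H.Adj w (φ (i + 1)) := by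
    rcases a1 with e | e | e
    · rw [e]; exact ⟨hpg.symm, fun w h1 h2 => hn1 w h2 h1⟩
    · exact absurd e b1
    · rw [e]; exact ⟨hgq, fun w h1 h2 => hn2 w h2 h1⟩
  have c2 : H.Adj g (φ (i - 1)) := by
    rcases a2 with e | e | e
    · rw [e]; exact hpg.symm
    · exact absurd e b2
    · rw [e]; exact hgq
  -- no other vertex of the cycle equals `g`
  have hvg : G.Adj v g := (h.nbr g).2 (Or.inr (Or.inl rfl))
  have hg : ∀ j, φ j ≠ g := by
    intro j hj
    rw [← hi, ← hj, φ.map_rel_iff] at hvg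
    rw [cycleGraph_adj'] at hvg
    rcases hvg with e | e
    · have : i - j = 1 := Fin.ext (by rw [e, Fin.val_one', Nat.mod_eq_of_lt (by omega)])
      exact b2 (by rw [← hj, ← this]; congr 1; abel)
    · have : j - i = 1 := Fin.ext (by rw [e, Fin.val_one', Nat.mod_eq_of_lt (by omega)])
      exact b1 (by rw [← hj, ← this]; congr 1; abel)
  -- The numbering starts just after `i`, so that `v` comes last and the replacement `g` is an end
  -- of the closing edge, which would then be a triangle-free edge on a cycle of `H`.
  let ψ : ℕ → Fin k := fun s => i + 1 + (Fin.ofNat k s)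
  have hψ : ∀ a < k, ∀ b < k, ψ a = ψ b → a = b := by
    intro a ha b hb hab
    have := add_left_cancel hab
    have := congrArg Fin.val this
    simpa [Fin.ofNat, Nat.mod_eq_of_lt ha, Nat.mod_eq_of_lt hb] using this
  have hψk : ψ (k - 1) = i := by
    have : ((Fin.ofNat k (k - 1)) : Fin k) = -1 := by
      rw [eq_neg_iff_add_eq_zero]
      apply Fin.ext
      rw [Fin.val_add, Fin.val_one', Nat.mod_eq_of_lt (show 1 < k by omega), Fin.val_ofNat,
        Nat.mod_eq_of_lt (show k - 1 < k by omega), Nat.sub_add_cancel (by omega), Nat.mod_self]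
      rfl
    simp only [ψ, this]; abel
  have hψs : ∀ a, ψ (a + 1) = ψ a + 1 := by
    intro a
    simp only [ψ]
    rw [show (Fin.ofNat k (a + 1)) = Fin.ofNat k a + 1 by apply Fin.ext; simp [Fin.val_add, Fin.ofNat], ← add_assoc]
  have hψ0 : ψ 0 = i + 1 := by simp [ψ]
  have hψl : ψ (k - 2) = i - 1 := by
    have := hψs (k - 2)
    rw [show k - 2 + 1 = k - 1 by omega, hψk] at this
    rw [this]; abel
  have hcyc : IsCyc H (fun s => if s = k - 1 then g else φ (ψ s)) k := by
    refine ⟨?_, ?_, ?_⟩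
    · intro a ha b hb hab
      beta_reduce at hab
      split_ifs at hab with e1 e2 e2
      · omega
      · exact absurd hab.symm (hg _)
      · exact absurd hab (hg _)
      · exact hψ a ha b hb (φ.injective hab)
    · intro a ha
      rw [if_neg (by omega)]
      split_ifs with e
      · rw [show a = k - 2 by omega, hψl]; exact c2.symm
      · refine (h.old _ _ ?_ ?_).1 (φ.map_rel_iff.2 ?_)
        · rw [← hi, ← hψk]; intro e'
          have := hψ _ (by omega) _ (by omega) (φ.injective e'); omega
        · rw [← hi, ← hψk]; intro e'
          have := hψ _ (by omega) _ (by omega) (φ.injective e'); omega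
        · rw [hψs]; exact (cycleGraph_adj_add_one hk _).1
    · rw [if_pos rfl, if_neg (by omega), hψ0]; exact c1.1
  obtain ⟨w, hw1, hw2⟩ := hH.exists_common_of_isCyc k _ (by omega) hcyc
  simp only [if_true] at hw1 hw2
  rw [if_neg (by omega), hψ0] at hw2
  exact c1.2 w hw1 hw2

/-! ### Decycling matchings and the configurations they exclude. -/

/-- `M` is a matching of `H` whose removal leaves a forest. -/
structure Decyc (H M : SimpleGraph V) : Prop where
  le : M ≤ H
  mat : ∀ a b c, M.Adj a b → M.Adj a c → b = c
  acyc : (H \ M).IsAcyclic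

/-- Matchings become graphs on all of `V`, which makes it easy to restrict them, to add edges and to
delete edges. -/
theorem isMDecyclable_iff {G : SimpleGraph V} : G.IsMDecyclable ↔ ∃ M, Decyc G M := by
  constructor
  · rintro ⟨M, hM, hA⟩
    refine ⟨M.spanningCoe, fun a b h => M.adj_sub h, ?_, ?_⟩
    · intro a b c h1 h2
      exact (hM (M.edge_vert h1)).unique h1 h2
    · refine hA.anti ?_
      intro a b h
      simpa [sdiff_adj, deleteEdges_adj] using h
  · rintro ⟨M, hM⟩
    refine ⟨⟨M.support, M.Adj, fun h => hM.le h, fun {a b} h => ⟨b, h⟩, M.symm⟩, ?_, ?_⟩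
    · rintro a ⟨b, hb⟩
      exact ⟨b, hb, fun c hc => hM.mat _ _ _ hc hb⟩
    · refine hM.acyc.anti ?_
      intro a b h
      simp only [deleteEdges_adj, sdiff_adj] at h ⊢
      exact h

theorem SimpleGraph.IsAcyclic.false_of_triangle {K : SimpleGraph V} (hK : K.IsAcyclic) {a b c : V}
    (h1 : K.Adj a b) (h2 : K.Adj b c) (h3 : K.Adj c a) : False := by
  have := isAcyclic_iff_forall_adj_isBridge.1 hK h1
  rw [isBridge_iff] at this
  refine this (Reachable.trans (v := c) (Adj.reachable ?_) (Adj.reachable ?_))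
  · simp [deleteEdges_adj, h3.symm, h2.ne', h1.ne]
  · simp only [deleteEdges_adj, h2.symm, Set.mem_singleton_iff, Sym2.eq_iff, true_and]
    rintro (⟨rfl, _⟩ | ⟨rfl, _⟩)
    · exact h3.ne rfl
    · exact h2.ne rfl

theorem SimpleGraph.IsAcyclic.false_of_square {K : SimpleGraph V} (hK : K.IsAcyclic) {a b c d : V}
    (h1 : K.Adj a b) (h2 : K.Adj b c) (h3 : K.Adj c d) (h4 : K.Adj d a) (hac : a ≠ c) (hbd : b ≠ d) :
    False := by
  have := isAcyclic_iff_forall_adj_isBridge.1 hK h1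
  rw [isBridge_iff] at this
  refine this (Reachable.trans (v := d) (Adj.reachable ?_)
    (Reachable.trans (v := c) (Adj.reachable ?_) (Adj.reachable ?_)))
  · simp [deleteEdges_adj, h4.symm, hbd.symm, h1.ne]
  · simp [deleteEdges_adj, h3.symm, h4.ne, hac.symm]
  · simp only [deleteEdges_adj, h2.symm, Set.mem_singleton_iff, Sym2.eq_iff, true_and]
    rintro (⟨rfl, _⟩ | ⟨rfl, _⟩)
    · exact hac rfl
    · exact h2.ne rfl

namespace Decyc

variable {H M : SimpleGraph V} (h : Decyc H M)
include h

theorem triangle {a b c : V} (h1 : H.Adj a b) (h2 : H.Adj b c) (h3 : H.Adj c a) :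
    M.Adj a b ∨ M.Adj b c ∨ M.Adj c a := by
  by_contra! hn
  exact h.acyc.false_of_triangle (a := a) (b := b) (c := c) ⟨h1, hn.1⟩ ⟨h2, hn.2.1⟩ ⟨h3, hn.2.2⟩

theorem square {a b c d : V} (h1 : H.Adj a b) (h2 : H.Adj b c) (h3 : H.Adj c d) (h4 : H.Adj d a)
    (hac : a ≠ c) (hbd : b ≠ d) : M.Adj a b ∨ M.Adj b c ∨ M.Adj c d ∨ M.Adj d a := by
  by_contra! hn
  exact h.acyc.false_of_square (a := a) (b := b) (c := c) (d := d)
    ⟨h1, hn.1⟩ ⟨h2, hn.2.1⟩ ⟨h3, hn.2.2.1⟩ ⟨h4, hn.2.2.2⟩ hac hbd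

/-- In a diamond with hubs `x`, `y` and tips `s`, `t`, the matching is perfect and avoids `x y`. -/
theorem diamond {x y s t : V} (hxy : H.Adj x y) (hsx : H.Adj s x) (hsy : H.Adj s y)
    (htx : H.Adj t x) (hty : H.Adj t y) (hst : s ≠ t) :
    ¬ M.Adj x y ∧ (M.Adj s x ∧ M.Adj t y ∨ M.Adj s y ∧ M.Adj t x) := by
  have t1 := h.triangle hxy hsy.symm hsx
  have t2 := h.triangle hxy hty.symm htx
  have q := h.square hsx.symm hsy hty.symm htx hxy.ne hst
  have sym : ∀ a b, M.Adj a b → M.Adj b a := fun _ _ h => h.symm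
  have mat := h.mat
  have n1 := hsx.ne; have n2 := hsy.ne; have n3 := htx.ne; have n4 := hty.ne; have n5 := hxy.ne
  -- The outer square needs a matched edge too, and each of its edges shares an end with `x y`.
  have nxy : ¬ M.Adj x y := by
    intro hM
    rcases q with q | q | q | q
    · exact n2 (mat _ _ _ q hM)
    · exact n1 (mat _ _ _ q.symm hM.symm)
    · exact n3 (mat _ _ _ q hM.symm)
    · exact n4 (mat _ _ _ q.symm hM)
  refine ⟨nxy, ?_⟩
  rcases t1 with t1 | t1 | t1
  · exact absurd t1 nxy
  · rcases t2 with t2 | t2 | t2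
    · exact absurd t2 nxy
    · exact absurd (mat _ _ _ t1 t2) hst
    · exact Or.inr ⟨t1.symm, t2⟩
  · rcases t2 with t2 | t2 | t2
    · exact absurd t2 nxy
    · exact Or.inl ⟨t1, t2.symm⟩
    · exact absurd (mat _ _ _ t1.symm t2.symm) hst

/-- Any two of the four vertices can be taken as hubs of a diamond, and hubs are never matched to
each other. -/
theorem no_clique_four {x y s t : V} (hxy : H.Adj x y) (hsx : H.Adj s x) (hsy : H.Adj s y)
    (htx : H.Adj t x) (hty : H.Adj t y) (hst : H.Adj s t) : False := by
  have d1 := (h.diamond hxy hsx hsy htx hty hst.ne).2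
  have d2 := (h.diamond (x := s) (y := x) (s := y) (t := t) hsx hsy.symm hxy.symm hst.symm htx hty.ne').1
  have d3 := (h.diamond (x := s) (y := y) (s := x) (t := t) hsy hsx.symm hxy hst.symm hty htx.ne').1
  rcases d1 with d | d
  · exact d2 d.1
  · exact d3 d.1

/-- No three consecutive triangles around a vertex `a`. -/
theorem no_fan {a b c d e : V} (hab : H.Adj a b) (hac : H.Adj a c) (had : H.Adj a d) (hae : H.Adj a e)
    (hbc : H.Adj b c) (hcd : H.Adj c d) (hde : H.Adj d e) (hbd : b ≠ d) (hce : c ≠ e) (hbe : b ≠ e) :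
    False := by
  have d1 := h.diamond hac hab.symm hbc had.symm hcd.symm hbd
  have d2 := h.diamond had hac.symm hcd hae.symm hde.symm hce
  have mat := h.mat
  -- The first diamond forbids `a c`, so the second one forces `c d` and `e a`; neither perfect
  -- matching of the first is compatible with these.
  rcases d2.2 with ⟨x, _⟩ | ⟨x, y⟩
  · exact d1.1 x.symm
  · rcases d1.2 with ⟨z, _⟩ | ⟨z, _⟩
    · exact hbe (mat _ _ _ z.symm y.symm)
    · exact hbd (mat _ _ _ z.symm x)

end Decyc

theorem SimpleGraph.IsChordal.square {G : SimpleGraph V} (hG : G.IsChordal) {a b c d : V}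
    (h1 : G.Adj a b) (h2 : G.Adj b c) (h3 : G.Adj c d) (h4 : G.Adj d a) (hac : a ≠ c) (hbd : b ≠ d) :
    G.Adj a c ∨ G.Adj b d := by
  let f : ℕ → V := fun n => match n with | 0 => a | 1 => b | 2 => c | _ => d
  have hf : IsCyc G f 4 := by
    refine ⟨?_, ?_, ?_⟩
    · intro i hi j hj hij
      have := h1.ne; have := h2.ne; have := h3.ne; have := h4.ne
      interval_cases i <;> interval_cases j <;> simp_all [f]
    · intro i hi
      have : i < 3 := by omega
      interval_cases i
      · exact h1
      · exact h2
      · exact h3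
    · exact h4
  obtain ⟨i, j, hij, hj, hne, hadj⟩ := hG.exists_chord (by omega) hf
  interval_cases j
  · omega
  · omega
  · obtain rfl : i = 0 := by omega
    exact Or.inl hadj
  · obtain rfl : i = 1 := by omega
    exact Or.inr hadj

/-- The chord cuts off a square `a c d e`, and either chord of that square completes three
consecutive triangles around `a` or around `c`. -/
theorem Decyc.no_five_cycle_of_chord {G M : SimpleGraph V} (hG : G.IsChordal) (hM : Decyc G M)
    {a b c d e : V} (hab : G.Adj a b) (hbc : G.Adj b c) (hcd : G.Adj c d) (hde : G.Adj d e)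
    (hea : G.Adj e a) (hac : G.Adj a c) (had : a ≠ d) (hbd : b ≠ d) (hbe : b ≠ e) (hce : c ≠ e) :
    False := by
  rcases hG.square hac hcd hde hea had hce with h | h
  · exact hM.no_fan hab hac h hea.symm hbc hcd hde hbd hce hbe
  · exact hM.no_fan hbc.symm hac.symm h hcd hab.symm hea.symm hde.symm hbe had hbd

/-- The two parts at a chord have lengths adding up to `k + 2`, so for `k ≥ 7` one of them has
length at least five. A hexagon could only be halved into squares, but a chord of such a square cuts
a triangle off the hexagon and leaves a pentagon. Pentagons are excluded by fans. -/
theorem Decyc.no_long_cycle {G M : SimpleGraph V} (hG : G.IsChordal) (hM : Decyc G M) :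
    ∀ (k : ℕ) (f : ℕ → V), 5 ≤ k → ¬ IsCyc G f k := by
  intro k
  induction k using Nat.strong_induction_on with
  | _ k ih =>
    intro f hk hf
    have step : ∀ i j, i + 2 ≤ j → j < k → ¬ (i = 0 ∧ j = k - 1) → G.Adj (f i) (f j) →
        ¬ (5 ≤ j - i + 1 ∨ 5 ≤ k - (j - i) + 1) := by
      rintro i j hij hj hne h (h5 | h5)
      · exact ih _ (by omega) _ h5 (hf.inner hij hj h)
      · exact ih _ (by omega) _ h5 (hf.outer hij hj h)
    obtain ⟨i, j, hij, hj, hne, h⟩ := hG.exists_chord (by omega) hf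
    have := step i j hij hj hne h
    have hd : ∀ a < k, ∀ b < k, a ≠ b → f a ≠ f b := fun a ha b hb hab e => hab (hf.inj a ha b hb e)
    have hk' : k = 6 ∧ j = i + 3 ∨ k = 5 := by omega
    rcases hk' with ⟨rfl, rfl⟩ | rfl
    · rcases hG.square (hf.adj i (by omega)) (hf.adj (i + 1) (by omega)) (hf.adj (i + 2) (by omega)) h.symm
        (hd _ (by omega) _ (by omega) (by omega)) (hd _ (by omega) _ (by omega) (by omega)) with h | h
      · exact step i (i + 2) (by omega) (by omega) (by omega) h (by omega)
      · exact step (i + 1) (i + 3) (by omega) (by omega) (by omega) h (by omega)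
    · have a0 := hf.adj 0 (by omega)
      have a1 := hf.adj 1 (by omega)
      have a2 := hf.adj 2 (by omega)
      have a3 := hf.adj 3 (by omega)
      have a4 := hf.close
      simp only [Nat.reduceAdd, Nat.reduceSub, zero_add] at a0 a1 a2 a3 a4
      have d02 := hd 0 (by omega) 2 (by omega) (by omega)
      have d03 := hd 0 (by omega) 3 (by omega) (by omega)
      have d13 := hd 1 (by omega) 3 (by omega) (by omega)
      have d14 := hd 1 (by omega) 4 (by omega) (by omega)
      have d24 := hd 2 (by omega) 4 (by omega) (by omega)
      have hc : i = 0 ∧ j = 2 ∨ i = 0 ∧ j = 3 ∨ i = 1 ∧ j = 3 ∨ i = 1 ∧ j = 4 ∨ i = 2 ∧ j = 4 := by omega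
      rcases hc with ⟨rfl, rfl⟩ | ⟨rfl, rfl⟩ | ⟨rfl, rfl⟩ | ⟨rfl, rfl⟩ | ⟨rfl, rfl⟩
      · exact hM.no_five_cycle_of_chord hG a0 a1 a2 a3 a4 h d03 d13 d14 d24
      · exact hM.no_five_cycle_of_chord hG a3 a4 a0 a1 a2 h.symm d13.symm d14.symm d24.symm d02
      · exact hM.no_five_cycle_of_chord hG a1 a2 a3 a4 a0 h d14 d24 d02.symm d03.symm
      · exact hM.no_five_cycle_of_chord hG a4 a0 a1 a2 a3 h.symm d24.symm d02 d03 d13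
      · exact hM.no_five_cycle_of_chord hG a2 a3 a4 a0 a1 h d02.symm d03.symm d13.symm d14.symm

/-! ### How attaching a vertex changes the sets that can be left uncovered. -/

/-- Some decycling matching leaves every vertex satisfying `R` uncovered. -/
def Avoid (H : SimpleGraph V) (R : V → Prop) : Prop :=
  ∃ M, Decyc H M ∧ ∀ x y, R x → ¬ M.Adj x y

theorem Decyc.inf {H G M : SimpleGraph V} (hM : Decyc G M) (h : H ≤ G) : Decyc H (M ⊓ H) := by
  refine ⟨inf_le_right, fun a b c h1 h2 => hM.mat a b c h1.1 h2.1, hM.acyc.anti ?_⟩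
  intro a b hab
  exact ⟨h hab.1, fun h' => hab.2 ⟨h', hab.1⟩⟩

/-- A bridge lies on no cycle, so it can be handed back to the forest; this frees both of its ends.
-/
theorem Decyc.deleteBridge {H M : SimpleGraph V} (hM : Decyc H M) {a b : V} (hb : H.IsBridge s(a, b))
    (hab : M.Adj a b) : Decyc H (M.deleteEdges {s(a, b)}) := by
  refine ⟨(deleteEdges_le _).trans hM.le, ?_, ?_⟩
  · intro x y z h1 h2
    exact hM.mat x y z (deleteEdges_le _ h1) (deleteEdges_le _ h2)
  · have hr : ¬ (H \ M).Reachable a b := by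
      intro hr
      refine hb (hr.mono ?_)
      intro x y hxy
      simp only [deleteEdges_adj, Set.mem_singleton_iff, Sym2.eq_iff]
      refine ⟨hxy.1, ?_⟩
      rintro (⟨rfl, rfl⟩ | ⟨rfl, rfl⟩)
      · exact hxy.2 hab
      · exact hxy.2 hab.symm
    refine (hM.acyc.sup_edge_of_not_reachable hr).anti ?_
    intro x y hxy
    simp only [sdiff_adj, deleteEdges_adj, Set.mem_singleton_iff, Sym2.eq_iff, sup_adj, edge_adj] at hxy ⊢
    have := hxy.1.ne
    tauto

theorem not_reachable_of_isolated {K : SimpleGraph V} {v x : V} (hv : ∀ y, ¬ K.Adj v y) (hx : v ≠ x) :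
    ¬ K.Reachable v x := by
  rintro ⟨w⟩
  cases w with
  | nil => exact hx rfl
  | cons h _ => exact hv _ h

/-- Rerouting an edge of a forest through an isolated vertex. -/
theorem SimpleGraph.IsAcyclic.subdivide {K : SimpleGraph V} (hK : K.IsAcyclic) {v a b : V}
    (hv : ∀ y, ¬ K.Adj v y) (hab : K.Adj a b) (hva : v ≠ a) (hvb : v ≠ b) :
    (K.deleteEdges {s(a, b)} ⊔ edge v b ⊔ edge v a).IsAcyclic := by
  have h1 : (K ⊔ edge v b).IsAcyclic := hK.sup_edge_of_not_reachable (not_reachable_of_isolated hv hvb)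
  have h2 : (K ⊔ edge v b).IsBridge s(a, b) := isAcyclic_iff_forall_adj_isBridge.1 h1 (Or.inl hab)
  have h3 : K.deleteEdges {s(a, b)} ⊔ edge v b ≤ (K ⊔ edge v b).deleteEdges {s(a, b)} := by
    intro x y hxy
    simp only [sup_adj, deleteEdges_adj, edge_adj, Set.mem_singleton_iff, Sym2.eq_iff] at hxy ⊢
    refine ⟨by tauto, ?_⟩
    have := hab.ne
    rintro (⟨rfl, rfl⟩ | ⟨rfl, rfl⟩) <;> grind
  refine (h1.anti (h3.trans (deleteEdges_le _))).sup_edge_of_not_reachable ?_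
  intro hr
  refine h2 (Reachable.trans (hr.symm.mono h3) (Adj.reachable ?_))
  apply h3
  right
  simp [edge_adj, hvb]

theorem Extends.not_self {H G : SimpleGraph V} {v : V} {N : V → Prop} (h : Extends H G v N) : ¬ N v :=
  fun hN => ((h.nbr v).2 hN).ne rfl

/-- With `v a` matched, the remaining edge `v b` hangs `v` on the forest as a leaf. -/
theorem Extends.decyc_pendant {H G M : SimpleGraph V} {v a b : V}
    (h : Extends H G v (fun x => x = a ∨ x = b)) (hM : Decyc H M) (ha : ∀ y, ¬ M.Adj a y) :
    Decyc G (M ⊔ edge v a) := by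
  have hn := h.not_self
  have hvM : ∀ y, ¬ M.Adj v y := fun y hy => h.iso _ (hM.le hy)
  have e1 : ∀ x y, M.Adj x y → x ≠ v ∧ x ≠ a := by
    rintro x y hxy
    exact ⟨by rintro rfl; exact hvM _ hxy, by rintro rfl; exact ha _ hxy⟩
  refine ⟨?_, ?_, ?_⟩
  · refine sup_le (hM.le.trans h.le) ?_
    intro x y hxy
    simp only [edge_adj] at hxy
    rcases hxy.1 with ⟨rfl, rfl⟩ | ⟨rfl, rfl⟩
    · exact (h.nbr _).2 (Or.inl rfl)
    · exact ((h.nbr _).2 (Or.inl rfl)).symm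
  · intro x y z h1 h2
    simp only [sup_adj, edge_adj] at h1 h2
    have m := hM.mat x y z
    have := e1 x y; have := e1 x z
    grind
  · refine (hM.acyc.sup_edge_of_not_reachable (u := v) (v := b) (not_reachable_of_isolated (K := H \ M)
      (fun y hy => h.iso _ hy.1) (by rintro rfl; exact hn (Or.inr rfl)))).anti ?_
    intro x y hxy
    have hne := hxy.1.ne
    simp only [sdiff_adj, sup_adj, edge_adj] at hxy ⊢
    have := h.old x y; have := h.nbr y; have := h.nbr x; have := hxy.1.symm
    rcases eq_or_ne x v with e1 | e1 <;> rcases eq_or_ne y v with e2 | e2 <;> grind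

/-- A vertex of degree at most one is on no cycle, so its edge never has to be matched. -/
theorem avoid_pendant {H G : SimpleGraph V} {v a : V} {N : V → Prop} (h : Extends H G v N)
    (hN : ∀ x, N x → x = a) (R : V → Prop) : Avoid G R ↔ Avoid H R := by
  have hn := h.not_self
  constructor
  · rintro ⟨M, hM, hR⟩
    exact ⟨_, hM.inf h.le, fun x y hx hxy => hR x y hx hxy.1⟩
  · rintro ⟨M, hM, hR⟩
    refine ⟨M, ⟨hM.le.trans h.le, hM.mat, ?_⟩, hR⟩
    by_cases hNa : N a
    · refine (hM.acyc.sup_edge_of_not_reachable (u := v) (v := a) (not_reachable_of_isolated (K := H \ M)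
        (fun y hy => h.iso _ hy.1) (by rintro rfl; exact hn hNa))).anti ?_
      intro x y hxy
      have hne := hxy.1.ne
      simp only [sdiff_adj, sup_adj, edge_adj] at hxy ⊢
      have := h.old x y; have := h.nbr y; have := h.nbr x; have := hxy.1.symm
      rcases eq_or_ne x v with e1 | e1 <;> rcases eq_or_ne y v with e2 | e2 <;> grind
    · refine hM.acyc.anti ?_
      intro x y hxy
      simp only [sdiff_adj] at hxy ⊢
      have := h.old x y; have := h.nbr y; have := h.nbr x; have := hxy.1.symm
      rcases eq_or_ne x v with e1 | e1 <;> rcases eq_or_ne y v with e2 | e2 <;> grind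

/-- The three alternatives are the possible matched edges `v a`, `v b`, `a b` of the triangle. In
the last one `a` and `b` are both free in `H`, because the bridge can be dropped from the matching
there; conversely the forest edge `a b` is rerouted through `v`. -/
theorem avoid_triangle_of_isBridge {H G : SimpleGraph V} {v a b : V}
    (h : Extends H G v (fun x => x = a ∨ x = b)) (hab : H.Adj a b) (hbr : H.IsBridge s(a, b))
    (R : V → Prop) :
    Avoid G R ↔ (¬ R v ∧ ¬ R a ∧ Avoid H (fun x => R x ∨ x = a)) ∨
      (¬ R v ∧ ¬ R b ∧ Avoid H (fun x => R x ∨ x = b)) ∨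
      (¬ R a ∧ ¬ R b ∧ Avoid H (fun x => R x ∨ x = a ∨ x = b)) := by
  have hva : G.Adj v a := (h.nbr _).2 (Or.inl rfl)
  have hvb : G.Adj v b := (h.nbr _).2 (Or.inr rfl)
  constructor
  · rintro ⟨M, hM, hR⟩
    rcases hM.triangle hva (h.le hab) hvb.symm with m | m | m
    · left
      refine ⟨fun hv => hR _ _ hv m, fun ha => hR _ _ ha m.symm, _, hM.inf h.le, ?_⟩
      rintro x y (hx | rfl) hxy
      · exact hR x y hx hxy.1
      · obtain rfl := hM.mat _ _ _ hxy.1 m.symm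
        exact h.iso _ hxy.2.symm
    · right; right
      refine ⟨fun ha => hR _ _ ha m, fun hb => hR _ _ hb m.symm, _,
        (hM.inf h.le).deleteBridge hbr ⟨m, hab⟩, ?_⟩
      rintro x y hx hxy
      simp only [deleteEdges_adj, Set.mem_singleton_iff, Sym2.eq_iff] at hxy
      rcases hx with hx | rfl | rfl
      · exact hR x y hx hxy.1.1
      · exact hxy.2 (Or.inl ⟨rfl, hM.mat _ _ _ hxy.1.1 m⟩)
      · exact hxy.2 (Or.inr ⟨rfl, hM.mat _ _ _ hxy.1.1 m.symm⟩)
    · right; left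
      refine ⟨fun hv => hR _ _ hv m.symm, fun hb => hR _ _ hb m, _, hM.inf h.le, ?_⟩
      rintro x y (hx | rfl) hxy
      · exact hR x y hx hxy.1
      · obtain rfl := hM.mat _ _ _ hxy.1 m
        exact h.iso _ hxy.2.symm
  · rintro (⟨hv, ha, M, hM, hR⟩ | ⟨hv, hb, M, hM, hR⟩ | ⟨ha, hb, M, hM, hR⟩)
    · refine ⟨_, h.decyc_pendant hM (fun y => hR a y (Or.inr rfl)), ?_⟩
      intro x y hx hxy
      simp only [sup_adj, edge_adj] at hxy
      have := hR x y (Or.inl hx)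
      grind
    · have h' : Extends H G v (fun x => x = b ∨ x = a) :=
        ⟨h.iso, h.old, fun x => (h.nbr x).trans or_comm⟩
      refine ⟨_, h'.decyc_pendant hM (fun y => hR b y (Or.inr rfl)), ?_⟩
      intro x y hx hxy
      simp only [sup_adj, edge_adj] at hxy
      have := hR x y (Or.inl hx)
      grind
    · have hma : ∀ y, ¬ M.Adj a y := fun y => hR a y (Or.inr (Or.inl rfl))
      have hmb : ∀ y, ¬ M.Adj b y := fun y => hR b y (Or.inr (Or.inr rfl))
      refine ⟨M ⊔ edge a b, ⟨?_, ?_, ?_⟩, ?_⟩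
      · refine sup_le (hM.le.trans h.le) ?_
        intro x y hxy
        simp only [edge_adj] at hxy
        rcases hxy.1 with ⟨rfl, rfl⟩ | ⟨rfl, rfl⟩
        · exact h.le hab
        · exact h.le hab.symm
      · intro x y z h1 h2
        simp only [sup_adj, edge_adj] at h1 h2
        have m := hM.mat x y z
        grind
      · refine (hM.acyc.subdivide (v := v) (a := a) (b := b) (fun y hy => h.iso _ hy.1) ⟨hab, hma b⟩
          hva.ne hvb.ne).anti ?_
        intro x y hxy
        have hne := hxy.1.ne
        simp only [sdiff_adj, sup_adj, edge_adj, deleteEdges_adj, Set.mem_singleton_iff, Sym2.eq_iff] at hxy ⊢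
        have := h.old x y; have := h.nbr y; have := h.nbr x; have := hxy.1.symm
        rcases eq_or_ne x v with e1 | e1 <;> rcases eq_or_ne y v with e2 | e2 <;> grind
      · intro x y hx hxy
        simp only [sup_adj, edge_adj] at hxy
        have := hR x y (Or.inl hx)
        grind

/-- The tips `v`, `w` and the hubs `a`, `b` form a diamond, so `a b` is unmatched and `v` is matched
to one of the hubs. -/
theorem avoid_triangle_of_common {H G : SimpleGraph V} {v a b w : V}
    (h : Extends H G v (fun x => x = a ∨ x = b)) (hab : H.Adj a b) (hwa : H.Adj w a) (hwb : H.Adj w b)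
    (R : V → Prop) :
    Avoid G R ↔ ¬ R v ∧ ((¬ R a ∧ Avoid H (fun x => R x ∨ x = a)) ∨
      (¬ R b ∧ Avoid H (fun x => R x ∨ x = b))) := by
  have hva : G.Adj v a := (h.nbr _).2 (Or.inl rfl)
  have hvb : G.Adj v b := (h.nbr _).2 (Or.inr rfl)
  have hvw : v ≠ w := by rintro rfl; exact h.iso _ hwa
  constructor
  · rintro ⟨M, hM, hR⟩
    rcases (hM.diamond (h.le hab) hva hvb (h.le hwa) (h.le hwb) hvw).2 with ⟨m, m'⟩ | ⟨m, m'⟩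
    · refine ⟨fun hv => hR _ _ hv m, Or.inl ⟨fun ha => hR _ _ ha m.symm, _, hM.inf h.le, ?_⟩⟩
      rintro x y (hx | rfl) hxy
      · exact hR x y hx hxy.1
      · obtain rfl := hM.mat _ _ _ hxy.1 m.symm
        exact h.iso _ hxy.2.symm
    · refine ⟨fun hv => hR _ _ hv m, Or.inr ⟨fun hb => hR _ _ hb m.symm, _, hM.inf h.le, ?_⟩⟩
      rintro x y (hx | rfl) hxy
      · exact hR x y hx hxy.1
      · obtain rfl := hM.mat _ _ _ hxy.1 m.symm
        exact h.iso _ hxy.2.symm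
  · rintro ⟨hv, ⟨ha, M, hM, hR⟩ | ⟨hb, M, hM, hR⟩⟩
    · refine ⟨_, h.decyc_pendant hM (fun y => hR a y (Or.inr rfl)), ?_⟩
      intro x y hx hxy
      simp only [sup_adj, edge_adj] at hxy
      have := hR x y (Or.inl hx)
      grind
    · have h' : Extends H G v (fun x => x = b ∨ x = a) :=
        ⟨h.iso, h.old, fun x => (h.nbr x).trans or_comm⟩
      refine ⟨_, h'.decyc_pendant hM (fun y => hR b y (Or.inr rfl)), ?_⟩
      intro x y hx hxy
      simp only [sup_adj, edge_adj] at hxy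
      have := hR x y (Or.inl hx)
      grind

/-- Here `v` and `g` are the hubs. Either perfect matching of the diamond uses exactly one of the
bridges `p g`, `g q`; dropping it leaves `p`, `g`, `q` all uncovered in `H`. For the converse `v p`
and `g q` are matched, and the forest edge `g q` is rerouted through `v`. -/
theorem avoid_diamond {H G : SimpleGraph V} {v p g q : V}
    (h : Extends H G v (fun x => x = p ∨ x = g ∨ x = q)) (hpg : H.Adj p g) (hgq : H.Adj g q) (hpq : p ≠ q)
    (hb1 : H.IsBridge s(p, g)) (hb2 : H.IsBridge s(g, q)) (R : V → Prop) :
    Avoid G R ↔ ¬ R v ∧ ¬ R p ∧ ¬ R g ∧ ¬ R q ∧ Avoid H (fun x => R x ∨ x = p ∨ x = g ∨ x = q) := by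
  have hvp : G.Adj v p := (h.nbr _).2 (Or.inl rfl)
  have hvg : G.Adj v g := (h.nbr _).2 (Or.inr (Or.inl rfl))
  have hvq : G.Adj v q := (h.nbr _).2 (Or.inr (Or.inr rfl))
  constructor
  · rintro ⟨M, hM, hR⟩
    have hmat := hM.mat
    rcases (hM.diamond hvg hvp.symm (h.le hpg) hvq.symm (h.le hgq.symm) hpq).2 with ⟨m, m'⟩ | ⟨m, m'⟩
    · refine ⟨fun hv => hR _ _ hv m.symm, fun hv => hR _ _ hv m, fun hv => hR _ _ hv m'.symm,
        fun hv => hR _ _ hv m', _, (hM.inf h.le).deleteBridge hb2 ⟨m'.symm, hgq⟩, ?_⟩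
      intro x y hx hxy
      simp only [deleteEdges_adj, Set.mem_singleton_iff, Sym2.eq_iff] at hxy
      rcases hx with hx | rfl | rfl | rfl
      · exact hR x y hx hxy.1.1
      · obtain rfl := hmat _ _ _ hxy.1.1 m
        exact h.iso _ hxy.1.2.symm
      · exact hxy.2 (Or.inl ⟨rfl, hmat _ _ _ hxy.1.1 m'.symm⟩)
      · exact hxy.2 (Or.inr ⟨rfl, hmat _ _ _ hxy.1.1 m'⟩)
    · refine ⟨fun hv => hR _ _ hv m'.symm, fun hv => hR _ _ hv m, fun hv => hR _ _ hv m.symm,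
        fun hv => hR _ _ hv m', _, (hM.inf h.le).deleteBridge hb1 ⟨m, hpg⟩, ?_⟩
      intro x y hx hxy
      simp only [deleteEdges_adj, Set.mem_singleton_iff, Sym2.eq_iff] at hxy
      rcases hx with hx | rfl | rfl | rfl
      · exact hR x y hx hxy.1.1
      · exact hxy.2 (Or.inl ⟨rfl, hmat _ _ _ hxy.1.1 m⟩)
      · exact hxy.2 (Or.inr ⟨rfl, hmat _ _ _ hxy.1.1 m.symm⟩)
      · obtain rfl := hmat _ _ _ hxy.1.1 m'
        exact h.iso _ hxy.1.2.symm
  · rintro ⟨hv, hp, hg, hq, M, hM, hR⟩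
    have hmp : ∀ y, ¬ M.Adj p y := fun y => hR p y (Or.inr (Or.inl rfl))
    have hmg : ∀ y, ¬ M.Adj g y := fun y => hR g y (Or.inr (Or.inr (Or.inl rfl)))
    have hmq : ∀ y, ¬ M.Adj q y := fun y => hR q y (Or.inr (Or.inr (Or.inr rfl)))
    have hmv : ∀ y, ¬ M.Adj v y := fun y hy => h.iso _ (hM.le hy)
    have n1 := hpg.ne; have n2 := hgq.ne; have n3 := hvp.ne; have n4 := hvg.ne; have n5 := hvq.ne
    refine ⟨M ⊔ edge v p ⊔ edge g q, ⟨?_, ?_, ?_⟩, ?_⟩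
    · refine sup_le (sup_le (hM.le.trans h.le) ?_) ?_
      · intro x y hxy
        simp only [edge_adj] at hxy
        rcases hxy.1 with ⟨rfl, rfl⟩ | ⟨rfl, rfl⟩
        · exact hvp
        · exact hvp.symm
      · intro x y hxy
        simp only [edge_adj] at hxy
        rcases hxy.1 with ⟨rfl, rfl⟩ | ⟨rfl, rfl⟩
        · exact h.le hgq
        · exact h.le hgq.symm
    · intro x y z h1 h2
      simp only [sup_adj, edge_adj] at h1 h2
      have m := hM.mat x y z
      grind
    · refine (hM.acyc.subdivide (v := v) (a := g) (b := q) (fun y hy => h.iso _ hy.1) ⟨hgq, hmg q⟩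
        hvg.ne hvq.ne).anti ?_
      intro x y hxy
      have hne := hxy.1.ne
      simp only [sdiff_adj, sup_adj, edge_adj, deleteEdges_adj, Set.mem_singleton_iff, Sym2.eq_iff] at hxy ⊢
      have := h.old x y; have := h.nbr y; have := h.nbr x; have := hxy.1.symm
      rcases eq_or_ne x v with e1 | e1 <;> rcases eq_or_ne y v with e2 | e2 <;> grind
    · intro x y hx hxy
      simp only [sup_adj, edge_adj] at hxy
      have := hR x y (Or.inl hx)
      grind

theorem avoid_isolated {H : SimpleGraph V} {v : V} (hv : ∀ x, ¬ H.Adj v x) (R : V → Prop) :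
    Avoid H R ↔ Avoid H (fun x => R x ∧ x ≠ v) := by
  constructor
  · rintro ⟨M, hM, hR⟩
    exact ⟨M, hM, fun x y hx => hR x y hx.1⟩
  · rintro ⟨M, hM, hR⟩
    refine ⟨M, hM, fun x y hx hxy => ?_⟩
    rcases eq_or_ne x v with rfl | hne
    · exact hv _ (hM.le hxy)
    · exact hR x y ⟨hx, hne⟩ hxy

/-! ### Labels on the search path and the invariant they satisfy. -/

/-- Whether the component of the first vertex of a path still has a vertex to spare, given the
set `F` of vertices of saturated components. -/
def Spare (F : V → Prop) : List V → Prop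
  | [] => True
  | x :: _ => ¬ F x

/-- The vertices of a path that satisfy `R` are at most one in each group of consecutive vertices
linked by `C`, and none in a group whose first vertex satisfies `F`; the first group is
treated as if its first vertex satisfied `¬ b`. -/
def Sparse (C F R : V → Prop) : Prop → List V → Prop
  | _, [] => True
  | b, x :: l => (R x → b) ∧ Sparse C F R ((C x ∧ b ∧ ¬ R x) ∨ (¬ C x ∧ Spare F l)) l

theorem spare_cons {F : V → Prop} {x : V} {l : List V} : Spare F (x :: l) ↔ ¬ F x := Iff.rfl

theorem sparse_cons {C F R : V → Prop} {b : Prop} {x : V} {l : List V} :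
    Sparse C F R b (x :: l) ↔
      (R x → b) ∧ Sparse C F R ((C x ∧ b ∧ ¬ R x) ∨ (¬ C x ∧ Spare F l)) l := Iff.rfl

theorem Spare.congr {F F' : V → Prop} {l : List V} (hF : ∀ x ∈ l, F x ↔ F' x) :
    Spare F l ↔ Spare F' l := by
  cases l with
  | nil => rfl
  | cons x l => simp [Spare, hF]

theorem Sparse.congr {C F R C' F' R' : V → Prop} {l : List V} : ∀ {b b' : Prop},
    (∀ x ∈ l, C x ↔ C' x) → (∀ x ∈ l, F x ↔ F' x) → (∀ x ∈ l, R x ↔ R' x) → (b ↔ b') →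
    (Sparse C F R b l ↔ Sparse C' F' R' b' l) := by
  induction l with
  | nil => intros; rfl
  | cons x l ih =>
    intro b b' hC hF hR hb
    simp only [Sparse]
    simp only [hR x (by simp), hb]
    refine and_congr_right fun _ => ih (fun y hy => hC y (by simp [hy])) (fun y hy => hF y (by simp [hy]))
      (fun y hy => hR y (by simp [hy])) ?_
    rw [hC x (by simp), Spare.congr (fun y hy => hF y (by simp [hy]))]

theorem Sparse.mono {C F R : V → Prop} {l : List V} : ∀ {b b' : Prop}, (b → b') →
    Sparse C F R b l → Sparse C F R b' l := by
  induction l with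
  | nil => intros; trivial
  | cons x l ih =>
    intro b b' hb h
    exact ⟨fun hx => hb (h.1 hx), ih (by tauto) h.2⟩

/-- Reduces every value of `b` to two statements about the list, so that comparisons become
propositional. -/
theorem sparse_eq {C F R : V → Prop} {l : List V} (b : Prop) :
    Sparse C F R b l ↔ (b ∧ Sparse C F R True l) ∨ (¬ b ∧ Sparse C F R False l) := by
  by_cases hb : b <;> simp [hb]

/-- `l` is a path of a depth first search, the deepest vertex first, and `S` the set of vertices
visited so far. -/
structure SearchPath (G : SimpleGraph V) (S : Set V) (l : List V) : Prop where
  sub : ∀ x ∈ l, x ∈ S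
  nodup : l.Nodup
  chain : l.IsChain G.Adj
  closed : ∀ x ∈ S, x ∉ l → ∀ y, G.Adj x y → y ∈ S

/-- The labels of the vertices of the search path describe the visited part of the graph: `C` marks
the vertices whose edge to the preceding vertex lies in a triangle, `F` those in saturated
components, `A` those adjacent to the second vertex before them. -/
structure Labelled (G : SimpleGraph V) (S : Set V) (l : List V) (C F A : V → Prop) : Prop where
  chordal : (res G S).IsChordal
  tri : ∀ x p, [x, p] <:+: l → (C x ↔ ∃ w ∈ S, G.Adj w x ∧ G.Adj w p)
  grand : ∀ x p g, [x, p, g] <:+: l → (A x ↔ G.Adj x g)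
  avoid : ∀ R : V → Prop, (∀ x, R x → x ∈ l) → (Avoid (res G S) R ↔ Sparse C F R (Spare F l) l)

theorem pair_infix_cons {x y a : V} {l : List V} :
    [x, y] <:+: a :: l ↔ (x = a ∧ l.head? = some y) ∨ [x, y] <:+: l := by
  rw [List.infix_cons_iff, List.cons_prefix_cons]
  cases l with
  | nil => simp
  | cons b l => simp only [List.cons_prefix_cons, List.nil_prefix, and_true, List.head?_cons,
      Option.some.injEq, eq_comm (a := y)]

theorem triple_infix_cons {x y z a : V} {l : List V} :
    [x, y, z] <:+: a :: l ↔ (x = a ∧ [y, z] <+: l) ∨ [x, y, z] <:+: l := by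
  rw [List.infix_cons_iff, List.cons_prefix_cons]

theorem pair_infix_mem {x y : V} {l : List V} (h : [x, y] <:+: l) : x ∈ l ∧ y ∈ l :=
  ⟨h.subset (by simp), h.subset (by simp)⟩

theorem pair_infix_mem_tail {x y a : V} {l : List V} (h : [x, y] <:+: a :: l) : y ∈ l := by
  rcases pair_infix_cons.1 h with h | h
  · exact List.mem_of_mem_head? h.2
  · exact (pair_infix_mem h).2

/-! ### Entering a vertex at the end of the path, and removing it. -/

section Push

variable {G : SimpleGraph V} {S : Set V} {C F A C' F' A' : V → Prop} {v p g q : V} {l : List V}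

theorem SearchPath.push (hP : SearchPath G S l) (hv : v ∉ S) (hh : ∀ p ∈ l.head?, G.Adj v p) :
    SearchPath G (insert v S) (v :: l) := by
  refine ⟨?_, ?_, ?_, ?_⟩
  · intro x hx
    rcases List.mem_cons.1 hx with rfl | hx
    · exact Set.mem_insert _ _
    · exact Set.mem_insert_of_mem _ (hP.sub x hx)
  · exact List.nodup_cons.2 ⟨fun h => hv (hP.sub _ h), hP.nodup⟩
  · exact List.isChain_cons.2 ⟨hh, hP.chain⟩
  · intro x hx hxl y hy
    simp only [List.mem_cons, not_or] at hxl
    rcases hx with rfl | hx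
    · exact absurd rfl hxl.1
    · exact Set.mem_insert_of_mem _ (hP.closed x hx hxl.2 y hy)

/-- A visited vertex that has left the path has no unvisited neighbour. -/
theorem SearchPath.mem_of_adj (hP : SearchPath G S l) (hv : v ∉ S) {x : V} (hx : x ∈ S)
    (h : G.Adj v x) : x ∈ l := by
  by_contra hn
  exact hv (hP.closed x hx hn v h.symm)

/-- The invariant covers only sets on the old path, but `v` is isolated in the old graph, so a
demand on `v` costs nothing there. -/
theorem Labelled.avoid_insert (hL : Labelled G S l C F A) (hP : SearchPath G S l) (hv : v ∉ S)
    (R : V → Prop) (hR : ∀ x, R x → x ∈ v :: l) :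
    Avoid (res G S) R ↔ Sparse C F R (Spare F l) l := by
  rw [avoid_isolated (H := res G S) (v := v) (fun x h => hv h.2.1), hL.avoid]
  · refine Sparse.congr (fun _ _ => Iff.rfl) (fun _ _ => Iff.rfl) ?_ Iff.rfl
    intro x hx
    have : x ≠ v := by rintro rfl; exact hv (hP.sub _ hx)
    simp [this]
  · rintro x ⟨hx, hxv⟩
    simpa [hxv] using hR x hx

theorem tri_push (hL : Labelled G S l C F A)
    (hCv : ∀ p ∈ l.head?, C' v ↔ ∃ w ∈ S, G.Adj w v ∧ G.Adj w p)
    (hC : ∀ x y, [x, y] <:+: l → (C' x ↔ C x ∨ (G.Adj v x ∧ G.Adj v y))) (x p : V)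
    (h : [x, p] <:+: v :: l) : C' x ↔ ∃ w ∈ insert v S, G.Adj w x ∧ G.Adj w p := by
  rcases pair_infix_cons.1 h with ⟨rfl, h'⟩ | h
  · rw [hCv p h']; simp
  · rw [hC x p h, hL.tri x p h]
    simp only [Set.mem_insert_iff, exists_eq_or_imp]
    exact or_comm

theorem grand_push (hL : Labelled G S l C F A) (hv : v ∉ l)
    (hAv : ∀ p g, [p, g] <+: l → (A' v ↔ G.Adj v g)) (hA : ∀ x ∈ l, A' x ↔ A x) (x p g : V)
    (h : [x, p, g] <:+: v :: l) : A' x ↔ G.Adj x g := by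
  rcases triple_infix_cons.1 h with ⟨rfl, h'⟩ | h
  · exact hAv p g h'
  · rw [hA x (h.subset (by simp))]; exact hL.grand x p g h

/-- A new vertex with at most one visited neighbour, the end of the path. -/
theorem Labelled.push_pendant (hL : Labelled G S l C F A) (hP : SearchPath G S l) (hv : v ∉ S)
    (hN : ∀ x ∈ S, G.Adj v x → l.head? = some x)
    (hC : ∀ x ∈ l, C' x ↔ C x) (hF : ∀ x ∈ l, F' x ↔ F x) (hA : ∀ x ∈ l, A' x ↔ A x)
    (hCv : ¬ C' v) (hFv : ¬ F' v) (hAv : ¬ A' v) : Labelled G (insert v S) (v :: l) C' F' A' := by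
  have hvl : v ∉ l := fun h => hv (hP.sub _ h)
  have hE := extends_res G hv
  have hone : ∀ x y, (G.Adj v x ∧ x ∈ S) → (G.Adj v y ∧ y ∈ S) → x = y := by
    intro x y hx hy
    exact Option.some.inj ((hN x hx.2 hx.1).symm.trans (hN y hy.2 hy.1))
  refine ⟨?_, ?_, ?_, ?_⟩
  · exact hE.isChordal_of_clique hL.chordal (fun x y hx hy hne => absurd (hone x y hx hy) hne)
  · refine tri_push hL ?_ ?_
    · intro p hp
      refine iff_of_false hCv ?_
      rintro ⟨w, hw, h1, h2⟩
      have := Option.some.inj ((hN w hw h1.symm).symm.trans hp)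
      exact h2.ne this
    · intro x y hxy
      have hm := pair_infix_mem hxy
      rw [hC x hm.1]
      refine (or_iff_left ?_).symm
      rintro ⟨h1, h2⟩
      have := hone x y ⟨h1, hP.sub _ hm.1⟩ ⟨h2, hP.sub _ hm.2⟩
      subst this
      have := hP.nodup.sublist hxy.sublist
      simp at this
  · refine grand_push hL hvl ?_ hA
    intro p g hpg
    refine iff_of_false hAv fun h => ?_
    have h1 := hN g (hP.sub _ (hpg.subset (by simp))) h
    obtain ⟨t, rfl⟩ := hpg
    have := hP.nodup
    simp at h1
    simp [h1] at this
  · intro R hR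
    rcases hl : l.head? with _ | p
    · rw [avoid_pendant (a := v) hE (fun x hx => by rw [hN x hx.2 hx.1] at hl; cases hl)]
      rw [hL.avoid_insert hP hv R hR]
      simp only [Sparse, Spare, hFv, hCv, not_false_eq_true, implies_true, true_and, false_and, false_or]
      exact Sparse.congr (fun x hx => (hC x hx).symm) (fun x hx => (hF x hx).symm) (fun _ _ => Iff.rfl)
        (Spare.congr (fun x hx => (hF x hx).symm))
    · rw [avoid_pendant (a := p) hE (fun x hx => by rw [hN x hx.2 hx.1] at hl; exact Option.some.inj hl)]
      rw [hL.avoid_insert hP hv R hR]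
      simp only [Sparse, Spare, hFv, hCv, not_false_eq_true, implies_true, true_and, false_and, false_or]
      exact Sparse.congr (fun x hx => (hC x hx).symm) (fun x hx => (hF x hx).symm) (fun _ _ => Iff.rfl)
        (Spare.congr (fun x hx => (hF x hx).symm))

theorem extends_pair (hv : v ∉ S) (hp : p ∈ S) (hg : g ∈ S)
    (hN : ∀ x ∈ S, (G.Adj v x ↔ x = p ∨ x = g)) :
    Extends (res G S) (res G (insert v S)) v (fun x => x = p ∨ x = g) := by
  have hE := extends_res G hv
  refine ⟨hE.iso, hE.old, fun x => (hE.nbr x).trans ?_⟩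
  constructor
  · rintro ⟨h, hx⟩; exact (hN x hx).1 h
  · intro h
    have hx : x ∈ S := by rcases h with rfl | rfl <;> assumption
    exact ⟨(hN x hx).2 h, hx⟩

theorem extends_triple (hv : v ∉ S) (hp : p ∈ S) (hg : g ∈ S) (hq : q ∈ S)
    (hN : ∀ x ∈ S, (G.Adj v x ↔ x = p ∨ x = g ∨ x = q)) :
    Extends (res G S) (res G (insert v S)) v (fun x => x = p ∨ x = g ∨ x = q) := by
  have hE := extends_res G hv
  refine ⟨hE.iso, hE.old, fun x => (hE.nbr x).trans ?_⟩
  constructor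
  · rintro ⟨h, hx⟩; exact (hN x hx).1 h
  · intro h
    have hx : x ∈ S := by rcases h with rfl | rfl | rfl <;> assumption
    exact ⟨(hN x hx).2 h, hx⟩

theorem isChordal_insert_pair (hE : Extends (res G S) (res G (insert v S)) v (fun x => x = p ∨ x = g))
    (hc : (res G S).IsChordal) (hpg : (res G S).Adj p g) : (res G (insert v S)).IsChordal := by
  refine hE.isChordal_of_clique hc ?_
  rintro x y (rfl | rfl) (rfl | rfl) hne
  · exact absurd rfl hne
  · exact hE.le hpg
  · exact hE.le hpg.symm
  · exact absurd rfl hne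

theorem Labelled.isBridge (hL : Labelled G S l C F A) (hP : SearchPath G S l)
    (h : [p, g] <:+: l) (hpg : G.Adj p g) (hC : ¬ C p) : (res G S).IsBridge s(p, g) := by
  have hm := pair_infix_mem h
  refine hL.chordal.isBridge ⟨hpg, hP.sub _ hm.1, hP.sub _ hm.2⟩ ?_
  intro w h1 h2
  exact hC ((hL.tri p g h).2 ⟨w, h1.2.1, h1.1, h2.1⟩)

/-- A new vertex that forms a triangle with a bridge. -/
theorem Labelled.avoid_triangle_bridge (hL : Labelled G S (p :: g :: l) C F A)
    (hP : SearchPath G S (p :: g :: l)) (hv : v ∉ S)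
    (hN : ∀ x ∈ S, (G.Adj v x ↔ x = p ∨ x = g))
    (hC : ∀ x ∈ g :: l, C' x ↔ C x) (hF : ∀ x ∈ p :: g :: l, F' x ↔ F x)
    (hCp : ¬ C p) (hCv' : C' v) (hCp' : C' p) (hFv : F' v ↔ F p ∨ F g)
    (R : V → Prop) (hR : ∀ x, R x → x ∈ v :: p :: g :: l) :
    Avoid (res G (insert v S)) R ↔ ¬ (F p ∧ F g) ∧
      Sparse C' F' R (Spare F' (v :: p :: g :: l)) (v :: p :: g :: l) := by
  have hpS : p ∈ S := hP.sub _ (by simp)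
  have hgS : g ∈ S := hP.sub _ (by simp)
  have hE := extends_pair hv hpS hgS hN
  have hpg : G.Adj p g := by have := hP.chain; simp at this; exact this.1
  have hnd := hP.nodup
  simp only [List.nodup_cons, List.mem_cons, not_or] at hnd
  have hvl : v ∉ l := fun h => hv (hP.sub _ (by simp [h]))
  have hvp : v ≠ p := by rintro rfl; exact hv hpS
  have hvg : v ≠ g := by rintro rfl; exact hv hgS
  have key : ∀ (Q : V → Prop) (b : Prop), (∀ x ∈ l, Q x ↔ R x) → (Sparse C F Q b l ↔
      (b ∧ Sparse C' F' R True l) ∨ (¬ b ∧ Sparse C' F' R False l)) := by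
    intro Q b hQ
    rw [← sparse_eq]
    exact Sparse.congr (fun x hx => (hC x (by simp [hx])).symm)
      (fun x hx => (hF x (by simp [hx])).symm) hQ Iff.rfl
  have hmono : Sparse C' F' R False l → Sparse C' F' R True l := Sparse.mono (fun h => h.elim)
  have hsp : Spare F' l ↔ Spare F l := Spare.congr (fun x hx => hF x (by simp [hx]))
  have hl : ∀ x ∈ l, x ≠ p ∧ x ≠ g := by
    rintro x hx
    exact ⟨by rintro rfl; exact hnd.1.2 hx, by rintro rfl; exact hnd.2.1 hx⟩
  rw [avoid_triangle_of_isBridge hE ⟨hpg, hpS, hgS⟩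
    (hL.isBridge hP (by rw [pair_infix_cons]; simp) hpg hCp) R]
  rw [hL.avoid_insert hP hv (fun x => R x ∨ x = p) (by rintro x (h | rfl); exacts [hR x h, by simp]),
    hL.avoid_insert hP hv (fun x => R x ∨ x = g) (by rintro x (h | rfl); exacts [hR x h, by simp]),
    hL.avoid_insert hP hv (fun x => R x ∨ x = p ∨ x = g)
      (by rintro x (h | rfl | rfl); exacts [hR x h, by simp, by simp])]
  have key' : ∀ b : Prop, Sparse C' F' R b l ↔
      (b ∧ Sparse C' F' R True l) ∨ (¬ b ∧ Sparse C' F' R False l) := sparse_eq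
  generalize Sparse C' F' R True l = X at *
  generalize Sparse C' F' R False l = Y at *
  simp only [sparse_cons]
  rw [key _ _ (fun x hx => by simp [hl x hx]), key _ _ (fun x hx => by simp [hl x hx]),
    key _ _ (fun x hx => by simp [hl x hx]), key']
  simp only [spare_cons, hFv, hsp, hCv', hCp', hCp, hC g (by simp)]
  have n1 : g ≠ p := fun h => hnd.1.1 h.symm
  have n2 : p ≠ g := hnd.1.1
  generalize Spare F l = Z
  clear key key' hN hC hF hL hP hE
  -- The rest of the path enters only through `X`, `Y` with `Y → X`, and through `Z`; what remains
  -- is a truth table for the labels and demands at `v`, `p`, `g`.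
  by_cases h1 : F p <;> by_cases h2 : F g <;> by_cases h3 : C g <;> by_cases h4 : R v <;>
    by_cases h5 : R p <;> by_cases h6 : R g <;>
    simp only [h1, h2, h3, h4, h5, h6, n1, n2, true_and, and_true, false_and, and_false, or_true,
      false_or, or_false, not_true_eq_false, not_false_eq_true, imp_false,
      imp_true_iff, or_self, and_self] <;> tauto

theorem Sparse.anti {C F R R' : V → Prop} {l : List V} : ∀ {b b' : Prop}, (b → b') →
    (∀ x ∈ l, R' x → R x) → Sparse C F R b l → Sparse C F R' b' l := by
  induction l with
  | nil => intros; trivial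
  | cons x l ih =>
    intro b b' hb hR h
    have hx := hR x (by simp)
    refine ⟨fun h' => hb (h.1 (hx h')), ih (by tauto) (fun y hy => hR y (by simp [hy])) h.2⟩

/-- A new vertex that forms a triangle with an edge that is in a triangle already. -/
theorem Labelled.avoid_triangle_common (hL : Labelled G S (p :: l) C F A)
    (hP : SearchPath G S (p :: l)) (hv : v ∉ S) {y w : V} (hy : y ∈ l)
    (hN : ∀ x ∈ S, (G.Adj v x ↔ x = p ∨ x = y)) (hpy : G.Adj p y)
    (hw : w ∈ S) (hwp : G.Adj w p) (hwy : G.Adj w y)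
    (hsame : ∀ R : V → Prop, ¬ R y → Sparse C F (fun x => R x ∨ x = y) (¬ F p) (p :: l) →
      ¬ R p ∧ ¬ F p ∧ Sparse C F R False l)
    (hC : ∀ x ∈ p :: l, C' x ↔ C x) (hF : ∀ x ∈ p :: l, F' x ↔ F x)
    (hCp : C p) (hCv' : C' v) (hFv : F' v)
    (R : V → Prop) (hR : ∀ x, R x → x ∈ v :: p :: l) :
    Avoid (res G (insert v S)) R ↔ ¬ F p ∧
      Sparse C' F' R (Spare F' (v :: p :: l)) (v :: p :: l) := by
  have hpS : p ∈ S := hP.sub _ (by simp)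
  have hyS : y ∈ S := hP.sub _ (by simp [hy])
  have hE := extends_pair hv hpS hyS hN
  have hnd := hP.nodup
  simp only [List.nodup_cons] at hnd
  have hpl : ∀ x ∈ l, x ≠ p := by rintro x hx rfl; exact hnd.1 hx
  have hdrop : ∀ Q : V → Prop, (∀ x ∈ l, Q x ↔ R x) →
      (Sparse C F Q False l ↔ Sparse C' F' R False l) := fun Q hQ =>
    Sparse.congr (fun x hx => (hC x (by simp [hx])).symm) (fun x hx => (hF x (by simp [hx])).symm) hQ Iff.rfl
  rw [avoid_triangle_of_common hE ⟨hpy, hpS, hyS⟩ ⟨hwp, hw, hpS⟩ ⟨hwy, hw, hyS⟩ R]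
  rw [hL.avoid_insert hP hv (fun x => R x ∨ x = p) (by rintro x (h | rfl); exacts [hR x h, by simp]),
    hL.avoid_insert hP hv (fun x => R x ∨ x = y)
      (by rintro x (h | rfl); exacts [hR x h, by simp [hy]])]
  -- Matching `v` to `y` instead of `p` permits nothing new: both use up the one free vertex of the
  -- same group. So the alternative for `y` is absorbed by the one for `p`.
  have h1 : ¬ R y ∧ Sparse C F (fun x => R x ∨ x = y) (Spare F (p :: l)) (p :: l) →
      ¬ R p ∧ ¬ F p ∧ Sparse C F R False l := fun h => hsame R h.1 h.2
  rw [hdrop R (fun _ _ => Iff.rfl)] at h1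
  have h2 : Sparse C F (fun x => R x ∨ x = p) (Spare F (p :: l)) (p :: l) ↔
      ¬ F p ∧ Sparse C' F' R False l := by
    rw [sparse_cons, ← hdrop (fun x => R x ∨ x = p) (fun x hx => by simp [hpl x hx])]
    simp [spare_cons, hCp]
  rw [h2]
  obtain ⟨X, hX⟩ : ∃ X, X = Sparse C F (fun x => R x ∨ x = y) (Spare F (p :: l)) (p :: l) := ⟨_, rfl⟩
  rw [← hX] at h1 ⊢
  simp only [sparse_cons, spare_cons, hFv, hC p (by simp), hCp, hCv', not_true_eq_false, false_and, and_false,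
    or_false]
  tauto

/-- A new vertex that forms a diamond with two consecutive bridges. -/
theorem Labelled.avoid_diamond_bridges (hL : Labelled G S (p :: g :: q :: l) C F A)
    (hP : SearchPath G S (p :: g :: q :: l)) (hv : v ∉ S)
    (hN : ∀ x ∈ S, (G.Adj v x ↔ x = p ∨ x = g ∨ x = q))
    (hC : ∀ x ∈ q :: l, C' x ↔ C x) (hF : ∀ x ∈ p :: g :: q :: l, F' x ↔ F x)
    (hCp : ¬ C p) (hCg : ¬ C g) (hCv' : C' v) (hCp' : C' p) (hCg' : C' g) (hFv : F' v)
    (R : V → Prop) (hR : ∀ x, R x → x ∈ v :: p :: g :: q :: l) :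
    Avoid (res G (insert v S)) R ↔ (¬ F p ∧ ¬ F g ∧ ¬ F q) ∧
      Sparse C' F' R (Spare F' (v :: p :: g :: q :: l)) (v :: p :: g :: q :: l) := by
  have hpS : p ∈ S := hP.sub _ (by simp)
  have hgS : g ∈ S := hP.sub _ (by simp)
  have hqS : q ∈ S := hP.sub _ (by simp)
  have hE := extends_triple hv hpS hgS hqS hN
  have hch := hP.chain
  simp only [List.isChain_cons_cons] at hch
  have hnd := hP.nodup
  simp only [List.nodup_cons, List.mem_cons, not_or] at hnd
  have hl : ∀ x ∈ l, x ≠ p ∧ x ≠ g ∧ x ≠ q := by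
    rintro x hx
    refine ⟨?_, ?_, ?_⟩ <;> rintro rfl
    · exact hnd.1.2.2 hx
    · exact hnd.2.1.2 hx
    · exact hnd.2.2.1 hx
  have hdrop : ∀ b : Prop, Sparse C F (fun x => R x ∨ x = p ∨ x = g ∨ x = q) b l ↔ Sparse C' F' R b l :=
    fun b => Sparse.congr (fun x hx => (hC x (by simp [hx])).symm) (fun x hx => (hF x (by simp [hx])).symm)
      (fun x hx => by simp [hl x hx]) Iff.rfl
  have hsp : Spare F' l ↔ Spare F l := Spare.congr (fun x hx => hF x (by simp [hx]))
  rw [avoid_diamond hE ⟨hch.1, hpS, hgS⟩ ⟨hch.2.1, hgS, hqS⟩ hnd.1.2.1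
    (hL.isBridge hP (by rw [pair_infix_cons]; simp) hch.1 hCp)
    (hL.isBridge hP (by rw [pair_infix_cons, pair_infix_cons]; simp) hch.2.1 hCg) R]
  rw [hL.avoid_insert hP hv _ (by rintro x (h | rfl | rfl | rfl); exacts [hR x h, by simp, by simp, by simp])]
  simp only [sparse_cons, hdrop, spare_cons, hCv', hCp', hCg', hFv, hCp, hCg, hC q (by simp), hsp]
  simp
  tauto

/-- The groups of `p` and `g` merge. Together with `v` they offer at most three free vertices, and
the triangle consumes two: the new group is saturated if one of the old ones was, and there is no
matching if both were. -/
theorem Labelled.push_triangle_bridge (hL : Labelled G S (p :: g :: l) C F A)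
    (hP : SearchPath G S (p :: g :: l)) (hv : v ∉ S)
    (hN : ∀ x ∈ S, (G.Adj v x ↔ x = p ∨ x = g))
    (hC : ∀ x ∈ g :: l, C' x ↔ C x) (hF : ∀ x ∈ p :: g :: l, F' x ↔ F x)
    (hA : ∀ x ∈ p :: g :: l, A' x ↔ A x)
    (hCp : ¬ C p) (hCv' : C' v) (hCp' : C' p) (hFv : F' v ↔ F p ∨ F g) (hAv : A' v)
    (hok : ¬ (F p ∧ F g)) : Labelled G (insert v S) (v :: p :: g :: l) C' F' A' := by
  have hpS : p ∈ S := hP.sub _ (by simp)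
  have hgS : g ∈ S := hP.sub _ (by simp)
  have hE := extends_pair hv hpS hgS hN
  have hpg : G.Adj p g := by have := hP.chain; simp at this; exact this.1
  have hnd := hP.nodup
  simp only [List.nodup_cons, List.mem_cons, not_or] at hnd
  refine ⟨isChordal_insert_pair hE hL.chordal ⟨hpg, hpS, hgS⟩, ?_, ?_, ?_⟩
  · refine tri_push hL ?_ ?_
    · intro x hx
      obtain rfl : p = x := by simpa using hx
      exact iff_of_true hCv' ⟨g, hgS, ((hN g hgS).2 (Or.inr rfl)).symm, hpg.symm⟩
    · intro x y hxy
      rcases pair_infix_cons.1 hxy with ⟨rfl, h⟩ | h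
      · obtain rfl : g = y := by simpa using h
        exact iff_of_true hCp' (Or.inr ⟨(hN _ hpS).2 (Or.inl rfl), (hN _ hgS).2 (Or.inr rfl)⟩)
      · rw [hC x (pair_infix_mem h).1]
        refine (or_iff_left ?_).symm
        rintro ⟨_, h2⟩
        have hy := pair_infix_mem_tail h
        rcases (hN y (hP.sub _ (by simp [hy]))).1 h2 with rfl | rfl
        · exact hnd.1.2 hy
        · exact hnd.2.1 hy
  · refine grand_push hL (fun h => hv (hP.sub _ h)) ?_ hA
    intro x y hxy
    simp only [List.cons_prefix_cons, List.nil_prefix, and_true] at hxy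
    obtain ⟨rfl, rfl⟩ := hxy
    exact iff_of_true hAv ((hN _ hgS).2 (Or.inr rfl))
  · intro R hR
    rw [hL.avoid_triangle_bridge hP hv hN hC hF hCp hCv' hCp' hFv R hR]
    exact and_iff_right hok

/-- The new vertex takes the last free vertex of the group of `p`, which ends up saturated. The
generality of `y` covers the parent and the grandparent of `p`; `hsame` expresses that `y` is in the
group of `p`. -/
theorem Labelled.push_triangle_common (hL : Labelled G S (p :: l) C F A)
    (hP : SearchPath G S (p :: l)) (hv : v ∉ S) {y w : V} (hy : y ∈ l)
    (hN : ∀ x ∈ S, (G.Adj v x ↔ x = p ∨ x = y)) (hpy : G.Adj p y)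
    (hw : w ∈ S) (hwp : G.Adj w p) (hwy : G.Adj w y)
    (hsame : ∀ R : V → Prop, ¬ R y → Sparse C F (fun x => R x ∨ x = y) (¬ F p) (p :: l) →
      ¬ R p ∧ ¬ F p ∧ Sparse C F R False l)
    (hC : ∀ x ∈ p :: l, C' x ↔ C x) (hF : ∀ x ∈ p :: l, F' x ↔ F x) (hA : ∀ x ∈ p :: l, A' x ↔ A x)
    (hCp : C p) (hCv' : C' v) (hFv : F' v) (hAv : ∀ g, l.head? = some g → (A' v ↔ G.Adj v g))
    (hok : ¬ F p) : Labelled G (insert v S) (v :: p :: l) C' F' A' := by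
  have hpS : p ∈ S := hP.sub _ (by simp)
  have hyS : y ∈ S := hP.sub _ (by simp [hy])
  have hE := extends_pair hv hpS hyS hN
  have hnd := hP.nodup
  refine ⟨isChordal_insert_pair hE hL.chordal ⟨hpy, hpS, hyS⟩, ?_, ?_, ?_⟩
  · refine tri_push hL ?_ ?_
    · intro x hx
      obtain rfl : p = x := by simpa using hx
      exact iff_of_true hCv' ⟨y, hyS, ((hN y hyS).2 (Or.inr rfl)).symm, hpy.symm⟩
    · intro x z hxz
      have hm := pair_infix_mem hxz
      rw [hC x hm.1]
      refine (or_iff_left_of_imp ?_).symm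
      rintro ⟨h1, h2⟩
      rcases (hN x (hP.sub _ hm.1)).1 h1 with rfl | rfl
      · exact hCp
      · have hz := pair_infix_mem_tail hxz
        have hne := hnd.sublist hxz.sublist
        rcases (hN z (hP.sub _ hm.2)).1 h2 with rfl | rfl
        · exact absurd hz (List.nodup_cons.1 hnd).1
        · simp at hne
  · refine grand_push hL (fun h => hv (hP.sub _ h)) ?_ hA
    intro x z hxz
    rw [List.cons_prefix_cons] at hxz
    obtain ⟨_, t, rfl⟩ := hxz
    exact hAv z rfl
  · intro R hR
    rw [hL.avoid_triangle_common hP hv hy hN hpy hw hwp hwy hsame hC hF hCp hCv' hFv R hR]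
    exact and_iff_right hok

/-- Three groups merge, each giving up its free vertex, so none may be saturated before and the
union is saturated afterwards. -/
theorem Labelled.push_diamond (hL : Labelled G S (p :: g :: q :: l) C F A)
    (hP : SearchPath G S (p :: g :: q :: l)) (hv : v ∉ S)
    (hN : ∀ x ∈ S, (G.Adj v x ↔ x = p ∨ x = g ∨ x = q))
    (hC : ∀ x ∈ q :: l, C' x ↔ C x) (hF : ∀ x ∈ p :: g :: q :: l, F' x ↔ F x)
    (hA : ∀ x ∈ p :: g :: q :: l, A' x ↔ A x)
    (hCp : ¬ C p) (hCg : ¬ C g) (hCv' : C' v) (hCp' : C' p) (hCg' : C' g) (hFv : F' v) (hAv : A' v)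
    (hok : ¬ F p ∧ ¬ F g ∧ ¬ F q) : Labelled G (insert v S) (v :: p :: g :: q :: l) C' F' A' := by
  have hpS : p ∈ S := hP.sub _ (by simp)
  have hgS : g ∈ S := hP.sub _ (by simp)
  have hqS : q ∈ S := hP.sub _ (by simp)
  have hE := extends_triple hv hpS hgS hqS hN
  have hch := hP.chain
  simp only [List.isChain_cons_cons] at hch
  have hnd := hP.nodup
  simp only [List.nodup_cons, List.mem_cons, not_or] at hnd
  have i1 : [p, g] <:+: p :: g :: q :: l := by rw [pair_infix_cons]; simp
  have i2 : [g, q] <:+: p :: g :: q :: l := by rw [pair_infix_cons, pair_infix_cons]; simp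
  refine ⟨?_, ?_, ?_, ?_⟩
  · refine hE.isChordal_of_diamond hL.chordal ⟨hch.1, hpS, hgS⟩ ⟨hch.2.1, hgS, hqS⟩ ?_ ?_
    · intro w h1 h2
      exact hCp ((hL.tri _ _ i1).2 ⟨w, h1.2.1, h1.1, h2.1⟩)
    · intro w h1 h2
      exact hCg ((hL.tri _ _ i2).2 ⟨w, h1.2.1, h2.1, h1.1⟩)
  · refine tri_push hL ?_ ?_
    · intro x hx
      obtain rfl : p = x := by simpa using hx
      exact iff_of_true hCv' ⟨g, hgS, ((hN g hgS).2 (Or.inr (Or.inl rfl))).symm, hch.1.symm⟩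
    · intro x y hxy
      rcases pair_infix_cons.1 hxy with ⟨rfl, h⟩ | h
      · obtain rfl : g = y := by simpa using h
        exact iff_of_true hCp' (Or.inr ⟨(hN _ hpS).2 (Or.inl rfl), (hN _ hgS).2 (Or.inr (Or.inl rfl))⟩)
      rcases pair_infix_cons.1 h with ⟨rfl, h'⟩ | h
      · obtain rfl : q = y := by simpa using h'
        exact iff_of_true hCg' (Or.inr ⟨(hN _ hgS).2 (Or.inr (Or.inl rfl)),
          (hN _ hqS).2 (Or.inr (Or.inr rfl))⟩)
      · rw [hC x (pair_infix_mem h).1]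
        refine (or_iff_left ?_).symm
        rintro ⟨_, h2⟩
        have hy := pair_infix_mem_tail h
        rcases (hN y (hP.sub _ (by simp [hy]))).1 h2 with rfl | rfl | rfl
        · exact hnd.1.2.2 hy
        · exact hnd.2.1.2 hy
        · exact hnd.2.2.1 hy
  · refine grand_push hL (fun h => hv (hP.sub _ h)) ?_ hA
    intro x y hxy
    simp only [List.cons_prefix_cons, List.nil_prefix, and_true] at hxy
    obtain ⟨rfl, rfl⟩ := hxy
    exact iff_of_true hAv ((hN _ hgS).2 (Or.inr (Or.inl rfl)))
  · intro R hR
    rw [hL.avoid_diamond_bridges hP hv hN hC hF hCp hCg hCv' hCp' hCg' hFv R hR]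
    exact and_iff_right hok

theorem avoid_of_decyc {M : SimpleGraph V} (hM : Decyc G M) (S : Set V) :
    Avoid (res G S) (fun _ => False) :=
  ⟨_, hM.inf (res_le G S), fun _ _ h => h.elim⟩

/-- The cycle consists of `v` and the path vertices at positions `0, …, j`. -/
theorem SearchPath.isCyc (hP : SearchPath G S l) (hv : v ∉ S) (hh : ∀ p ∈ l.head?, G.Adj v p)
    {j : ℕ} {x : V} (hj : l[j]? = some x) (h : G.Adj v x) (h1 : 1 ≤ j) :
    IsCyc G (fun i => (v :: l).getD i v) (j + 2) := by
  have hP' := hP.push hv hh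
  obtain ⟨hjl, hjx⟩ := List.getElem?_eq_some_iff.1 hj
  have hlen : (v :: l).length = l.length + 1 := rfl
  have hget : ∀ i, i < j + 2 → ∃ h : i < (v :: l).length, (v :: l).getD i v = (v :: l)[i] := fun i hi =>
    ⟨by omega, List.getD_eq_getElem _ _ (by omega)⟩
  refine ⟨?_, ?_, ?_⟩
  · intro a ha b hb hab
    obtain ⟨ha', ea⟩ := hget a ha
    obtain ⟨hb', eb⟩ := hget b hb
    beta_reduce at hab
    rw [ea, eb] at hab
    exact (hP'.nodup.getElem_inj_iff).1 hab
  · intro i hi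
    obtain ⟨ha', ea⟩ := hget i (by omega)
    obtain ⟨hb', eb⟩ := hget (i + 1) (by omega)
    rw [ea, eb]
    exact List.isChain_iff_getElem.1 hP'.chain i hb'
  · obtain ⟨hb', eb⟩ := hget (j + 1) (by omega)
    rw [show j + 2 - 1 = j + 1 by omega, eb, List.getD_cons_zero, List.getElem_cons_succ, hjx]
    exact h.symm

theorem not_good_of_far (hP : SearchPath G S l) (hv : v ∉ S) (hh : ∀ p ∈ l.head?, G.Adj v p)
    {x : V} (hx : x ∈ S) (h : G.Adj v x) (h0 : l[0]? ≠ some x) (h1 : l[1]? ≠ some x) (h2 : l[2]? ≠ some x) :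
    ¬ (G.IsChordal ∧ G.IsMDecyclable) := by
  rintro ⟨hc, hm⟩
  obtain ⟨M, hM⟩ := isMDecyclable_iff.1 hm
  obtain ⟨j, hj⟩ := List.mem_iff_getElem?.1 (hP.mem_of_adj hv hx h)
  have hj3 : 3 ≤ j := by
    by_contra hlt
    have : j < 3 := by omega
    interval_cases j <;> contradiction
  exact hM.no_long_cycle hc _ _ (by omega) (hP.isCyc hv hh hj h (by omega))

/-- Saturation is recorded at the first vertex of a group. If the parent belongs to the group of
`x`, it becomes the first one and inherits the record; otherwise that group leaves the path and
constrains nothing any more. -/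
theorem Labelled.pop {x : V} (hL : Labelled G S (x :: l) C F A) (hnd : (x :: l).Nodup)
    (hF : ∀ y ∈ l, F' y ↔ (C x ∧ l.head? = some y ∧ F x) ∨ (¬ (C x ∧ l.head? = some y) ∧ F y)) :
    Labelled G S l C F' A := by
  refine ⟨hL.chordal, fun y p h => hL.tri y p (pair_infix_cons.2 (Or.inr h)),
    fun y p g h => hL.grand y p g (triple_infix_cons.2 (Or.inr h)), ?_⟩
  intro R hR
  have hx : ¬ R x := fun h => (List.nodup_cons.1 hnd).1 (hR x h)
  rw [hL.avoid R (fun y hy => by simp [hR y hy]), sparse_cons]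
  simp only [hx, false_imp_iff, true_and, not_false_eq_true, and_true]
  cases l with
  | nil => exact Iff.rfl
  | cons y l =>
    simp only [List.nodup_cons, List.mem_cons, not_or] at hnd
    have h1 := hF y (by simp)
    simp only [List.head?_cons, and_true, true_and] at h1
    have h2 : ∀ z ∈ l, F' z ↔ F z := by
      intro z hz
      have hyz : y ≠ z := by rintro rfl; exact hnd.2.1 hz
      rw [hF z (by simp [hz])]
      simp [hyz]
    rw [sparse_cons, sparse_cons]
    have h3 : (C x ∧ Spare F (x :: y :: l) ∨ ¬ C x ∧ Spare F (y :: l)) ↔ Spare F' (y :: l) := by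
      simp only [spare_cons, h1]
      by_cases hC : C x <;> simp [hC]
    rw [h3]
    refine and_congr_right fun _ => Sparse.congr (fun _ _ => Iff.rfl) (fun z hz => (h2 z hz).symm)
      (fun _ _ => Iff.rfl) ?_
    rw [Spare.congr h2]

theorem Labelled.good (hL : Labelled G Set.univ [] C F A) : G.IsChordal ∧ G.IsMDecyclable := by
  have h := hL.chordal
  have h2 := (hL.avoid (fun _ => False) (by simp)).2 trivial
  rw [res_univ] at h h2
  obtain ⟨M, hM, _⟩ := h2
  exact ⟨h, isMDecyclable_iff.2 ⟨M, hM⟩⟩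

theorem labelled_empty : Labelled G ∅ [] C F A := by
  have h0 : res G ∅ = ⊥ := by ext; simp [res_adj]
  refine ⟨?_, by simp, by simp, ?_⟩
  · rintro k hk ⟨φ⟩
    have : NeZero k := ⟨by omega⟩
    have := φ.map_rel_iff.2 (cycleGraph_adj_add_one hk 0).1
    exact this.2.1
  · intro R hR
    refine iff_of_true ⟨⊥, ⟨bot_le, by simp, by simp [h0]⟩, by simp⟩ trivial

end Push

/-! ### The rule for accepting a vertex, and its correctness. -/

section Push

variable {G : SimpleGraph V} {S : Set V} {C F A C' F' A' : V → Prop} {v p g q : V} {l : List V}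

/-- A group leaves at most one vertex uncovered; once `g` claims it, the other members of the group
must satisfy the same constraints as if `p` had claimed it. -/
theorem same_of_parent (l : List V) (R : V → Prop) (hg : ¬ R g) (hCp : C p) (hpg : p ≠ g)
    (h : Sparse C F (fun x => R x ∨ x = g) (¬ F p) (p :: g :: l)) :
    ¬ R p ∧ ¬ F p ∧ Sparse C F R False (g :: l) := by
  simp only [sparse_cons, or_true, forall_const, not_true_eq_false, and_false, false_or, hpg, hCp,
    or_false, hg, not_false_eq_true, and_true, true_and, false_and] at h ⊢
  refine ⟨by tauto, by tauto, by tauto, h.2.2.anti id fun x _ hR => Or.inl hR⟩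

theorem same_of_grandparent (l : List V) (R : V → Prop) (hq : ¬ R q) (hCp : C p) (hCg : C g) (hpq : p ≠ q)
    (hgq : g ≠ q) (h : Sparse C F (fun x => R x ∨ x = q) (¬ F p) (p :: g :: q :: l)) :
    ¬ R p ∧ ¬ F p ∧ Sparse C F R False (g :: q :: l) := by
  simp only [sparse_cons, or_true, forall_const, not_true_eq_false, and_false, false_or, hpq, hgq, hCp, hCg,
    or_false, hq, not_false_eq_true, and_true, true_and, false_and] at h ⊢
  refine ⟨by tauto, by tauto, by tauto, by tauto, h.2.2.2.anti id fun x _ hR => Or.inl hR⟩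

/-- The rule by which a newly visited vertex `v` is examined: `a` and `b` say whether it is
adjacent to the second and the third vertex of the path. -/
def Accepts (a b cp fp ap cg fg fq : Prop) : Prop :=
  (¬ a ∧ ¬ b) ∨ (a ∧ ¬ b ∧ ¬ cp ∧ ¬ (fp ∧ fg)) ∨ (a ∧ ¬ b ∧ cp ∧ ¬ fp) ∨ (¬ a ∧ b ∧ ap ∧ ¬ fp) ∨
    (a ∧ b ∧ ¬ cp ∧ ¬ cg ∧ ¬ fp ∧ ¬ fg ∧ ¬ fq)

theorem accepts_both {a b cp fp ap cg fg fq : Prop} (ha : a) (hb : b) :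
    Accepts a b cp fp ap cg fg fq ↔ ¬ cp ∧ ¬ cg ∧ ¬ fp ∧ ¬ fg ∧ ¬ fq := by
  simp [Accepts, ha, hb]

theorem accepts_second {a b cp fp ap cg fg fq : Prop} (ha : ¬ a) (hb : b) :
    Accepts a b cp fp ap cg fg fq ↔ ap ∧ ¬ fp := by
  simp [Accepts, ha, hb]

theorem accepts_first_common {a b cp fp ap cg fg fq : Prop} (ha : a) (hb : ¬ b) (hc : cp) :
    Accepts a b cp fp ap cg fg fq ↔ ¬ fp := by
  simp [Accepts, ha, hb, hc]

theorem accepts_first_bridge {a b cp fp ap cg fg fq : Prop} (ha : a) (hb : ¬ b) (hc : ¬ cp) :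
    Accepts a b cp fp ap cg fg fq ↔ ¬ (fp ∧ fg) := by
  simp [Accepts, ha, hb, hc]

set_option maxHeartbeats 1000000 in
-- Both halves rest on the same equivalences for `Avoid`. If the test succeeds, they give the new
-- invariant. If `G` is good, its matching restricts to the visited part, and with `R` empty the
-- equivalence returns the tested conditions on `F`; the other tests are forced by chordality or by
-- conflicting diamonds.
theorem Labelled.push (hL : Labelled G S l C F A) (hP : SearchPath G S l) (hv : v ∉ S)
    (hh : ∀ p ∈ l.head?, G.Adj v p) {a b cp fp ap cg fg fq : Prop}
    (hl : ∀ x ∈ S, G.Adj v x → l[0]? = some x ∨ l[1]? = some x ∨ l[2]? = some x)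
    (ha : a ↔ ∃ g, l[1]? = some g ∧ G.Adj v g) (hb : b ↔ ∃ q, l[2]? = some q ∧ G.Adj v q)
    (hp : ∀ p, l[0]? = some p → (cp ↔ C p) ∧ (fp ↔ F p) ∧ (ap ↔ A p))
    (hg : ∀ g, l[1]? = some g → (cg ↔ C g) ∧ (fg ↔ F g))
    (hq : ∀ q, l[2]? = some q → (fq ↔ F q))
    (hCv : C' v ↔ a ∨ b)
    (hC : ∀ x ∈ l, C' x ↔ C x ∨ (l[0]? = some x ∧ (a ∨ b)) ∨ (l[1]? = some x ∧ b))
    (hFv : F' v ↔ b ∨ (a ∧ (cp ∨ fp ∨ fg))) (hF : ∀ x ∈ l, F' x ↔ F x)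
    (hAv : A' v ↔ a) (hA : ∀ x ∈ l, A' x ↔ A x) :
    (Accepts a b cp fp ap cg fg fq → Labelled G (insert v S) (v :: l) C' F' A') ∧
    (¬ Accepts a b cp fp ap cg fg fq → ¬ (G.IsChordal ∧ G.IsMDecyclable)) := by
  by_cases hab : ¬ a ∧ ¬ b
  · refine ⟨fun _ => ?_, fun h => absurd (Or.inl hab) h⟩
    obtain ⟨h1, h2⟩ := hab
    simp only [h1, h2, or_false, and_false, false_and] at *
    refine hL.push_pendant hP hv ?_ hC hF hA (by simpa using hCv) (by simpa using hFv) (by simpa using hAv)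
    intro x hx hvx
    rw [List.head?_eq_getElem?]
    rcases hl x hx hvx with h | h | h
    · exact h
    · exact absurd (ha.2 ⟨x, h, hvx⟩) (by simp)
    · exact absurd (hb.2 ⟨x, h, hvx⟩) (by simp)
  obtain ⟨p, g, l, rfl⟩ : ∃ p g l', l = p :: g :: l' := by
    rcases l with _ | ⟨p, _ | ⟨g, l⟩⟩
    · exact absurd ⟨by rw [ha]; simp, by rw [hb]; simp⟩ hab
    · exact absurd ⟨by rw [ha]; simp, by rw [hb]; simp⟩ hab
    · exact ⟨_, _, _, rfl⟩
  have hpS : p ∈ S := hP.sub _ (by simp)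
  have hgS : g ∈ S := hP.sub _ (by simp)
  have hnd := hP.nodup
  have hch := hP.chain
  simp only [List.nodup_cons, List.mem_cons, not_or] at hnd
  have hpg : G.Adj p g := by simp at hch; exact hch.1
  have hvp : G.Adj v p := hh p (by simp)
  have i1 : [p, g] <:+: p :: g :: l := by rw [pair_infix_cons]; simp
  obtain ⟨hcp, hfp, hap⟩ := hp p (by simp)
  obtain ⟨hcg, hfg⟩ := hg g (by simp)
  have ha' : a ↔ G.Adj v g := by simpa using ha
  have good_avoid : G.IsChordal ∧ G.IsMDecyclable → Avoid (res G (insert v S)) (fun _ => False) := by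
    rintro ⟨_, hm⟩
    obtain ⟨M, hM⟩ := isMDecyclable_iff.1 hm
    exact avoid_of_decyc hM _
  by_cases hb0 : b
  · -- adjacent to the third vertex of the path
    obtain ⟨q, l, rfl⟩ : ∃ q l', l = q :: l' := by
      rcases l with _ | ⟨q, l⟩
      · rw [hb] at hb0; simp at hb0
      · exact ⟨_, _, rfl⟩
    have hqS : q ∈ S := hP.sub _ (by simp)
    have hvq : G.Adj v q := by simpa using hb.1 hb0
    have hgq : G.Adj g q := by simp at hch; exact hch.2.1
    simp only [List.mem_cons, not_or] at hnd
    have hfq := hq q (by simp)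
    have i2 : [g, q] <:+: p :: g :: q :: l := by rw [pair_infix_cons, pair_infix_cons]; simp
    have i3 : [p, g, q] <:+: p :: g :: q :: l := by rw [triple_infix_cons]; simp
    have hApq := hL.grand _ _ _ i3
    have hl' : ∀ x ∈ S, G.Adj v x → x = p ∨ x = g ∨ x = q := by
      intro x hx hvx
      have := hl x hx hvx
      simp only [List.getElem?_cons_zero, List.getElem?_cons_succ, Option.some.injEq] at this
      rcases this with rfl | rfl | rfl <;> simp
    have hCl : ∀ x ∈ p :: g :: q :: l, C' x ↔ C x ∨ x = p ∨ x = g := by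
      intro x hx
      rw [hC x hx]
      simp [hb0, eq_comm]
    have hql : ∀ x ∈ q :: l, x ≠ p ∧ x ≠ g := by
      intro x hx
      refine ⟨?_, ?_⟩ <;> rintro rfl <;> rcases List.mem_cons.1 hx with h | h
      · exact hnd.1.2.1 h
      · exact hnd.1.2.2 h
      · exact hnd.2.1.1 h
      · exact hnd.2.1.2 h
    by_cases ha0 : a
    · have hvg : G.Adj v g := ha'.1 ha0
      have hN : ∀ x ∈ S, (G.Adj v x ↔ x = p ∨ x = g ∨ x = q) := by
        intro x hx
        refine ⟨hl' x hx, ?_⟩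
        rintro (rfl | rfl | rfl) <;> assumption
      constructor
      · intro hacc
        have hacc' := (accepts_both ha0 hb0).1 hacc
        rw [hcp, hcg, hfp, hfg, hfq] at hacc'
        refine hL.push_diamond hP hv hN ?_ hF hA hacc'.1 hacc'.2.1 (hCv.2 (Or.inr hb0))
          ((hCl p (by simp)).2 (by simp)) ((hCl g (by simp)).2 (by simp)) (hFv.2 (Or.inl hb0)) (hAv.2 ha0)
          hacc'.2.2
        intro x hx
        rw [hCl x (List.mem_cons_of_mem _ (List.mem_cons_of_mem _ hx))]
        exact or_iff_left (not_or.2 (hql x hx))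
      · intro hacc hgood
        have hM := isMDecyclable_iff.1 hgood.2
        obtain ⟨M, hM⟩ := hM
        -- A triangle on `p g` would produce a `K₄`, or a second diamond whose matching conflicts
        -- with the one on `v`, `p`, `g`, `q`.
        have hcp' : ¬ C p := by
          intro hc
          obtain ⟨w, hw, hwp, hwg⟩ := (hL.tri _ _ i1).1 hc
          have hwv : w ≠ v := by rintro rfl; exact hv hw
          by_cases hwq : w = q
          · subst hwq
            exact hM.no_clique_four hpg hvp hvg hwp hwg hvq
          have d1 := hM.diamond hpg hvp hvg hwp hwg hwv.symm
          have d2 := hM.diamond hvg hvp.symm hpg hvq.symm hgq.symm hnd.1.2.1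
          have mat := hM.mat
          rcases d2.2 with ⟨m1, m2⟩ | ⟨m1, m2⟩
          · rcases d1.2 with ⟨m3, m4⟩ | ⟨m3, m4⟩
            · exact hwq (mat _ _ _ m4.symm m2.symm)
            · exact hnd.1.1 (mat _ _ _ m1.symm m3)
          · exact d1.1 m1
        have hcg' : ¬ C g := by
          intro hc
          obtain ⟨w, hw, hwg, hwq⟩ := (hL.tri _ _ i2).1 hc
          have hwv : w ≠ v := by rintro rfl; exact hv hw
          by_cases hwp : w = p
          · subst hwp
            exact hM.no_clique_four hpg hvp hvg hwq.symm hgq.symm hvq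
          have d1 := hM.diamond hgq hvg hvq hwg hwq hwv.symm
          have d2 := hM.diamond hvg hvp.symm hpg hvq.symm hgq.symm hnd.1.2.1
          have mat := hM.mat
          rcases d2.2 with ⟨m1, m2⟩ | ⟨m1, m2⟩
          · exact d1.1 m2.symm
          · rcases d1.2 with ⟨m3, m4⟩ | ⟨m3, m4⟩
            · exact hgq.ne (mat _ _ _ m3 m2.symm)
            · exact hwp (mat _ _ _ m4.symm m1.symm)
        -- Any labels of the required shape would serve, as only the condition on the old labels is
        -- extracted from the equivalence.
        let C₁ : V → Prop := fun x => C x ∨ x = v ∨ x = p ∨ x = g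
        let F₁ : V → Prop := fun x => F x ∨ x = v
        have hne : ∀ x ∈ p :: g :: q :: l, x ≠ v := by
          rintro x hx rfl
          exact hv (hP.sub _ hx)
        have := (hL.avoid_diamond_bridges (C' := C₁) (F' := F₁) hP hv hN ?_ ?_ hcp' hcg' (by simp [C₁])
          (by simp [C₁]) (by simp [C₁]) (by simp [F₁]) (fun _ => False) (by simp)).1 (good_avoid hgood)
        · refine hacc ((accepts_both ha0 hb0).2 ?_)
          rw [hcp, hcg, hfp, hfg, hfq]
          exact ⟨hcp', hcg', this.1⟩
        · intro x hx
          have h1 := hne x (List.mem_cons_of_mem _ (List.mem_cons_of_mem _ hx))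
          have h2 := hql x hx
          simp [C₁, h1, h2.1, h2.2]
        · intro x hx
          simp [F₁, hne x hx]
    · have hvg : ¬ G.Adj v g := fun h => ha0 (ha'.2 h)
      have hN : ∀ x ∈ S, (G.Adj v x ↔ x = p ∨ x = q) := by
        intro x hx
        constructor
        · intro h
          rcases hl' x hx h with rfl | rfl | rfl
          · exact Or.inl rfl
          · exact absurd h hvg
          · exact Or.inr rfl
        · rintro (rfl | rfl) <;> assumption
      by_cases hA0 : A p
      · have hpq := hApq.1 hA0
        have hCp : C p := (hL.tri _ _ i1).2 ⟨q, hqS, hpq.symm, hgq.symm⟩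
        have hCg : C g := (hL.tri _ _ i2).2 ⟨p, hpS, hpg, hpq⟩
        have hC1 : ∀ x ∈ p :: g :: q :: l, C' x ↔ C x := by
          intro x hx
          rw [hCl x hx]
          refine or_iff_left_of_imp ?_
          rintro (rfl | rfl) <;> assumption
        constructor
        · intro hacc
          refine hL.push_triangle_common (y := q) (w := g) hP hv (by simp) hN hpq hgS hpg.symm hgq
            (fun R hR h => same_of_grandparent _ R hR hCp hCg hnd.1.2.1 hnd.2.1.1 h)
            hC1 hF hA hCp (hCv.2 (Or.inr hb0)) (hFv.2 (Or.inl hb0)) ?_ ?_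
          · intro x hx
            obtain rfl : g = x := by simpa using hx
            exact hAv.trans ha'
          · rw [← hfp]; exact ((accepts_second ha0 hb0).1 hacc).2
        · intro hacc hgood
          have := (hL.avoid_triangle_common (C' := C') (F' := F') (y := q) (w := g) hP hv (by simp) hN hpq hgS
            hpg.symm hgq
            (fun R hR h => same_of_grandparent _ R hR hCp hCg hnd.1.2.1 hnd.2.1.1 h)
            hC1 hF hCp (hCv.2 (Or.inr hb0)) (hFv.2 (Or.inl hb0)) (fun _ => False) (by simp)).1
            (good_avoid hgood)
          refine hacc ((accepts_second ha0 hb0).2 ?_)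
          rw [hap, hfp]
          exact ⟨hA0, this.1⟩
      · refine ⟨fun hacc => ?_, fun _ hgood => ?_⟩
        · exact absurd (hap.1 ((accepts_second ha0 hb0).1 hacc).1) hA0
        · have hpq : ¬ G.Adj p q := fun h => hA0 (hApq.2 h)
          -- The square `v p g q` has neither chord.
          rcases hgood.1.square hvp hpg hgq hvq.symm (by rintro rfl; exact hv hgS) hnd.1.2.1 with h | h
          · exact hvg h
          · exact hpq h
  · have ha0 : a := by by_contra h; exact hab ⟨h, hb0⟩
    have hvg : G.Adj v g := ha'.1 ha0
    have hN : ∀ x ∈ S, (G.Adj v x ↔ x = p ∨ x = g) := by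
      intro x hx
      constructor
      · intro h
        rcases hl x hx h with e | e | e
        · left; simpa [eq_comm] using e
        · right; simpa [eq_comm] using e
        · exact absurd (hb.2 ⟨x, e, h⟩) hb0
      · rintro (rfl | rfl) <;> assumption
    have hCl : ∀ x ∈ p :: g :: l, C' x ↔ C x ∨ x = p := by
      intro x hx
      rw [hC x hx]
      simp [hb0, ha0, eq_comm]
    by_cases hCp : C p
    · obtain ⟨w, hw, hwp, hwg⟩ := (hL.tri _ _ i1).1 hCp
      have hC1 : ∀ x ∈ p :: g :: l, C' x ↔ C x := by
        intro x hx
        rw [hCl x hx]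
        refine or_iff_left_of_imp ?_
        rintro rfl; assumption
      have hcp0 : cp := hcp.2 hCp
      constructor
      · intro hacc
        refine hL.push_triangle_common (y := g) (w := w) hP hv (by simp) hN hpg hw hwp hwg
          (fun R hR h => same_of_parent _ R hR hCp hnd.1.1 h)
          hC1 hF hA hCp (hCv.2 (Or.inl ha0)) (hFv.2 (Or.inr ⟨ha0, Or.inl hcp0⟩)) ?_ ?_
        · intro x hx
          obtain rfl : g = x := by simpa using hx
          exact hAv.trans ha'
        · rw [← hfp]; exact (accepts_first_common ha0 hb0 hcp0).1 hacc
      · intro hacc hgood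
        have := (hL.avoid_triangle_common (C' := C') (F' := F') (y := g) (w := w) hP hv (by simp) hN hpg hw
          hwp hwg (fun R hR h => same_of_parent _ R hR hCp hnd.1.1 h)
          hC1 hF hCp (hCv.2 (Or.inl ha0)) (hFv.2 (Or.inr ⟨ha0, Or.inl hcp0⟩)) (fun _ => False) (by simp)).1
          (good_avoid hgood)
        refine hacc ((accepts_first_common ha0 hb0 hcp0).2 ?_)
        rw [hfp]
        exact this.1
    · have hcp0 : ¬ cp := fun h => hCp (hcp.1 h)
      have hC1 : ∀ x ∈ g :: l, C' x ↔ C x := by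
        intro x hx
        rw [hCl x (List.mem_cons_of_mem _ hx)]
        refine or_iff_left ?_
        rintro rfl
        rcases List.mem_cons.1 hx with h | h
        · exact hnd.1.1 h
        · exact hnd.1.2 h
      have hFv1 : F' v ↔ F p ∨ F g := by
        rw [hFv, ← hfp, ← hfg]; simp [ha0, hb0, hcp0]
      constructor
      · intro hacc
        refine hL.push_triangle_bridge hP hv hN hC1 hF hA hCp (hCv.2 (Or.inl ha0))
          ((hCl p (by simp)).2 (by simp)) hFv1 (hAv.2 ha0) ?_
        rw [← hfp, ← hfg]
        exact (accepts_first_bridge ha0 hb0 hcp0).1 hacc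
      · intro hacc hgood
        have := (hL.avoid_triangle_bridge (C' := C') (F' := F') hP hv hN hC1 hF hCp (hCv.2 (Or.inl ha0))
          ((hCl p (by simp)).2 (by simp)) hFv1 (fun _ => False) (by simp)).1 (good_avoid hgood)
        refine hacc ((accepts_first_bridge ha0 hb0 hcp0).2 ?_)
        rw [hfp, hfg]
        exact this.1

end Push

end Graphs

/-! ### A program logic with running times for the machine. -/

namespace RAM

infixr:60 " ;; " => Program.seq

/-- The program can be run from `s`, and the running time and the final state satisfy `Q`. -/
def Runs (B : ℕ) (p : Program) (Q : ℕ → State → Prop) (s : State) : Prop :=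
  ∃ t s', Exec B p s t s' ∧ Q t s'

theorem Runs.mono {B : ℕ} {p : Program} {Q Q' : ℕ → State → Prop} {s : State} (h : Runs B p Q s)
    (hQ : ∀ t s', Q t s' → Q' t s') : Runs B p Q' s := by
  obtain ⟨t, s', h1, h2⟩ := h
  exact ⟨t, s', h1, hQ _ _ h2⟩

theorem Runs.skip {B : ℕ} {Q : ℕ → State → Prop} {s : State} (h : Q 1 s) : Runs B .skip Q s :=
  ⟨_, _, .skip s, h⟩

theorem Runs.assign {B r : ℕ} {e : Rhs} {Q : ℕ → State → Prop} {s : State} (hB : e.value s ≤ B)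
    (h : Q 1 ⟨Function.update s.reg r (e.value s), s.mem⟩) : Runs B (.assign r e) Q s :=
  ⟨_, _, .assign r e s hB, h⟩

theorem Runs.store {B a b : ℕ} {Q : ℕ → State → Prop} {s : State}
    (h : Q 1 ⟨s.reg, Function.update s.mem (s.reg a) (s.reg b)⟩) : Runs B (.store a b) Q s :=
  ⟨_, _, .store a b s, h⟩

theorem Runs.seq {B : ℕ} {p q : Program} {Q : ℕ → State → Prop} {s : State}
    (h : Runs B p (fun t s' => Runs B q (fun t' => Q (t + t')) s') s) : Runs B (p ;; q) Q s := by
  obtain ⟨t, s', h1, t', s'', h2, h3⟩ := h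
  exact ⟨_, _, .seq h1 h2, h3⟩

theorem Runs.ite {B : ℕ} {c : Test} {p q : Program} {Q : ℕ → State → Prop} {s : State}
    (h1 : c.Holds s → Runs B p (fun t => Q (1 + t)) s)
    (h2 : ¬ c.Holds s → Runs B q (fun t => Q (1 + t)) s) : Runs B (.ite c p q) Q s := by
  by_cases hc : c.Holds s
  · obtain ⟨t, s', h, h'⟩ := h1 hc
    exact ⟨_, _, .ite_true hc h, h'⟩
  · obtain ⟨t, s', h, h'⟩ := h2 hc
    exact ⟨_, _, .ite_false hc h, h'⟩

/-- A loop whose body consumes its running time from a potential. -/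
theorem Runs.while {B : ℕ} {c : Test} {p : Program} {I : ℕ → State → Prop}
    (hbody : ∀ φ s, I φ s → c.Holds s → Runs B p (fun t s' => ∃ φ', I φ' s' ∧ 1 + t + φ' ≤ φ) s) :
    ∀ (φ : ℕ) (s : State), I φ s →
      Runs B (.while c p) (fun t s' => ∃ φ', I φ' s' ∧ ¬ c.Holds s' ∧ t + φ' ≤ φ + 1) s := by
  intro φ
  induction φ using Nat.strong_induction_on with
  | _ φ ih =>
    intro s hI
    by_cases hc : c.Holds s
    · obtain ⟨t, s', h1, φ', hI', hφ⟩ := hbody φ s hI hc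
      obtain ⟨t', s'', h2, φ'', hI'', hc'', hφ'⟩ := ih φ' (by omega) s' hI'
      exact ⟨_, _, .while_true hc h1 h2, φ'', hI'', hc'', by omega⟩
    · exact ⟨_, _, .while_false hc, φ, hI, hc, by omega⟩

/-- The state consists of the registers `reg` (other than `1, …, 6`), of the input `w`, and of five
arrays `arr 0, …, arr 4` of length `n + 1` behind the input; the registers `1, …, 5` hold the addresses
of the arrays and register `6` is scratch space. -/
structure Rep (n : ℕ) (w : List ℕ) (reg : ℕ → ℕ) (arr : ℕ → ℕ → ℕ) (s : State) : Prop where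
  reg_eq : ∀ r, r = 0 ∨ 7 ≤ r → s.reg r = reg r
  base : ∀ k < 5, s.reg (k + 1) = w.length + k * (n + 1)
  input : ∀ i < w.length, s.mem i = w.getD i 0
  arr_eq : ∀ k < 5, ∀ x ≤ n, s.mem (w.length + k * (n + 1) + x) = arr k x

/-- `Runs` for states that consist of registers, the input and arrays. -/
def Wp (n : ℕ) (w : List ℕ) (B : ℕ) (p : Program) (Q : ℕ → (ℕ → ℕ) → (ℕ → ℕ → ℕ) → Prop)
    (reg : ℕ → ℕ) (arr : ℕ → ℕ → ℕ) : Prop :=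
  ∀ s, Rep n w reg arr s → Runs B p (fun t s' => ∃ reg' arr', Rep n w reg' arr' s' ∧ Q t reg' arr') s

/-- Read entry `a` of array `k` into register `r`. -/
def ld (r k a : ℕ) : Program := .assign 6 (.add (k + 1) a) ;; .assign r (.load 6)

/-- Write register `b` to entry `a` of array `k`. -/
def st (k a b : ℕ) : Program := .assign 6 (.add (k + 1) a) ;; .store 6 b

section

variable {n : ℕ} {w : List ℕ} {B : ℕ} {Q Q' : ℕ → (ℕ → ℕ) → (ℕ → ℕ → ℕ) → Prop} {reg : ℕ → ℕ}
  {arr : ℕ → ℕ → ℕ} {p q : Program} {r a b k : ℕ}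

theorem Wp.mono (h : Wp n w B p Q reg arr) (hQ : ∀ t reg' arr', Q t reg' arr' → Q' t reg' arr') :
    Wp n w B p Q' reg arr := by
  intro s hs
  refine (h s hs).mono ?_
  rintro t s' ⟨reg', arr', h1, h2⟩
  exact ⟨reg', arr', h1, hQ _ _ _ h2⟩

theorem Wp.skip (h : Q 1 reg arr) : Wp n w B .skip Q reg arr :=
  fun _ hs => Runs.skip ⟨_, _, hs, h⟩

theorem Wp.seq (h : Wp n w B p (fun t => Wp n w B q (fun t' => Q (t + t'))) reg arr) :
    Wp n w B (p ;; q) Q reg arr := by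
  intro s hs
  refine Runs.seq ((h s hs).mono ?_)
  rintro t s' ⟨reg', arr', h1, h2⟩
  exact h2 s' h1

theorem Rep.update {s : State} (hs : Rep n w reg arr s) (hr : r = 0 ∨ 7 ≤ r) (x : ℕ) :
    Rep n w (Function.update reg r x) arr ⟨Function.update s.reg r x, s.mem⟩ := by
  refine ⟨?_, ?_, hs.input, hs.arr_eq⟩
  · intro r' hr'
    by_cases h : r' = r
    · subst h; simp
    · simp [h, hs.reg_eq r' hr']
  · intro k hk
    rw [← hs.base k hk]
    exact Function.update_of_ne (by omega) _ _

theorem Wp.const {x : ℕ} (hr : r = 0 ∨ 7 ≤ r) (hB : x ≤ B) (h : Q 1 (Function.update reg r x) arr) :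
    Wp n w B (.assign r (.const x)) Q reg arr :=
  fun _ hs => Runs.assign hB ⟨_, _, hs.update hr _, h⟩

theorem Wp.copy (hr : r = 0 ∨ 7 ≤ r) (ha : a = 0 ∨ 7 ≤ a) (hB : reg a ≤ B)
    (h : Q 1 (Function.update reg r (reg a)) arr) : Wp n w B (.assign r (.copy a)) Q reg arr := by
  intro s hs
  rw [← hs.reg_eq a ha] at hB h
  exact Runs.assign hB ⟨_, _, hs.update hr _, h⟩

theorem Wp.add (hr : r = 0 ∨ 7 ≤ r) (ha : a = 0 ∨ 7 ≤ a) (hb : b = 0 ∨ 7 ≤ b) (hB : reg a + reg b ≤ B)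
    (h : Q 1 (Function.update reg r (reg a + reg b)) arr) :
    Wp n w B (.assign r (.add a b)) Q reg arr := by
  intro s hs
  rw [← hs.reg_eq a ha, ← hs.reg_eq b hb] at hB h
  exact Runs.assign hB ⟨_, _, hs.update hr _, h⟩

theorem Wp.input (hr : r = 0 ∨ 7 ≤ r) (ha : a = 0 ∨ 7 ≤ a) (hl : reg a < w.length)
    (hB : w.getD (reg a) 0 ≤ B) (h : Q 1 (Function.update reg r (w.getD (reg a) 0)) arr) :
    Wp n w B (.assign r (.load a)) Q reg arr := by
  intro s hs
  have e : (Rhs.load a).value s = w.getD (reg a) 0 := by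
    rw [Rhs.value, hs.reg_eq a ha, hs.input _ hl]
  rw [← e] at hB h
  exact Runs.assign hB ⟨_, _, hs.update hr _, h⟩

theorem Rep.scratch {s : State} (hs : Rep n w reg arr s) (x : ℕ) :
    Rep n w reg arr ⟨Function.update s.reg 6 x, s.mem⟩ := by
  refine ⟨?_, ?_, hs.input, hs.arr_eq⟩
  · intro r' hr'
    rw [← hs.reg_eq r' hr']
    exact Function.update_of_ne (by omega) _ _
  · intro k hk
    rw [← hs.base k hk]
    exact Function.update_of_ne (by omega) _ _

theorem array_bound (hk : k < 5) {x : ℕ} (hx : x ≤ n) :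
    w.length + k * (n + 1) + x < w.length + 5 * (n + 1) := by
  have : k * (n + 1) + (n + 1) ≤ 5 * (n + 1) := by
    rw [← Nat.succ_mul]; exact Nat.mul_le_mul_right _ hk
  omega

theorem Rep.index_value {s : State} (hs : Rep n w reg arr s) (ha : a = 0 ∨ 7 ≤ a) (hk : k < 5) :
    (Rhs.add (k + 1) a).value s = w.length + k * (n + 1) + reg a := by
  rw [Rhs.value, hs.base k hk, hs.reg_eq a ha]

theorem Wp.ld (hBB : w.length + 5 * (n + 1) ≤ B) (hr : r = 0 ∨ 7 ≤ r) (ha : a = 0 ∨ 7 ≤ a) (hk : k < 5)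
    (hx : reg a ≤ n) (hB : arr k (reg a) ≤ B)
    (h : Q 2 (Function.update reg r (arr k (reg a))) arr) : Wp n w B (ld r k a) Q reg arr := by
  intro s hs
  have e := hs.index_value ha hk
  refine Runs.seq (Runs.assign ?_ ?_)
  · rw [e]
    exact (array_bound hk hx).le.trans hBB
  · have hs' := hs.scratch ((Rhs.add (k + 1) a).value s)
    have e' : (Rhs.load 6).value ⟨Function.update s.reg 6 ((Rhs.add (k + 1) a).value s), s.mem⟩
        = arr k (reg a) := by
      simp [Rhs.value, ← hs.arr_eq k hk _ hx, hs.base k hk, hs.reg_eq a ha]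
    rw [← e'] at hB h
    exact Runs.assign hB ⟨_, _, hs'.update hr _, h⟩

/-- Reduction modulo `n + 1` recovers the index from the address, so a store changes one entry of
one array only. -/
theorem index_inj {k k' x x' : ℕ} (hx : x ≤ n) (hx' : x' ≤ n)
    (h : k * (n + 1) + x = k' * (n + 1) + x') : k = k' ∧ x = x' := by
  have h1 : x = x' := by
    have := congrArg (· % (n + 1)) h
    simpa [Nat.mul_add_mod, Nat.mod_eq_of_lt (Nat.lt_succ_of_le hx),
      Nat.mod_eq_of_lt (Nat.lt_succ_of_le hx'), Nat.add_comm, Nat.add_mul_mod_self_right] using this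
  subst h1
  exact ⟨Nat.eq_of_mul_eq_mul_right (Nat.succ_pos n) (Nat.add_right_cancel h), rfl⟩

theorem Wp.st (hBB : w.length + 5 * (n + 1) ≤ B) (ha : a = 0 ∨ 7 ≤ a) (hb : b = 0 ∨ 7 ≤ b) (hk : k < 5)
    (hx : reg a ≤ n)
    (h : Q 2 reg (Function.update arr k (Function.update (arr k) (reg a) (reg b)))) :
    Wp n w B (st k a b) Q reg arr := by
  intro s hs
  have e := hs.index_value ha hk
  refine Runs.seq (Runs.assign ?_ ?_)
  · rw [e]
    exact (array_bound hk hx).le.trans hBB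
  · have hs' := hs.scratch ((Rhs.add (k + 1) a).value s)
    refine Runs.store ⟨reg, _, ?_, h⟩
    have hb' := hs'.reg_eq b hb
    simp only [Function.update_self, e] at hb' ⊢
    rw [e] at hs'
    refine ⟨hs'.reg_eq, hs'.base, ?_, ?_⟩
    · intro i hi
      rw [← hs.input i hi]
      exact Function.update_of_ne (by omega) _ _
    · intro k' hk' x hx'
      have hb'' : s.reg b = reg b := hs.reg_eq b hb
      by_cases hkx : k' = k ∧ x = reg a
      · obtain ⟨rfl, rfl⟩ := hkx
        simp [hb']
      · have hne : w.length + k' * (n + 1) + x ≠ w.length + k * (n + 1) + reg a := by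
          intro h'
          exact hkx (index_inj hx' hx (by omega))
        have h2 : Function.update arr k (Function.update (arr k) (reg a) (reg b)) k' x = arr k' x := by
          by_cases h1 : k' = k
          · subst h1
            have : x ≠ reg a := fun h2 => hkx ⟨rfl, h2⟩
            simp [this]
          · simp [h1]
        rw [h2, ← hs.arr_eq k' hk' x hx']
        exact Function.update_of_ne hne _ _

theorem Wp.ite_eq (ha : a = 0 ∨ 7 ≤ a) (hb : b = 0 ∨ 7 ≤ b)
    (h1 : reg a = reg b → Wp n w B p (fun t => Q (1 + t)) reg arr)
    (h2 : reg a ≠ reg b → Wp n w B q (fun t => Q (1 + t)) reg arr) :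
    Wp n w B (.ite (.eq a b) p q) Q reg arr := by
  intro s hs
  refine Runs.ite (fun hc => h1 ?_ s hs) (fun hc => h2 ?_ s hs)
  · rwa [Test.Holds, hs.reg_eq a ha, hs.reg_eq b hb] at hc
  · rwa [Test.Holds, hs.reg_eq a ha, hs.reg_eq b hb] at hc

theorem Wp.ite_lt (ha : a = 0 ∨ 7 ≤ a) (hb : b = 0 ∨ 7 ≤ b)
    (h1 : reg a < reg b → Wp n w B p (fun t => Q (1 + t)) reg arr)
    (h2 : ¬ reg a < reg b → Wp n w B q (fun t => Q (1 + t)) reg arr) :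
    Wp n w B (.ite (.lt a b) p q) Q reg arr := by
  intro s hs
  refine Runs.ite (fun hc => h1 ?_ s hs) (fun hc => h2 ?_ s hs)
  · rwa [Test.Holds, hs.reg_eq a ha, hs.reg_eq b hb] at hc
  · rwa [Test.Holds, hs.reg_eq a ha, hs.reg_eq b hb] at hc

theorem Wp.while_lt (ha : a = 0 ∨ 7 ≤ a) (hb : b = 0 ∨ 7 ≤ b) {I : ℕ → (ℕ → ℕ) → (ℕ → ℕ → ℕ) → Prop}
    (hbody : ∀ φ reg arr, I φ reg arr → reg a < reg b →
      Wp n w B p (fun t reg' arr' => ∃ φ', I φ' reg' arr' ∧ 1 + t + φ' ≤ φ) reg arr)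
    {φ : ℕ} (h : I φ reg arr) :
    Wp n w B (.while (.lt a b) p)
      (fun t reg' arr' => ∃ φ', I φ' reg' arr' ∧ ¬ reg' a < reg' b ∧ t + φ' ≤ φ + 1) reg arr := by
  intro s hs
  refine (Runs.while (I := fun φ s => ∃ reg' arr', Rep n w reg' arr' s ∧ I φ reg' arr') ?_ φ s
    ⟨reg, arr, hs, h⟩).mono ?_
  · rintro φ s ⟨reg', arr', hs', hI⟩ hc
    rw [Test.Holds, hs'.reg_eq a ha, hs'.reg_eq b hb] at hc
    refine (hbody φ reg' arr' hI hc s hs').mono ?_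
    rintro t s'' ⟨reg'', arr'', h1, φ', h2, h3⟩
    exact ⟨φ', ⟨reg'', arr'', h1, h2⟩, h3⟩
  · rintro t s' ⟨φ', ⟨reg', arr', h1, h2⟩, hc, h3⟩
    rw [Test.Holds, h1.reg_eq a ha, h1.reg_eq b hb] at hc
    exact ⟨reg', arr', h1, φ', h2, hc, h3⟩

end

end RAM

/-! ### The number of edges of an m-decyclable graph. -/

theorem SimpleGraph.IsAcyclic.sum_degree_le {n : ℕ} {F : SimpleGraph (Fin n)} [DecidableRel F.Adj]
    (hF : F.IsAcyclic) : ∑ v, F.degree v ≤ 2 * n := by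
  classical
  rcases Nat.eq_zero_or_pos n with rfl | hn
  · simp
  have : Nonempty (Fin n) := ⟨⟨0, hn⟩⟩
  obtain ⟨T, hFT, -, hT⟩ := (connected_top (V := Fin n)).exists_isTree_le_of_le_of_isAcyclic le_top hF
  have h1 := hT.card_edgeFinset
  have h2 : F.edgeFinset.card ≤ T.edgeFinset.card := Finset.card_le_card (edgeFinset_mono hFT)
  rw [sum_degrees_eq_twice_card_edges]
  simp only [Fintype.card_fin] at h1
  omega

/-- The forest contributes at most `2 * n`, and the matching at most one at each vertex. -/
theorem Decyc.sum_degree_le {n : ℕ} {G M : SimpleGraph (Fin n)} [DecidableRel G.Adj] (hM : Decyc G M) :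
    ∑ v, G.degree v ≤ 3 * n := by
  classical
  have h1 := hM.acyc.sum_degree_le
  have h2 : ∀ v, G.degree v ≤ (G \ M).degree v + 1 := by
    intro v
    have h3 : M.degree v ≤ 1 := by
      rw [← card_neighborFinset_eq_degree, Finset.card_le_one]
      intro a ha b hb
      rw [mem_neighborFinset] at ha hb
      exact hM.mat _ _ _ ha hb
    have h4 : G.neighborFinset v ⊆ (G \ M).neighborFinset v ∪ M.neighborFinset v := by
      intro x hx
      simp only [Finset.mem_union, mem_neighborFinset, sdiff_adj] at hx ⊢
      tauto
    have h5 := (Finset.card_le_card h4).trans (Finset.card_union_le _ _)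
    simp only [card_neighborFinset_eq_degree] at h5
    omega
  calc ∑ v, G.degree v ≤ ∑ v, ((G \ M).degree v + 1) := Finset.sum_le_sum (fun v _ => h2 v)
    _ ≤ 3 * n := by
      rw [Finset.sum_add_distrib]; simp; omega

/-! ### Addresses in the encoded adjacency lists. -/

section Encoding

theorem flatMap_getD {α : Type*} (f : α → List ℕ) : ∀ (xs : List α) (i : ℕ) (hi : i < xs.length) (j : ℕ),
    j < (f xs[i]).length →
    (xs.flatMap f).getD (((xs.take i).map fun v => (f v).length).sum + j) 0 = (f xs[i]).getD j 0
  | [], i, hi, j, hj => by simp at hi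
  | x :: xs, 0, hi, j, hj => by
    simp only [List.getElem_cons_zero] at hj
    simp only [List.flatMap_cons, List.take_zero, List.map_nil, List.sum_nil, zero_add,
      List.getElem_cons_zero]
    rw [List.getD_append _ _ _ _ hj]
  | x :: xs, i + 1, hi, j, hj => by
    simp only [List.getElem_cons_succ] at hj ⊢
    rw [← flatMap_getD f xs i (by simpa using hi) j hj]
    simp only [List.flatMap_cons, List.take_succ_cons, List.map_cons, List.sum_cons]
    rw [List.getD_append_right _ _ _ _ (by omega)]
    congr 1
    omega

variable {n : ℕ} (L : Fin n → List (Fin n))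

/-- The address at which the list of vertex `i` begins. -/
def listStart (i : ℕ) : ℕ := n + 2 + (((List.finRange n).take i).map fun v => (L v).length).sum

theorem encodeLists_eq : encodeLists L =
    n :: ((List.range (n + 1)).map (listStart L) ++ (List.finRange n).flatMap fun v => (L v).map Fin.val) :=
  rfl

theorem listStart_succ (v : Fin n) : listStart L (v + 1) = listStart L v + (L v).length := by
  unfold listStart
  rw [List.take_add_one, List.map_append, List.sum_append]
  simp [Nat.add_assoc]

theorem length_encodeLists : (encodeLists L).length = listStart L n := by
  rw [encodeLists_eq, listStart, List.take_of_length_le (by simp)]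
  simp [List.length_flatMap]
  omega

theorem encodeLists_zero : (encodeLists L).getD 0 0 = n := by
  rw [encodeLists_eq]; rfl

theorem encodeLists_start {i : ℕ} (hi : i ≤ n) : (encodeLists L).getD (i + 1) 0 = listStart L i := by
  rw [encodeLists_eq, List.getD_cons_succ, List.getD_append _ _ _ _ (by simp; omega)]
  rw [List.getD_eq_getElem _ _ (by simp; omega)]
  simp

theorem encodeLists_entry (v : Fin n) {j : ℕ} (hj : j < (L v).length) :
    (encodeLists L).getD (listStart L v + j) 0 = (L v)[j] := by
  rw [encodeLists_eq, listStart, show ∀ s, n + 2 + s + j = (n + 1 + (s + j)) + 1 by intros; omega,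
    List.getD_cons_succ, List.getD_append_right _ _ _ _ (by simp)]
  simp only [List.length_map, List.length_range, Nat.add_sub_cancel_left]
  have := flatMap_getD (fun v => (L v).map Fin.val) (List.finRange n) v (by simp) j (by simpa using hj)
  simp only [List.length_map, List.getElem_finRange, Fin.cast_mk, Fin.eta] at this
  rw [this, List.getD_eq_getElem _ _ (by simpa using hj)]
  simp

theorem listStart_mono {i j : ℕ} (h : i ≤ j) (hj : j ≤ n) : listStart L i ≤ listStart L j := by
  induction j, h using Nat.le_induction with
  | base => rfl
  | succ j hij ih =>
    have := listStart_succ L ⟨j, hj⟩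
    simp only at this
    have := ih (by omega)
    omega

theorem le_listStart (i : ℕ) : n + 2 ≤ listStart L i := Nat.le_add_right _ _

theorem listStart_le_length {i : ℕ} (h : i ≤ n) : listStart L i ≤ (encodeLists L).length := by
  rw [length_encodeLists]; exact listStart_mono L h le_rfl

theorem listStart_last : listStart L n = n + 2 + ∑ v, (L v).length := by
  rw [listStart, List.take_of_length_le (by simp), ← List.sum_ofFn, List.ofFn_eq_map]

theorem IsAdjacencyLists.sum_length_le {G : SimpleGraph (Fin n)} {L : Fin n → List (Fin n)}
    (hL : IsAdjacencyLists G L) (hG : G.IsMDecyclable) : ∑ v, (L v).length ≤ 3 * n := by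
  classical
  obtain ⟨M, hM⟩ := isMDecyclable_iff.1 hG
  refine le_trans (le_of_eq ?_) hM.sum_degree_le
  refine Finset.sum_congr rfl fun v _ => ?_
  rw [← card_neighborFinset_eq_degree, ← List.toFinset_card_of_nodup (hL v).1]
  congr 1
  ext x
  simp [(hL v).2 x]

end Encoding

/-! ### The program for a single vertex: scanning its list and judging it. -/

namespace RAM

/-! Registers of the program: `0` verdict, `7` number of vertices, `8` zero, `9` one, `10` end of the
search path, `11` next root, `12` vertex under inspection, `13` and `14` current and final address in a
list, `15` and `16` adjacency to the second and third vertex of the path, `17` and `18` these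
vertices, `19` and `20` scratch, `21, …, 26` labels of the first three vertices of the path, `27` and
`28` labels of the new vertex, `29` beginning of its list. Arrays: `0` next address in the list of each
visited vertex, `1` predecessors on the path, `2`, `3`, `4` the labels `C`, `F`, `A`. -/

/-- The search runs on after a rejection; no later step restores the verdict. -/
def reject : Program := .assign 0 (.const 0)

/-- Decide whether the new vertex is acceptable, and compute its labels. -/
def classify : Program :=
  .ite (.eq 16 8)
    (.ite (.eq 15 8) (.assign 27 (.const 0) ;; .assign 28 (.const 0))
      (.assign 27 (.const 1) ;; .ite (.eq 21 8)
        (.ite (.eq 22 8) (.assign 28 (.copy 25))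
          (.assign 28 (.const 1) ;; .ite (.eq 25 8) .skip reject))
        (.assign 28 (.const 1) ;; .ite (.eq 22 8) .skip reject)))
    (.assign 27 (.const 1) ;; .assign 28 (.const 1) ;;
      .ite (.eq 15 8)
        (.ite (.eq 23 8) reject (.ite (.eq 22 8) .skip reject))
        (.assign 19 (.add 21 24) ;; .assign 19 (.add 19 22) ;; .assign 19 (.add 19 25) ;;
          .assign 19 (.add 19 26) ;; .ite (.eq 19 8) .skip reject))

theorem classify_spec {n : ℕ} {w : List ℕ} {B : ℕ} {reg : ℕ → ℕ} {arr : ℕ → ℕ → ℕ} (hB : 5 ≤ B)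
    (h8 : reg 8 = 0) (h21 : reg 21 ≤ 1) (h22 : reg 22 ≤ 1) (h24 : reg 24 ≤ 1) (h25 : reg 25 ≤ 1)
    (h26 : reg 26 ≤ 1) :
    Wp n w B classify (fun t reg' arr' => arr' = arr ∧ t ≤ 12 ∧
      (∀ r, r ≠ 0 → r ≠ 19 → r ≠ 27 → r ≠ 28 → reg' r = reg r) ∧ reg' 27 ≤ 1 ∧ reg' 28 ≤ 1 ∧
      (reg' 27 ≠ 0 ↔ reg 15 ≠ 0 ∨ reg 16 ≠ 0) ∧
      (reg' 28 ≠ 0 ↔ reg 16 ≠ 0 ∨ (reg 15 ≠ 0 ∧ (reg 21 ≠ 0 ∨ reg 22 ≠ 0 ∨ reg 25 ≠ 0))) ∧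
      (Accepts (reg 15 ≠ 0) (reg 16 ≠ 0) (reg 21 ≠ 0) (reg 22 ≠ 0) (reg 23 ≠ 0) (reg 24 ≠ 0) (reg 25 ≠ 0)
        (reg 26 ≠ 0) → reg' 0 = reg 0) ∧
      (¬ Accepts (reg 15 ≠ 0) (reg 16 ≠ 0) (reg 21 ≠ 0) (reg 22 ≠ 0) (reg 23 ≠ 0) (reg 24 ≠ 0) (reg 25 ≠ 0)
        (reg 26 ≠ 0) → reg' 0 = 0)) reg arr := by
  unfold classify reject
  refine Wp.ite_eq (by decide) (by decide) (fun hb => ?_) (fun hb => ?_)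
  · rw [h8] at hb
    refine Wp.ite_eq (by decide) (by decide) (fun ha => ?_) (fun ha => ?_)
    · rw [h8] at ha
      refine Wp.seq (Wp.const (by decide) (by omega) (Wp.const (by decide) (by omega) ⟨rfl, by omega, ?_⟩))
      simp +contextual [Accepts, ha, hb]
    · rw [h8] at ha
      refine Wp.seq (Wp.const (by decide) (by omega) ?_)
      refine Wp.ite_eq (by decide) (by decide) (fun hc => ?_) (fun hc => ?_)
      · simp [h8] at hc
        refine Wp.ite_eq (by decide) (by decide) (fun hf => ?_) (fun hf => ?_)
        · simp [h8] at hf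
          refine Wp.copy (by decide) (by decide) (by simp; omega) ⟨rfl, by omega, ?_⟩
          simp +contextual [Accepts, ha, hb, (by simpa using hc : reg 21 = 0),
            (by simpa using hf : reg 22 = 0), h25]
        · simp [h8] at hf
          refine Wp.seq (Wp.const (by decide) (by omega) ?_)
          refine Wp.ite_eq (by decide) (by decide) (fun hg => ?_) (fun hg => ?_)
          · simp [h8] at hg
            refine Wp.skip ⟨rfl, by omega, ?_⟩
            simp +contextual [Accepts, ha, hb, (by simpa using hc : reg 21 = 0),
              (by simpa using hf : reg 22 ≠ 0), (by simpa using hg : reg 25 = 0)]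
          · simp [h8] at hg
            refine Wp.const (by decide) (by omega) ⟨rfl, by omega, ?_⟩
            simp +contextual [Accepts, ha, hb, (by simpa using hc : reg 21 = 0),
              (by simpa using hf : reg 22 ≠ 0), (by simpa using hg : reg 25 ≠ 0)]
      · simp [h8] at hc
        refine Wp.seq (Wp.const (by decide) (by omega) ?_)
        refine Wp.ite_eq (by decide) (by decide) (fun hf => ?_) (fun hf => ?_)
        · simp [h8] at hf
          refine Wp.skip ⟨rfl, by omega, ?_⟩
          simp +contextual [Accepts, ha, hb, (by simpa using hc : reg 21 ≠ 0),
            (by simpa using hf : reg 22 = 0)]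
        · simp [h8] at hf
          refine Wp.const (by decide) (by omega) ⟨rfl, by omega, ?_⟩
          simp +contextual [Accepts, ha, hb, (by simpa using hc : reg 21 ≠ 0),
            (by simpa using hf : reg 22 ≠ 0)]
  · rw [h8] at hb
    refine Wp.seq (Wp.const (by decide) (by omega) (Wp.seq (Wp.const (by decide) (by omega) ?_)))
    refine Wp.ite_eq (by decide) (by decide) (fun ha => ?_) (fun ha => ?_)
    · simp [h8] at ha
      refine Wp.ite_eq (by decide) (by decide) (fun hA => ?_) (fun hA => ?_)
      · simp [h8] at hA
        refine Wp.const (by decide) (by omega) ⟨rfl, by omega, ?_⟩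
        simp +contextual [Accepts, hb, (by simpa using ha : reg 15 = 0),
          (by simpa using hA : reg 23 = 0)]
      · simp [h8] at hA
        refine Wp.ite_eq (by decide) (by decide) (fun hf => ?_) (fun hf => ?_)
        · simp [h8] at hf
          refine Wp.skip ⟨rfl, by omega, ?_⟩
          simp +contextual [Accepts, hb, (by simpa using ha : reg 15 = 0),
            (by simpa using hA : reg 23 ≠ 0), (by simpa using hf : reg 22 = 0)]
        · simp [h8] at hf
          refine Wp.const (by decide) (by omega) ⟨rfl, by omega, ?_⟩
          simp +contextual [Accepts, hb, (by simpa using ha : reg 15 = 0),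
            (by simpa using hA : reg 23 ≠ 0), (by simpa using hf : reg 22 ≠ 0)]
    · simp [h8] at ha
      -- The sum of the five labels vanishes only if all of them do, so one test suffices; as labels
      -- are at most `1`, the sum is at most `5`.
      refine Wp.seq (Wp.add (by decide) (by decide) (by decide) (by simp; omega) ?_)
      refine Wp.seq (Wp.add (by decide) (by decide) (by decide) (by simp; omega) ?_)
      refine Wp.seq (Wp.add (by decide) (by decide) (by decide) (by simp; omega) ?_)
      refine Wp.seq (Wp.add (by decide) (by decide) (by decide) (by simp; omega) ?_)
      refine Wp.ite_eq (by decide) (by decide) (fun hs => ?_) (fun hs => ?_)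
      · simp [h8] at hs
        refine Wp.skip ⟨rfl, by omega, ?_⟩
        simp +contextual [Accepts, hb, (by simpa using ha : reg 15 ≠ 0), hs]
      · simp [h8] at hs
        refine Wp.const (by decide) (by omega) ⟨rfl, by omega, ?_⟩
        simp +contextual [Accepts, hb, (by simpa using ha : reg 15 ≠ 0)]
        tauto

/-- Scan a list of neighbours: record which of the vertices `17` and `18` occur, and reject if there is a
visited vertex other than these and the end of the path. -/
def scan : Program :=
  .while (.lt 13 14)
    (.assign 19 (.load 13) ;; .assign 13 (.add 13 9) ;; ld 20 0 19 ;;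
      .ite (.eq 20 8) .skip (.ite (.eq 19 10) .skip (.ite (.eq 19 17) (.assign 15 (.const 1))
        (.ite (.eq 19 18) (.assign 16 (.const 1)) reject))))

/-- What is known after a part `xs` of a list has been scanned. -/
structure Scanned {n : ℕ} (xs : List (Fin n)) (reg : ℕ → ℕ) (arr : ℕ → ℕ → ℕ) (reg' : ℕ → ℕ) : Prop where
  frame : ∀ r, r ≠ 0 → r ≠ 13 → r ≠ 15 → r ≠ 16 → r ≠ 19 → r ≠ 20 → reg' r = reg r
  le_a : reg' 15 ≤ 1
  le_b : reg' 16 ≤ 1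
  iff_a : reg' 15 ≠ 0 ↔ ∃ x ∈ xs, arr 0 x ≠ 0 ∧ x.val ≠ reg 10 ∧ x.val = reg 17
  iff_b : reg' 16 ≠ 0 ↔ ∃ x ∈ xs, arr 0 x ≠ 0 ∧ x.val ≠ reg 10 ∧ x.val ≠ reg 17 ∧ x.val = reg 18
  far : (∃ x ∈ xs, arr 0 x ≠ 0 ∧ x.val ≠ reg 10 ∧ x.val ≠ reg 17 ∧ x.val ≠ reg 18) → reg' 0 = 0
  near : (¬ ∃ x ∈ xs, arr 0 x ≠ 0 ∧ x.val ≠ reg 10 ∧ x.val ≠ reg 17 ∧ x.val ≠ reg 18) → reg' 0 = reg 0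

theorem scan_spec {n : ℕ} {L : Fin n → List (Fin n)} {B : ℕ} {reg : ℕ → ℕ} {arr : ℕ → ℕ → ℕ}
    (hBB : (encodeLists L).length + 5 * (n + 1) ≤ B) (h8 : reg 8 = 0) (h9 : reg 9 = 1)
    (h0 : ∀ x ≤ n, arr 0 x ≤ B) (v : Fin n) (h13 : reg 13 = listStart L v)
    (h14 : reg 14 = listStart L v + (L v).length) (h15 : reg 15 = 0) (h16 : reg 16 = 0) :
    Wp n (encodeLists L) B scan (fun t reg' arr' => arr' = arr ∧ t ≤ 10 * (L v).length + 1 ∧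
      Scanned (L v) reg arr reg') reg arr := by
  -- Ten steps are reserved for each entry: the loop test and at most nine steps of the body.
  let I : ℕ → (ℕ → ℕ) → (ℕ → ℕ → ℕ) → Prop := fun φ reg' arr' => arr' = arr ∧ ∃ k ≤ (L v).length,
    reg' 13 = listStart L v + k ∧ φ = 10 * ((L v).length - k) ∧ Scanned ((L v).take k) reg arr reg'
  have hI : I (10 * (L v).length) reg arr := by
    refine ⟨rfl, 0, by omega, by simpa using h13, by simp, ?_⟩
    constructor <;> simp [h15, h16]
  refine (Wp.while_lt (by decide) (by decide) (I := I) ?_ hI).mono ?_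
  · rintro φ reg' arr' ⟨rfl, k, hk, hk13, rfl, hS⟩ hlt
    rw [hS.frame 14 (by decide) (by decide) (by decide) (by decide) (by decide) (by decide), h14, hk13] at hlt
    have hk' : k < (L v).length := by omega
    have hlen : listStart L v + (L v).length ≤ (encodeLists L).length := by
      rw [← listStart_succ]; exact listStart_le_length L v.2
    have hent := encodeLists_entry L v hk'
    have h8' : reg' 8 = 0 := by rw [hS.frame 8 (by decide) (by decide) (by decide) (by decide) (by decide) (by decide), h8]
    have h9' : reg' 9 = 1 := by rw [hS.frame 9 (by decide) (by decide) (by decide) (by decide) (by decide) (by decide), h9]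
    have h10' := hS.frame 10 (by decide) (by decide) (by decide) (by decide) (by decide) (by decide)
    have h17' := hS.frame 17 (by decide) (by decide) (by decide) (by decide) (by decide) (by decide)
    have h18' := hS.frame 18 (by decide) (by decide) (by decide) (by decide) (by decide) (by decide)
    set x := (L v)[k] with hx
    have hxn := x.2
    have htake : (L v).take (k + 1) = (L v).take k ++ [x] := by
      rw [List.take_add_one, List.getElem?_eq_getElem hk']; rfl
    have hent' : (encodeLists L).getD (reg' 13) 0 = x := by rw [hk13, hent]
    have fin : ∀ t reg'', t ≤ 9 → reg'' 13 = listStart L v + (k + 1) →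
        Scanned ((L v).take (k + 1)) reg arr' reg'' →
        ∃ φ', I φ' reg'' arr' ∧ 1 + t + φ' ≤ 10 * ((L v).length - k) := by
      intro t reg'' ht h13'' hS'
      exact ⟨10 * ((L v).length - (k + 1)), ⟨rfl, k + 1, hk', h13'', rfl, hS'⟩, by omega⟩
    refine Wp.seq (Wp.input (by decide) (by decide) (by omega) (by rw [hent']; omega) ?_)
    rw [hent']
    refine Wp.seq (Wp.add (by decide) (by decide) (by decide) (by simp; omega) ?_)
    refine Wp.seq (Wp.ld hBB (by decide) (by decide) (by decide) (by simp)
      (h0 _ (by simp)) ?_)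
    obtain ⟨f, la, lb, ia, ib, fa, ne⟩ := hS
    refine Wp.ite_eq (by decide) (by decide) (fun hv => ?_) (fun hv => ?_)
    · simp [h8'] at hv
      refine Wp.skip (fin _ _ (by omega) (by simp [hk13, h9']; omega) ?_)
      rw [htake]
      refine ⟨by simp +contextual [f], by simpa [or_and_right, exists_or, hv] using la,
        by simpa [or_and_right, exists_or, hv] using lb,
        by simpa [or_and_right, exists_or, hv] using ia,
        by simpa [or_and_right, exists_or, hv] using ib,
        by simpa [or_and_right, exists_or, hv] using fa,
        by simpa [or_and_right, exists_or, hv] using ne⟩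
    simp [h8'] at hv
    refine Wp.ite_eq (by decide) (by decide) (fun he => ?_) (fun he => ?_)
    · simp [h10'] at he
      refine Wp.skip (fin _ _ (by omega) (by simp [hk13, h9']; omega) ?_)
      rw [htake]
      refine ⟨by simp +contextual [f], by simpa [or_and_right, exists_or, he] using la,
        by simpa [or_and_right, exists_or, he] using lb,
        by simpa [or_and_right, exists_or, he] using ia,
        by simpa [or_and_right, exists_or, he] using ib,
        by simpa [or_and_right, exists_or, he] using fa,
        by simpa [or_and_right, exists_or, he] using ne⟩
    simp [h10'] at he
    refine Wp.ite_eq (by decide) (by decide) (fun hg => ?_) (fun hg => ?_)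
    · simp [h17'] at hg
      refine Wp.const (by decide) (by omega) (fin _ _ (by omega) (by simp [hk13, h9']; omega) ?_)
      rw [htake]
      have he' : reg 17 ≠ reg 10 := hg ▸ he
      have hv' : arr' 0 (reg 17) ≠ 0 := hg ▸ hv
      refine ⟨by simp +contextual [f], by simp,
        by simpa [or_and_right, exists_or, hg] using lb,
        by simp [or_and_right, exists_or, hg, he', hv'],
        by simpa [or_and_right, exists_or, hg] using ib,
        by simpa [or_and_right, exists_or, hg] using fa,
        by simpa [or_and_right, exists_or, hg] using ne⟩
    simp [h17'] at hg
    refine Wp.ite_eq (by decide) (by decide) (fun hq => ?_) (fun hq => ?_)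
    · simp [h18'] at hq
      refine Wp.const (by decide) (by omega) (fin _ _ (by omega) (by simp [hk13, h9']; omega) ?_)
      rw [htake]
      have he' : reg 18 ≠ reg 10 := hq ▸ he
      have hg' : reg 18 ≠ reg 17 := hq ▸ hg
      have hv' : arr' 0 (reg 18) ≠ 0 := hq ▸ hv
      refine ⟨by simp +contextual [f], by simpa [or_and_right, exists_or, hq, hg'] using la,
        by simp,
        by simpa [or_and_right, exists_or, hq, hg'] using ia,
        by simp [or_and_right, exists_or, hq, he', hv', hg'],
        by simpa [or_and_right, exists_or, hq, hg'] using fa,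
        by simpa [or_and_right, exists_or, hq, hg'] using ne⟩
    · simp [h18'] at hq
      refine Wp.const (by decide) (by omega) (fin _ _ (by omega) (by simp [hk13, h9']; omega) ?_)
      rw [htake]
      refine ⟨by simp +contextual [f], by simpa [or_and_right, exists_or, hq, hg] using la,
        by simpa [or_and_right, exists_or, hq, hg] using lb,
        by simpa [or_and_right, exists_or, hq, hg] using ia,
        by simpa [or_and_right, exists_or, hq, hg] using ib,
        by simp,
        by simp [or_and_right, exists_or, hq, he, hv, hg]⟩
  · rintro t reg' arr' ⟨φ', ⟨rfl, k, hk, hk13, rfl, hS⟩, hlt, ht⟩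
    rw [hS.frame 14 (by decide) (by decide) (by decide) (by decide) (by decide) (by decide), h14, hk13] at hlt
    obtain rfl : k = (L v).length := by omega
    rw [List.take_length] at hS
    exact ⟨rfl, by omega, hS⟩

/-! ### The arrays as a description of the search path, and the visit of a vertex. -/

/-- The number of the first vertex of a list, or `n`. -/
def top {n : ℕ} : List (Fin n) → ℕ
  | [] => n
  | x :: _ => x

theorem top_le {n : ℕ} : ∀ l : List (Fin n), top l ≤ n
  | [] => le_rfl
  | x :: _ => x.2.le

/-- The dummy value `n` is the number of no vertex, so paths with fewer than three vertices need no
separate treatment in the program. -/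
theorem eq_top_drop_iff {n : ℕ} {x : Fin n} : ∀ {l : List (Fin n)} {k : ℕ},
    x.val = top (l.drop k) ↔ l[k]? = some x
  | [], k => by simpa [top] using x.2.ne
  | y :: l, 0 => by simp [top, Fin.ext_iff, eq_comm]
  | y :: l, k + 1 => by simpa using eq_top_drop_iff (l := l) (k := k)

theorem eq_top_iff {n : ℕ} {x : Fin n} {l : List (Fin n)} : x.val = top l ↔ l[0]? = some x :=
  eq_top_drop_iff (k := 0)

variable {n : ℕ} {G : SimpleGraph (Fin n)} {L : Fin n → List (Fin n)} {l : List (Fin n)} {v : Fin n}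
  {B : ℕ} {reg reg' : ℕ → ℕ} {arr arr' : ℕ → ℕ → ℕ}

/-- The arrays describe a depth-first search with search path `l`. -/
structure Arrays (G : SimpleGraph (Fin n)) (L : Fin n → List (Fin n)) (l : List (Fin n))
    (arr : ℕ → ℕ → ℕ) : Prop where
  path : SearchPath G {x | arr 0 x ≠ 0} l
  par : ∀ k, arr 1 (top (l.drop k)) = top (l.drop (k + 1))
  null : arr 0 n = 1
  ptr : ∀ x : Fin n, arr 0 x ≠ 0 → listStart L x ≤ arr 0 x ∧ arr 0 x ≤ listStart L x + (L x).length
  flag : ∀ k, 2 ≤ k → k < 5 → ∀ x ≤ n, arr k x ≤ 1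

theorem Arrays.ptr_le (h : Arrays G L l arr) (hB : (encodeLists L).length + 5 * (n + 1) ≤ B) :
    ∀ x ≤ n, arr 0 x ≤ B := by
  intro x hx
  rcases hx.eq_or_lt with rfl | hx
  · rw [h.null]; omega
  · by_cases h0 : arr 0 x = 0
    · omega
    · have h1 := (h.ptr ⟨x, hx⟩ h0).2
      rw [← listStart_succ] at h1
      have := listStart_le_length L (i := x + 1) hx
      dsimp only at h1
      omega

/-- These registers carry the state of the search; the verdict in register `0` is tracked
separately. -/
def Keeps (reg reg' : ℕ → ℕ) : Prop := ∀ r, 7 ≤ r ∧ r ≤ 12 ∨ r = 30 → reg' r = reg r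

/-- What is known about the visited neighbours of `v` after its list has been scanned. -/
structure Examined (G : SimpleGraph (Fin n)) (L : Fin n → List (Fin n)) (l : List (Fin n)) (v : Fin n)
    (reg : ℕ → ℕ) (arr : ℕ → ℕ → ℕ) (reg' : ℕ → ℕ) : Prop where
  keeps : Keeps reg reg'
  second : reg' 17 = top (l.drop 1)
  third : reg' 18 = top (l.drop 2)
  start : reg' 29 = listStart L v
  le_a : reg' 15 ≤ 1
  le_b : reg' 16 ≤ 1
  iff_a : reg' 15 ≠ 0 ↔ ∃ g, l[1]? = some g ∧ G.Adj v g
  iff_b : reg' 16 ≠ 0 ↔ ∃ q, l[2]? = some q ∧ G.Adj v q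
  far : (∃ x : Fin n, arr 0 x ≠ 0 ∧ G.Adj v x ∧ l[0]? ≠ some x ∧ l[1]? ≠ some x ∧ l[2]? ≠ some x) → reg' 0 = 0
  near : (¬ ∃ x : Fin n, arr 0 x ≠ 0 ∧ G.Adj v x ∧ l[0]? ≠ some x ∧ l[1]? ≠ some x ∧ l[2]? ≠ some x) →
    reg' 0 = reg 0

/-- Find the first vertices of the path, and scan the list of the new vertex. -/
def examine : Program :=
  ld 17 1 10 ;; ld 18 1 17 ;; .assign 19 (.add 12 9) ;; .assign 13 (.load 19) ;; .assign 19 (.add 19 9) ;;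
    .assign 14 (.load 19) ;; .assign 15 (.const 0) ;; .assign 16 (.const 0) ;; .assign 29 (.copy 13) ;; scan

theorem examine_spec (hL : IsAdjacencyLists G L) (hB : (encodeLists L).length + 5 * (n + 1) ≤ B)
    (hA : Arrays G L l arr) (h8 : reg 8 = 0) (h9 : reg 9 = 1) (h10 : reg 10 = top l) (h12 : reg 12 = v) :
    Wp n (encodeLists L) B examine (fun t reg' arr' => arr' = arr ∧ t ≤ 10 * (L v).length + 12 ∧
      Examined G L l v reg arr reg') reg arr := by
  have hv := v.2
  have p0 : arr 1 (top l) = top (l.drop 1) := hA.par 0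
  have p1 : arr 1 (top (l.drop 1)) = top (l.drop 2) := hA.par 1
  have t0 := top_le l
  have t1 := top_le (l.drop 1)
  have t2 := top_le (l.drop 2)
  have hs : (encodeLists L).getD (v + 1) 0 = listStart L v := encodeLists_start L hv.le
  have hs' : (encodeLists L).getD (v + 1 + 1) 0 = listStart L v + (L v).length := by
    rw [encodeLists_start L hv, listStart_succ]
  have hl : listStart L v + (L v).length ≤ (encodeLists L).length := by
    rw [← listStart_succ]; exact listStart_le_length L hv
  have hw : n + 2 ≤ (encodeLists L).length := (le_listStart L v).trans (le_trans (Nat.le_add_right _ _) hl)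
  unfold examine
  refine Wp.seq (Wp.ld hB (by decide) (by decide) (by decide) (by omega) (by rw [h10, p0]; omega) ?_)
  rw [h10, p0]
  refine Wp.seq (Wp.ld hB (by decide) (by decide) (by decide) (by simpa [-List.drop_one]) (by simp [p1, -List.drop_one]; omega) ?_)
  refine Wp.seq (Wp.add (by decide) (by decide) (by decide) (by simp; omega) ?_)
  refine Wp.seq (Wp.input (by decide) (by decide) (by simp [h12, h9]; omega)
    (by simp [h12, h9, -List.getD_eq_getElem?_getD, hs]; omega) ?_)
  refine Wp.seq (Wp.add (by decide) (by decide) (by decide) (by simp; omega) ?_)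
  refine Wp.seq (Wp.input (by decide) (by decide) (by simp [h12, h9]; omega)
    (by simp [h12, h9, -List.getD_eq_getElem?_getD, hs']; omega) ?_)
  refine Wp.seq (Wp.const (by decide) (by omega) (Wp.seq (Wp.const (by decide) (by omega) ?_)))
  refine Wp.seq (Wp.copy (by decide) (by decide)
    (by simp [h12, h9, -List.getD_eq_getElem?_getD, hs]; omega) ?_)
  refine (scan_spec hB (by simpa) (by simpa) (hA.ptr_le hB) v
    (by simp [h12, h9, -List.getD_eq_getElem?_getD, hs])
    (by simp [h12, h9, -List.getD_eq_getElem?_getD, hs']) (by simp) (by simp)).mono ?_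
  rintro t reg' arr' ⟨rfl, ht, hS⟩
  refine ⟨rfl, by omega, ?_⟩
  obtain ⟨f, la, lb, ia, ib, fa, ne⟩ := hS
  have nd := hA.path.nodup
  have sub := hA.path.sub
  have hadj : ∀ x, x ∈ L v ↔ G.Adj v x := (hL v).2
  simp [h10, p1, hadj, -List.drop_one, eq_top_iff] at ia ib fa ne
  -- Path vertices are distinct, so the exclusions caused by the order of the tests in `scan` hold
  -- automatically.
  have key : ∀ {i j : ℕ} {x : Fin n}, l[i]? = some x → l[j]? = some x → i = j := by
    intro i j x hi hj
    obtain ⟨hi', hi⟩ := List.getElem?_eq_some_iff.1 hi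
    obtain ⟨hj', hj⟩ := List.getElem?_eq_some_iff.1 hj
    exact (List.Nodup.getElem_inj_iff nd).1 (hi.trans hj.symm)
  have vis : ∀ {i : ℕ} {x : Fin n}, l[i]? = some x → arr' 0 x ≠ 0 :=
    fun h => sub _ (List.mem_of_getElem? h)
  refine ⟨?_, ?_, ?_, ?_, la, lb, ?_, ?_, ?_, ?_⟩
  · intro r hr
    rw [f r (by omega) (by omega) (by omega) (by omega) (by omega) (by omega)]
    repeat rw [Function.update_of_ne (by omega)]
  · simpa [p1, -List.drop_one] using
      f 17 (by decide) (by decide) (by decide) (by decide) (by decide) (by decide)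
  · simpa [p1, -List.drop_one] using
      f 18 (by decide) (by decide) (by decide) (by decide) (by decide) (by decide)
  · simpa [h12, h9, -List.getD_eq_getElem?_getD, hs] using
      f 29 (by decide) (by decide) (by decide) (by decide) (by decide) (by decide)
  · rw [ne_eq, ia]
    constructor
    · rintro ⟨x, h1, -, -, h2⟩
      exact ⟨x, h2, h1⟩
    · rintro ⟨x, h2, h1⟩
      exact ⟨x, h1, vis h2, fun h => absurd (key h h2) (by decide), h2⟩
  · rw [ne_eq, ib]
    constructor
    · rintro ⟨x, h1, -, -, -, h2⟩
      exact ⟨x, h2, h1⟩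
    · rintro ⟨x, h2, h1⟩
      exact ⟨x, h1, vis h2, fun h => absurd (key h h2) (by decide),
        fun h => absurd (key h h2) (by decide), h2⟩
  · rintro ⟨x, h1, h2, h3, h4, h5⟩
    exact fa x h2 h1 h3 h4 h5
  · intro h
    refine ne fun x h2 h1 h3 h4 => ?_
    by_contra h5
    exact h ⟨x, h1, h2, h3, h4, h5⟩

/-- Load the labels, and judge the new vertex. -/
def judge : Program :=
  ld 21 2 10 ;; ld 22 3 10 ;; ld 23 4 10 ;; ld 24 2 17 ;; ld 25 3 17 ;; ld 26 3 18 ;; classify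

theorem judge_spec {w : List ℕ} (hB : w.length + 5 * (n + 1) ≤ B) (h8 : reg 8 = 0) (h10 : reg 10 ≤ n)
    (h17 : reg 17 ≤ n) (h18 : reg 18 ≤ n) (hf : ∀ k, 2 ≤ k → k < 5 → ∀ x ≤ n, arr k x ≤ 1) :
    Wp n w B judge (fun t reg' arr' => arr' = arr ∧ t ≤ 24 ∧ Keeps reg reg' ∧
      (∀ r, 15 ≤ r ∧ r ≤ 18 ∨ r = 29 → reg' r = reg r) ∧ reg' 27 ≤ 1 ∧ reg' 28 ≤ 1 ∧
      (reg' 27 ≠ 0 ↔ reg 15 ≠ 0 ∨ reg 16 ≠ 0) ∧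
      (reg' 28 ≠ 0 ↔ reg 16 ≠ 0 ∨
        (reg 15 ≠ 0 ∧ (arr 2 (reg 10) ≠ 0 ∨ arr 3 (reg 10) ≠ 0 ∨ arr 3 (reg 17) ≠ 0))) ∧
      (Accepts (reg 15 ≠ 0) (reg 16 ≠ 0) (arr 2 (reg 10) ≠ 0) (arr 3 (reg 10) ≠ 0) (arr 4 (reg 10) ≠ 0)
        (arr 2 (reg 17) ≠ 0) (arr 3 (reg 17) ≠ 0) (arr 3 (reg 18) ≠ 0) → reg' 0 = reg 0) ∧
      (¬ Accepts (reg 15 ≠ 0) (reg 16 ≠ 0) (arr 2 (reg 10) ≠ 0) (arr 3 (reg 10) ≠ 0) (arr 4 (reg 10) ≠ 0)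
        (arr 2 (reg 17) ≠ 0) (arr 3 (reg 17) ≠ 0) (arr 3 (reg 18) ≠ 0) → reg' 0 = 0)) reg arr := by
  have b1 := hf 2 (by omega) (by omega) _ h10
  have b2 := hf 3 (by omega) (by omega) _ h10
  have b3 := hf 4 (by omega) (by omega) _ h10
  have b4 := hf 2 (by omega) (by omega) _ h17
  have b5 := hf 3 (by omega) (by omega) _ h17
  have b6 := hf 3 (by omega) (by omega) _ h18
  unfold judge
  refine Wp.seq (Wp.ld hB (by decide) (by decide) (by decide) (by simpa) (by omega) ?_)
  refine Wp.seq (Wp.ld hB (by decide) (by decide) (by decide) (by simpa) (by simp; omega) ?_)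
  refine Wp.seq (Wp.ld hB (by decide) (by decide) (by decide) (by simpa) (by simp; omega) ?_)
  refine Wp.seq (Wp.ld hB (by decide) (by decide) (by decide) (by simpa) (by simp; omega) ?_)
  refine Wp.seq (Wp.ld hB (by decide) (by decide) (by decide) (by simpa) (by simp; omega) ?_)
  refine Wp.seq (Wp.ld hB (by decide) (by decide) (by decide) (by simpa) (by simp; omega) ?_)
  refine (classify_spec (by omega) (by simpa) (by simpa) (by simpa) (by simpa) (by simpa) (by simpa)).mono ?_
  rintro t reg' arr' ⟨rfl, ht, f, h1, h2, h3, h4, h5, h6⟩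
  refine ⟨rfl, by omega, ?_, ?_, h1, h2, by simpa using h3, by simpa using h4, by simpa using h5, by simpa using h6⟩
  · intro r hr
    rw [f r (by omega) (by omega) (by omega) (by omega)]
    repeat rw [Function.update_of_ne (by omega)]
  · intro r hr
    rw [f r (by omega) (by omega) (by omega) (by omega)]
    repeat rw [Function.update_of_ne (by omega)]

/-- Enter the new vertex into the arrays, and make it the end of the path. -/
def record : Program :=
  st 0 12 29 ;; st 1 12 10 ;; st 2 12 27 ;; st 3 12 28 ;; st 4 12 15 ;;
    .ite (.eq 27 8) .skip (st 2 10 9) ;; .ite (.eq 16 8) .skip (st 2 17 9) ;; .assign 10 (.copy 12)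

theorem record_spec {w : List ℕ} (hB : w.length + 5 * (n + 1) ≤ B) (h8 : reg 8 = 0) (h9 : reg 9 = 1)
    (h10 : reg 10 ≤ n) (h12 : reg 12 ≤ n) (h17 : reg 17 ≤ n) :
    Wp n w B record (fun t reg' arr' => t ≤ 20 ∧ reg' = Function.update reg 10 (reg 12) ∧
      arr' 0 = Function.update (arr 0) (reg 12) (reg 29) ∧
      arr' 1 = Function.update (arr 1) (reg 12) (reg 10) ∧
      arr' 3 = Function.update (arr 3) (reg 12) (reg 28) ∧
      arr' 4 = Function.update (arr 4) (reg 12) (reg 15) ∧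
      ∀ x, arr' 2 x = if (x = reg 10 ∧ reg 27 ≠ 0) ∨ (x = reg 17 ∧ reg 16 ≠ 0) then 1
        else if x = reg 12 then reg 27 else arr 2 x) reg arr := by
  unfold record
  refine Wp.seq (Wp.st hB (by decide) (by decide) (by decide) (by simpa) ?_)
  refine Wp.seq (Wp.st hB (by decide) (by decide) (by decide) (by simpa) ?_)
  refine Wp.seq (Wp.st hB (by decide) (by decide) (by decide) (by simpa) ?_)
  refine Wp.seq (Wp.st hB (by decide) (by decide) (by decide) (by simpa) ?_)
  refine Wp.seq (Wp.st hB (by decide) (by decide) (by decide) (by simpa) ?_)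
  refine Wp.seq (Wp.ite_eq (by decide) (by decide) (fun hc => Wp.skip ?_)
    (fun hc => Wp.st hB (by decide) (by decide) (by decide) (by simpa) ?_))
  all_goals
    refine Wp.seq (Wp.ite_eq (by decide) (by decide) (fun hb => Wp.skip ?_)
      (fun hb => Wp.st hB (by decide) (by decide) (by decide) (by simpa) ?_))
    all_goals
      rw [h8] at hc hb
      refine Wp.copy (by decide) (by decide) (by omega) ⟨by omega, rfl, ?_⟩
      simp [hc, hb, h9, Function.update_apply]
  all_goals
    intro x
    split_ifs <;> simp_all

/-- The verdict `r` on the visited part of the graph is correct, and so are the labels if it is positive. -/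
def Verdict (G : SimpleGraph (Fin n)) (l : List (Fin n)) (arr : ℕ → ℕ → ℕ) (r : ℕ) : Prop :=
  (r = 1 ∧ Labelled G {x | arr 0 x ≠ 0} l (fun x => arr 2 x ≠ 0) (fun x => arr 3 x ≠ 0)
    (fun x => arr 4 x ≠ 0)) ∨ (r = 0 ∧ ¬ (G.IsChordal ∧ G.IsMDecyclable))

/-- Visit a vertex. -/
def visit : Program := examine ;; judge ;; record

/-- The arrays `arr'` result from `arr` when `v` is entered with the labels `c`, `f` and `a`, where `b` tells
that `v` is adjacent to the third vertex of the path. -/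
structure Entered (L : Fin n → List (Fin n)) (l : List (Fin n)) (v : Fin n) (arr : ℕ → ℕ → ℕ)
    (c f a b : ℕ) (arr' : ℕ → ℕ → ℕ) : Prop where
  ptr : arr' 0 = Function.update (arr 0) v (listStart L v)
  par : arr' 1 = Function.update (arr 1) v (top l)
  C : ∀ x, arr' 2 x = if (x = top l ∧ c ≠ 0) ∨ (x = top (l.drop 1) ∧ b ≠ 0) then 1
        else if x = v then c else arr 2 x
  F : arr' 3 = Function.update (arr 3) v f
  A : arr' 4 = Function.update (arr 4) v a

/-- List addresses are at least `n + 2`, hence nonzero, so the stored pointer doubles as the mark of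
a visited vertex. -/
theorem Entered.visited {c f a b : ℕ} (h : Entered L l v arr c f a b arr') :
    {x : Fin n | arr' 0 x ≠ 0} = insert v {x : Fin n | arr 0 x ≠ 0} := by
  have := le_listStart L v
  ext x
  by_cases hx : x = v
  · simp [h.ptr, hx]; omega
  · simp [h.ptr, hx, Function.update_apply, Fin.ext_iff.not.1 hx]

theorem Entered.arrays {c f a b : ℕ} (h : Entered L l v arr c f a b arr') (hc : c ≤ 1) (hf : f ≤ 1)
    (ha : a ≤ 1) (hA : Arrays G L l arr) (hv : arr 0 v = 0) (hh : ∀ p ∈ l.head?, G.Adj v p) :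
    Arrays G L (v :: l) arr' := by
  have hvn := v.2
  refine ⟨?_, ?_, ?_, ?_, ?_⟩
  · rw [h.visited]
    exact hA.path.push (by simpa) hh
  · rintro (_ | k)
    · simp [h.par, top]
    · rw [List.drop_succ_cons, List.drop_succ_cons, h.par, Function.update_of_ne, hA.par]
      intro he
      exact hA.path.sub v (List.mem_of_getElem? (eq_top_drop_iff.1 he.symm)) hv
  · rw [h.ptr, Function.update_of_ne (by omega), hA.null]
  · intro x hx
    by_cases hxv : x = v
    · simp [h.ptr, hxv]
    · rw [h.ptr, Function.update_of_ne (Fin.ext_iff.not.1 hxv)] at hx ⊢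
      exact hA.ptr x hx
  · intro k hk hk' x hx
    have h1 := hA.flag k hk hk' x hx
    obtain rfl | rfl | rfl : k = 2 ∨ k = 3 ∨ k = 4 := by omega
    · rw [h.C]; split_ifs <;> omega
    · rw [h.F, Function.update_apply]; split_ifs <;> omega
    · rw [h.A, Function.update_apply]; split_ifs <;> omega

theorem visit_spec (hL : IsAdjacencyLists G L) (hB : (encodeLists L).length + 5 * (n + 1) ≤ B)
    (hA : Arrays G L l arr) (hV : Verdict G l arr (reg 0)) (h8 : reg 8 = 0) (h9 : reg 9 = 1)
    (h10 : reg 10 = top l) (h12 : reg 12 = v) (hv : arr 0 v = 0) (hh : ∀ p ∈ l.head?, G.Adj v p) :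
    Wp n (encodeLists L) B visit (fun t reg' arr' => t ≤ 10 * (L v).length + 56 ∧
      reg' 7 = reg 7 ∧ reg' 8 = 0 ∧ reg' 9 = 1 ∧ reg' 10 = v ∧ reg' 11 = reg 11 ∧ reg' 30 = reg 30 ∧
      arr' 0 = Function.update (arr 0) v (listStart L v) ∧ Arrays G L (v :: l) arr' ∧
      Verdict G (v :: l) arr' (reg' 0)) reg arr := by
  refine Wp.seq ((examine_spec hL hB hA h8 h9 h10 h12).mono ?_)
  rintro t1 reg1 _ ⟨rfl, ht1, hE⟩
  have e10 := hE.keeps 10 (by decide)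
  rw [h10] at e10
  refine Wp.seq ((judge_spec hB (by rw [hE.keeps 8 (by decide), h8]) (by rw [e10]; exact top_le l)
    (by rw [hE.second]; exact top_le _) (by rw [hE.third]; exact top_le _) hA.flag).mono ?_)
  rintro t2 reg2 arr2 ⟨rfl, ht2, hK, f, lc, lf, ic, iF, hacc, hrej⟩
  have k : ∀ r, 7 ≤ r ∧ r ≤ 12 ∨ r = 30 → reg2 r = reg r := fun r hr => (hK r hr).trans (hE.keeps r hr)
  have f17 : reg2 17 = top (l.drop 1) := (f 17 (by decide)).trans hE.second
  refine (record_spec hB (by rw [k 8 (by decide), h8]) (by rw [k 9 (by decide), h9])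
    (by rw [k 10 (by decide), h10]; exact top_le l) (by rw [k 12 (by decide), h12]; exact v.2.le)
    (by rw [f17]; exact top_le _)).mono ?_
  rintro t3 reg3 arr3 ⟨ht3, rfl, a0, a1, a3, a4, a2⟩
  have hEn : Entered L l v arr2 (reg2 27) (reg2 28) (reg1 15) (reg1 16) arr3 := by
    rw [k 12 (by decide), h12] at a0 a1 a2 a3 a4
    rw [k 10 (by decide), h10] at a1 a2
    rw [f17, f 16 (by decide)] at a2
    rw [f 29 (by decide), hE.start] at a0
    rw [f 15 (by decide)] at a4
    exact ⟨a0, a1, a2, a3, a4⟩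
  refine ⟨by omega, by simp [k], by simp [k, h8], by simp [k, h9], by simp [k, h12], by simp [k], by simp [k],
    hEn.ptr, hEn.arrays lc lf hE.le_a hA hv hh, ?_⟩
  rw [Function.update_of_ne (by decide)]
  rw [e10, hE.second, hE.third] at hacc hrej
  rw [e10, hE.second] at iF
  -- After a rejection the labels carry no meaning, and it is enough that the verdict stays `0`.
  rcases hV with ⟨h0, hLab⟩ | ⟨h0, hbad⟩
  swap
  · refine Or.inr ⟨?_, hbad⟩
    have : reg1 0 = 0 := by
      by_cases h : ∃ x : Fin n, arr2 0 x ≠ 0 ∧ G.Adj v x ∧ l[0]? ≠ some x ∧ l[1]? ≠ some x ∧ l[2]? ≠ some x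
      · exact hE.far h
      · rw [hE.near h, h0]
    rw [this] at hacc
    by_cases h : Accepts (reg1 15 ≠ 0) (reg1 16 ≠ 0) (arr2 2 (top l) ≠ 0) (arr2 3 (top l) ≠ 0)
      (arr2 4 (top l) ≠ 0) (arr2 2 (top (l.drop 1)) ≠ 0) (arr2 3 (top (l.drop 1)) ≠ 0)
      (arr2 3 (top (l.drop 2)) ≠ 0)
    · exact hacc h
    · exact hrej h
  by_cases hfar : ∃ x : Fin n, arr2 0 x ≠ 0 ∧ G.Adj v x ∧ l[0]? ≠ some x ∧ l[1]? ≠ some x ∧ l[2]? ≠ some x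
  · refine Or.inr ⟨?_, ?_⟩
    · rw [hE.far hfar] at hacc
      by_cases h : Accepts (reg1 15 ≠ 0) (reg1 16 ≠ 0) (arr2 2 (top l) ≠ 0) (arr2 3 (top l) ≠ 0)
        (arr2 4 (top l) ≠ 0) (arr2 2 (top (l.drop 1)) ≠ 0) (arr2 3 (top (l.drop 1)) ≠ 0)
        (arr2 3 (top (l.drop 2)) ≠ 0)
      · exact hacc h
      · exact hrej h
    · obtain ⟨x, hx, hvx, n0, n1, n2⟩ := hfar
      exact not_good_of_far hA.path (by simpa) hh hx hvx n0 n1 n2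
  have hl : ∀ x ∈ {x : Fin n | arr2 0 x ≠ 0}, G.Adj v x →
      l[0]? = some x ∨ l[1]? = some x ∨ l[2]? = some x := by
    intro x hx hvx
    by_contra h
    push Not at h
    exact hfar ⟨x, hx, hvx, h⟩
  have hne : ∀ x ∈ l, x ≠ v := by
    rintro x hx rfl
    exact hA.path.sub x hx hv
  have hp : ∀ {i : ℕ} {x : Fin n}, l[i]? = some x → top (l.drop i) = x := fun h => (eq_top_drop_iff.2 h).symm
  have hp0 : ∀ {x : Fin n}, l[0]? = some x → top l = x := fun h => (eq_top_iff.2 h).symm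
  have main := Labelled.push hLab hA.path (v := v) (by simpa) hh hl hE.iff_a hE.iff_b
    (C' := fun x : Fin n => arr3 2 x ≠ 0) (F' := fun x : Fin n => arr3 3 x ≠ 0)
    (A' := fun x : Fin n => arr3 4 x ≠ 0)
    (cp := arr2 2 (top l) ≠ 0) (fp := arr2 3 (top l) ≠ 0) (ap := arr2 4 (top l) ≠ 0)
    (cg := arr2 2 (top (l.drop 1)) ≠ 0) (fg := arr2 3 (top (l.drop 1)) ≠ 0)
    (fq := arr2 3 (top (l.drop 2)) ≠ 0)
    (fun p h => by simp [hp0 h]) (fun g h => by rw [hp h]; simp) (fun q h => by rw [hp h])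
    ?_ ?_ ?_ ?_ ?_ ?_
  · rw [← hEn.visited] at main
    by_cases h : Accepts (reg1 15 ≠ 0) (reg1 16 ≠ 0) (arr2 2 (top l) ≠ 0) (arr2 3 (top l) ≠ 0)
      (arr2 4 (top l) ≠ 0) (arr2 2 (top (l.drop 1)) ≠ 0) (arr2 3 (top (l.drop 1)) ≠ 0)
      (arr2 3 (top (l.drop 2)) ≠ 0)
    · exact Or.inl ⟨by rw [hacc h, hE.near hfar, h0], main.1 h⟩
    · exact Or.inr ⟨hrej h, main.2 h⟩
  · have h1 : ∀ i, v.val ≠ top (l.drop i) := fun i h => hne v (List.mem_of_getElem? (eq_top_drop_iff.1 h)) rfl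
    have h0 := h1 0
    rw [List.drop_zero] at h0
    rw [hEn.C, if_neg (by simp [h0, h1, -List.drop_one]), if_pos rfl, ic]
  · intro x hx
    have hxv : x.val ≠ v.val := fun h => hne x hx (Fin.ext h)
    rw [hEn.C, ← ic, ← eq_top_iff, ← eq_top_drop_iff, if_neg hxv]
    split_ifs with h
    · exact ⟨fun _ => Or.inr h, fun _ => one_ne_zero⟩
    · exact ⟨Or.inl, fun h' => h'.resolve_right h⟩
  · rw [hEn.F, Function.update_self, iF]
  · intro x hx
    rw [hEn.F, Function.update_of_ne fun h => hne x hx (Fin.ext h)]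
  · rw [hEn.A, Function.update_self]
  · intro x hx
    rw [hEn.A, Function.update_of_ne fun h => hne x hx (Fin.ext h)]

/-! ### The search loop and its potential. -/

/-- Find the next vertex to be inspected: the next root if the path is empty, otherwise the next neighbour
of the end of the path; if there is none, then remove the end of the path. -/
def advance : Program :=
  .ite (.eq 10 7) (.assign 12 (.copy 11) ;; .assign 11 (.add 11 9))
    (ld 13 0 10 ;; .assign 19 (.add 10 9) ;; .assign 19 (.add 19 9) ;; .assign 14 (.load 19) ;;
      .ite (.lt 13 14) (.assign 12 (.load 13) ;; .assign 13 (.add 13 9) ;; st 0 10 13)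
        (ld 19 1 10 ;; ld 20 2 10 ;; .ite (.eq 20 8) .skip (ld 20 3 10 ;; st 3 19 20) ;;
          .assign 10 (.copy 19) ;; .assign 12 (.copy 7)))

/-- One step of the search. -/
def step : Program := advance ;; ld 20 0 12 ;; .ite (.eq 20 8) visit .skip

/-- The state of the search; the vertex `u` is under inspection, or `u = n`. -/
structure Searching (G : SimpleGraph (Fin n)) (L : Fin n → List (Fin n)) (l : List (Fin n)) (u : ℕ)
    (reg : ℕ → ℕ) (arr : ℕ → ℕ → ℕ) : Prop where
  size : reg 7 = n
  zero : reg 8 = 0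
  one : reg 9 = 1
  last : reg 10 = top l
  root_le : reg 11 ≤ n + 1
  limit : reg 30 = n + 1
  arrays : Arrays G L l arr
  verdict : Verdict G l arr (reg 0)
  roots : ∀ x : Fin n, x < reg 11 → arr 0 x ≠ 0 ∨ x = u
  seen : ∀ (x : Fin n) (j : ℕ) (hj : j < (L x).length), listStart L x + j < arr 0 x →
    arr 0 (L x)[j] ≠ 0 ∨ (L x)[j] = u
  finish : reg 11 = n + 1 → l = [] ∧ u = n

/-- The number of steps that remain for a vertex. -/
def remaining (L : Fin n → List (Fin n)) (arr : ℕ → ℕ → ℕ) (x : Fin n) : ℕ :=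
  if arr 0 x = 0 then 2 + 2 * (L x).length else listStart L x + (L x).length - arr 0 x

/-- The summands pay for roots to be drawn (the dummy root `n` included), removals from the path,
and list entries to be read. A visit replaces `2 + 2 * length` by `length` and lengthens the path by
one, which releases `1 + length` units for the scan. -/
def potential (L : Fin n → List (Fin n)) (l : List (Fin n)) (r : ℕ) (arr : ℕ → ℕ → ℕ) : ℕ :=
  (n + 1 - r) + l.length + ∑ x, remaining L arr x

theorem sum_remaining_update {s d : ℕ} (h : arr' 0 = Function.update (arr 0) v s)
    (hd : remaining L arr' v + d ≤ remaining L arr v) :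
    ∑ x, remaining L arr' x + d ≤ ∑ x, remaining L arr x := by
  rw [← Finset.add_sum_erase _ _ (Finset.mem_univ v),
    ← Finset.add_sum_erase _ (remaining L arr) (Finset.mem_univ v)]
  have : ∑ x ∈ Finset.univ.erase v, remaining L arr' x = ∑ x ∈ Finset.univ.erase v, remaining L arr x := by
    refine Finset.sum_congr rfl fun x hx => ?_
    unfold remaining
    rw [h, Function.update_of_ne (Fin.ext_iff.not.1 (Finset.ne_of_mem_erase hx))]
  omega

theorem remaining_congr (h : arr' 0 = arr 0) : remaining L arr' = remaining L arr := by
  funext x; unfold remaining; rw [h]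

theorem tail_searchPath {x : Fin n} (hS : SearchPath G {x | arr 0 x ≠ 0} (x :: l))
    (hx : ∀ y, G.Adj x y → arr 0 y ≠ 0) : SearchPath G {x | arr 0 x ≠ 0} l := by
  refine ⟨fun y hy => hS.sub y (List.mem_cons_of_mem _ hy), (List.nodup_cons.1 hS.nodup).2,
    hS.chain.tail, ?_⟩
  intro y hy hyl z hyz
  by_cases h : y = x
  · exact hx z (h ▸ hyz)
  · exact hS.closed y hy (by simp [h, hyl]) z hyz

/-- The pointer moves past entry `j` before that neighbour is known to be visited; this is why
`seen` makes an exception for the vertex under inspection. -/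
theorem Searching.next_neighbor {x : Fin n} {j : ℕ} (hL : IsAdjacencyLists G L)
    (hS : Searching G L (x :: l) n reg arr) (hr : reg 11 < n + 1) (hj : arr 0 x = listStart L x + j)
    (hj' : j < (L x).length) (hreg : ∀ r, r = 0 ∨ 7 ≤ r ∧ r ≤ 11 ∨ r = 30 → reg' r = reg r)
    (h12 : reg' 12 = (L x)[j]) (h0 : arr' 0 = Function.update (arr 0) x (arr 0 x + 1))
    (hk : ∀ k, k ≠ 0 → arr' k = arr k) :
    reg' 12 ≤ n ∧ ∃ l', Searching G L l' (reg' 12) reg' arr' ∧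
      (∀ v : Fin n, v = reg' 12 → ∀ p ∈ l'.head?, G.Adj v p) ∧
      potential L l' (reg' 11) arr' + 1 ≤ potential L (x :: l) (reg 11) arr := by
  obtain ⟨h7, h8, h9, h10, h11, h30, hA, hV, hroots, hseen, hfin⟩ := hS
  have hxn := x.2
  have hx0 : arr 0 x ≠ 0 := hA.path.sub x List.mem_cons_self
  have hvis : ∀ y, arr' 0 y = 0 ↔ arr 0 y = 0 := by
    intro y
    by_cases hy : y = x
    · simp [h0, hy, hx0]
    · simp [h0, hy]
  have hset : {y : Fin n | arr' 0 y ≠ 0} = {y : Fin n | arr 0 y ≠ 0} := by simp [hvis]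
  rw [h12]
  refine ⟨((L x)[j]).2.le, x :: l, ⟨by simp [hreg, h7], by simp [hreg, h8], by simp [hreg, h9],
    by simp [hreg, h10], by simpa [hreg], by simpa [hreg], ⟨?_, ?_, ?_, ?_, ?_⟩, ?_, ?_, ?_, ?_⟩, ?_, ?_⟩
  · rw [hset]; exact hA.path
  · rw [hk 1 (by decide)]; exact hA.par
  · rw [h0, Function.update_of_ne (by omega), hA.null]
  · intro y hy
    have := hA.ptr y (by rwa [ne_eq, ← hvis])
    by_cases hyx : y = x
    · subst hyx
      rw [h0, Function.update_self]
      omega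
    · rwa [h0, Function.update_of_ne (Fin.ext_iff.not.1 hyx)]
  · intro k h2 h5
    rw [hk k (by omega)]
    exact hA.flag k h2 h5
  · simpa only [Verdict, hreg 0 (Or.inl rfl), hset, hk 2 (by decide), hk 3 (by decide), hk 4 (by decide)]
      using hV
  · intro y hy
    rw [ne_eq, hvis]
    exact Or.inl ((hroots y (by simpa [hreg] using hy)).resolve_right y.2.ne)
  · intro y i hi hlt
    rw [ne_eq, hvis]
    by_cases hyx : y = x
    · subst hyx
      rw [h0, Function.update_self] at hlt
      by_cases hij : i = j
      · subst hij; exact Or.inr rfl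
      · exact Or.inl ((hseen y i hi (by omega)).resolve_right (Fin.is_lt _).ne)
    · rw [h0, Function.update_of_ne (Fin.ext_iff.not.1 hyx)] at hlt
      exact Or.inl ((hseen y i hi hlt).resolve_right (Fin.is_lt _).ne)
  · intro h
    rw [hreg 11 (by decide)] at h
    omega
  · intro v hv
    obtain rfl : v = (L x)[j] := Fin.ext hv
    simpa using (((hL x).2 _).1 (List.getElem_mem hj')).symm
  · have := sum_remaining_update (L := L) (d := 1) h0 (by simp [remaining, hvis, hx0]; simp [h0]; omega)
    simp only [potential, hreg 11 (by decide)]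
    omega

/-- With its list read to the end, all neighbours of `x` are visited, so `x` may leave the path
without violating `closed`. -/
theorem Searching.pop {x : Fin n} (hL : IsAdjacencyLists G L)
    (hS : Searching G L (x :: l) n reg arr) (hr : reg 11 < n + 1)
    (hx : ¬ arr 0 x < listStart L x + (L x).length)
    (hreg : ∀ r, r = 0 ∨ 7 ≤ r ∧ r ≤ 9 ∨ r = 11 ∨ r = 30 → reg' r = reg r) (h10 : reg' 10 = top l)
    (h12 : reg' 12 = n) (hk : ∀ k, k ≠ 3 → arr' k = arr k)
    (h3 : arr' 3 = if arr 2 x = 0 then arr 3 else Function.update (arr 3) (top l) (arr 3 x)) :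
    reg' 12 ≤ n ∧ ∃ l', Searching G L l' (reg' 12) reg' arr' ∧
      (∀ v : Fin n, v = reg' 12 → ∀ p ∈ l'.head?, G.Adj v p) ∧
      potential L l' (reg' 11) arr' + 1 ≤ potential L (x :: l) (reg 11) arr := by
  obtain ⟨h7, h8, h9, -, h11, h30, hA, hV, hroots, hseen, hfin⟩ := hS
  have h0 := hk 0 (by decide)
  rw [h12]
  refine ⟨le_rfl, l, ⟨by simp [hreg, h7], by simp [hreg, h8], by simp [hreg, h9], h10, by simpa [hreg],
    by simpa [hreg], ⟨?_, ?_, ?_, ?_, ?_⟩, ?_, ?_, ?_, ?_⟩, ?_, ?_⟩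
  · rw [h0]
    refine tail_searchPath hA.path fun y hy => ?_
    obtain ⟨j, hj, rfl⟩ := List.mem_iff_getElem.1 (((hL x).2 y).2 hy)
    exact (hseen x j hj (by omega)).resolve_right (Fin.is_lt _).ne
  · intro k
    rw [hk 1 (by decide)]
    exact hA.par (k + 1)
  · rw [h0, hA.null]
  · rw [h0]; exact hA.ptr
  · intro k h2 h5 y hy
    by_cases h : k = 3
    · subst h
      have h1 := hA.flag 3 (by omega) (by omega) y hy
      have h1' := hA.flag 3 (by omega) (by omega) x x.2.le
      rw [h3]
      split_ifs
      · exact h1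
      · rw [Function.update_apply]
        split_ifs <;> assumption
    · rw [hk k h]
      exact hA.flag k h2 h5 y hy
  · rw [Verdict, hreg 0 (by decide), h0, hk 2 (by decide), hk 4 (by decide)]
    refine hV.imp_left fun h => ⟨h.1, h.2.pop hA.path.nodup fun y _ => ?_⟩
    have hy : l.head? = some y ↔ y.val = top l := by rw [List.head?_eq_getElem?, eq_top_iff]
    rw [h3, hy]
    by_cases hc : arr 2 x = 0
    · simp [hc]
    · by_cases hyt : y.val = top l
      · simp [hc, hyt]
      · simp [hc, hyt]
  · rw [hreg 11 (by decide), h0]; exact hroots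
  · rw [h0]; exact hseen
  · intro h
    rw [hreg 11 (by decide)] at h
    omega
  · intro v hv
    exact absurd hv v.2.ne
  · simp only [potential, hreg 11 (by decide), remaining_congr h0, List.length_cons]
    omega

theorem advance_spec (hL : IsAdjacencyLists G L) (hB : (encodeLists L).length + 5 * (n + 1) ≤ B)
    (hS : Searching G L l n reg arr) (hr : reg 11 < n + 1) :
    Wp n (encodeLists L) B advance (fun t reg' arr' => t ≤ 20 ∧ reg' 12 ≤ n ∧ ∃ l',
      Searching G L l' (reg' 12) reg' arr' ∧
      (∀ v : Fin n, v = reg' 12 → ∀ p ∈ l'.head?, G.Adj v p) ∧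
      potential L l' (reg' 11) arr' + 1 ≤ potential L l (reg 11) arr) reg arr := by
  have hS' := hS
  obtain ⟨h7, h8, h9, h10, h11, h30, hA, hV, hroots, hseen, hfin⟩ := hS
  have hw : n + 2 ≤ (encodeLists L).length := (le_listStart L 0).trans (listStart_le_length L (Nat.zero_le _))
  have hroots' : ∀ x : Fin n, x < reg 11 → arr 0 x ≠ 0 := fun x hx => (hroots x hx).resolve_right x.2.ne
  have hseen' : ∀ (x : Fin n) (j : ℕ) (hj : j < (L x).length), listStart L x + j < arr 0 x →
    arr 0 (L x)[j] ≠ 0 := fun x j hj h => (hseen x j hj h).resolve_right (Fin.is_lt _).ne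
  unfold advance
  rcases l with _ | ⟨x, l⟩
  · refine Wp.ite_eq (by decide) (by decide) (fun _ => ?_) (fun h => absurd (h10.trans h7.symm) h)
    refine Wp.seq (Wp.copy (by decide) (by decide) (by omega) ?_)
    refine Wp.add (by decide) (by decide) (by decide) (by simp [h9]; omega) ⟨by omega, by simp; omega, [], ?_, ?_, ?_⟩
    · refine ⟨by simp [h7], by simp [h8], by simp [h9], by simp [h10], by simp [h9]; omega, by simp [h30], hA,
        by simpa using hV, ?_, ?_, ?_⟩
      · intro y hy
        by_cases h : y.val = reg 11
        · exact Or.inr (by simp [h])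
        · exact Or.inl (hroots' y (by simp [h9] at hy; omega))
      · exact fun y j hj h => Or.inl (hseen' y j hj h)
      -- The counter reaches `n + 1` only by drawing the dummy root `n`, which happens only when the
      -- path is empty.
      · intro h
        simp [h9] at h
        simp [h]
    · simp
    · simp [potential, h9]; omega
  have hx := x.2
  have h10' : reg 10 = x := h10
  have hx0 : arr 0 x ≠ 0 := hA.path.sub x List.mem_cons_self
  have hxp := hA.ptr x hx0
  have hs : (encodeLists L).getD (x + 1 + 1) 0 = listStart L x + (L x).length := by
    rw [encodeLists_start L hx, listStart_succ]
  have hl : listStart L x + (L x).length ≤ (encodeLists L).length := by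
    rw [← listStart_succ]; exact listStart_le_length L hx
  refine Wp.ite_eq (by decide) (by decide) (fun h => absurd h (by omega)) (fun _ => ?_)
  refine Wp.seq (Wp.ld hB (by decide) (by decide) (by decide) (by omega) (by rw [h10']; omega) ?_)
  rw [h10']
  refine Wp.seq (Wp.add (by decide) (by decide) (by decide) (by simp; omega) ?_)
  refine Wp.seq (Wp.add (by decide) (by decide) (by decide) (by simp; omega) ?_)
  refine Wp.seq (Wp.input (by decide) (by decide) (by simp [h10', h9]; omega)
    (by simp [h10', h9, -List.getD_eq_getElem?_getD, hs]; omega) ?_)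
  refine Wp.ite_lt (by decide) (by decide) (fun h => ?_) (fun h => ?_)
  all_goals simp [h10', h9, -List.getD_eq_getElem?_getD, hs] at h
  · obtain ⟨j, hj⟩ := Nat.exists_eq_add_of_le hxp.1
    have hj' : j < (L x).length := by omega
    have hent : (encodeLists L).getD (arr 0 x) 0 = (L x)[j] := by rw [hj]; exact encodeLists_entry L x hj'
    have hyn := (L x)[j].2
    refine Wp.seq (Wp.input (by decide) (by decide) (by simp; omega)
      (by simp [-List.getD_eq_getElem?_getD, hent]; omega) ?_)
    refine Wp.seq (Wp.add (by decide) (by decide) (by decide) (by simp; omega) ?_)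
    refine Wp.st hB (by decide) (by decide) (by decide) (by simp; omega) ⟨by omega,
      hS'.next_neighbor hL hr hj hj' ?_ (by simp [-List.getD_eq_getElem?_getD, hent])
        (by simp [h10', h9]) (by simp +contextual)⟩
    intro r hr
    repeat rw [Function.update_of_ne (by omega)]
  · have p0 : arr 1 x = top l := hA.par 0
    have t0 := top_le l
    have f2 := hA.flag 2 (by omega) (by omega) x hx.le
    have f3 := hA.flag 3 (by omega) (by omega) x hx.le
    refine Wp.seq (Wp.ld hB (by decide) (by decide) (by decide) (by simp; omega) (by simp [h10', p0]; omega) ?_)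
    refine Wp.seq (Wp.ld hB (by decide) (by decide) (by decide) (by simp; omega) (by simp [h10']; omega) ?_)
    refine Wp.seq (Wp.ite_eq (by decide) (by decide) (fun hc => Wp.skip ?_) (fun hc => ?_))
    · simp [h10', h8] at hc
      refine Wp.seq (Wp.copy (by decide) (by decide) (by simp [h10', p0]; omega) ?_)
      refine Wp.copy (by decide) (by decide) (by simp; omega) ⟨by omega,
        hS'.pop hL hr (by omega) ?_ (by simp [h10', p0]) (by simp [h7]) (by simp) (by simp [hc])⟩
      intro r hr
      repeat rw [Function.update_of_ne (by omega)]
    · simp [h10', h8] at hc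
      refine Wp.seq (Wp.ld hB (by decide) (by decide) (by decide) (by simp; omega) (by simp [h10']; omega) ?_)
      refine Wp.st hB (by decide) (by decide) (by decide) (by simp [h10', p0]; omega) ?_
      refine Wp.seq (Wp.copy (by decide) (by decide) (by simp [h10', p0]; omega) ?_)
      refine Wp.copy (by decide) (by decide) (by simp; omega) ⟨by omega,
        hS'.pop hL hr (by omega) ?_ (by simp [h10', p0]) (by simp [h7]) (by simp +contextual)
          (by simp [hc, h10', p0])⟩
      intro r hr
      repeat rw [Function.update_of_ne (by omega)]

/-- One unit of potential is worth 100 steps. `advance` always releases a unit, which covers the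
constant costs, and the scan of a new vertex is paid for by the units released by its visit. -/
theorem step_spec (hL : IsAdjacencyLists G L) (hB : (encodeLists L).length + 5 * (n + 1) ≤ B)
    (hS : Searching G L l n reg arr) (hr : reg 11 < n + 1) :
    Wp n (encodeLists L) B step (fun t reg' arr' => ∃ l', Searching G L l' n reg' arr' ∧
      1 + t + 100 * potential L l' (reg' 11) arr' ≤ 100 * potential L l (reg 11) arr) reg arr := by
  unfold step
  refine Wp.seq ((advance_spec hL hB hS hr).mono ?_)
  rintro t1 reg1 arr1 ⟨ht1, hle, l1, ⟨h7, h8, h9, h10, h11, h30, hA, hV, hroots, hseen, hfin⟩, hadj, hpot⟩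
  refine Wp.seq (Wp.ld hB (by decide) (by decide) (by decide) hle (hA.ptr_le hB _ hle) ?_)
  refine Wp.ite_eq (by decide) (by decide) (fun hv => ?_) (fun hv => ?_)
  · simp [h8] at hv
    -- Entry `n` of array `0` is `1`, so the dummy counts as visited.
    have hne : reg1 12 ≠ n := by
      intro h
      rw [h, hA.null] at hv
      exact one_ne_zero hv
    obtain ⟨v, hv12⟩ : ∃ v : Fin n, reg1 12 = v := ⟨⟨reg1 12, by omega⟩, rfl⟩
    have hvn := v.2
    rw [hv12] at hv
    refine (visit_spec hL hB hA (by simpa using hV) (by simpa) (by simpa) (by simpa) (v := v) (by simpa) hv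
      (hadj v hv12.symm)).mono ?_
    rintro t2 reg2 arr2 ⟨ht2, e7, e8, e9, e10, e11, e30, a0, hA2, hV2⟩
    simp at e7 e11 e30
    have hs := le_listStart L v
    have hvis : ∀ x : Fin n, arr1 0 x ≠ 0 ∨ x.val = reg1 12 → arr2 0 x ≠ 0 := by
      rintro x hx
      by_cases hxv : x = v
      · rw [a0, hxv, Function.update_self]; omega
      · rw [a0, Function.update_of_ne (Fin.ext_iff.not.1 hxv)]
        exact hx.resolve_right (fun h => hxv (Fin.ext (h.trans hv12)))
    refine ⟨v :: l1, ⟨by omega, e8, e9, e10, by omega, by omega, hA2, hV2, ?_, ?_, ?_⟩, ?_⟩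
    · intro x hx
      exact Or.inl (hvis x (hroots x (by omega)))
    · intro x j hj hlt
      refine Or.inl (hvis _ ?_)
      by_cases hxv : x = v
      · subst hxv
        rw [a0, Function.update_self] at hlt
        omega
      · rw [a0, Function.update_of_ne (Fin.ext_iff.not.1 hxv)] at hlt
        exact hseen x j hj hlt
    · intro h
      exact absurd (hfin (by omega)).2 hne
    · have hd := sum_remaining_update (L := L) (d := 2 + (L v).length) a0
        (by simp [remaining, hv, a0]; split_ifs <;> omega)
      simp only [potential, List.length_cons, e11] at hpot ⊢
      omega
  · simp [h8] at hv
    have hV' : ∀ x : Fin n, arr1 0 x ≠ 0 ∨ x.val = reg1 12 → arr1 0 x ≠ 0 ∨ x.val = n := by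
      rintro x (hx | hx)
      · exact Or.inl hx
      · exact Or.inl (hx ▸ hv)
    refine Wp.skip ⟨l1, ⟨by simpa, by simpa, by simpa, by simpa, by simpa, by simpa, hA, by simpa using hV,
      fun x hx => hV' x (hroots x (by simpa using hx)), fun x j hj h => hV' _ (hseen x j hj h), ?_⟩, ?_⟩
    · intro h
      exact ⟨(hfin (by simpa using h)).1, rfl⟩
    · simp
      omega

/-! ### The whole program and its time bound. -/

/-- Initialize the arrays, and search the graph. -/
def search : Program :=
  .assign 0 (.const 1) ;; .assign 10 (.copy 7) ;; st 1 10 10 ;; st 0 10 9 ;; .while (.lt 11 30) step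

theorem Searching.verdict_iff {l : List (Fin n)} {arr : ℕ → ℕ → ℕ} (hS : Searching G L l n reg arr)
    (h : reg 11 = n + 1) : reg 0 = 1 ↔ G.IsChordal ∧ G.IsMDecyclable := by
  obtain ⟨rfl, -⟩ := hS.finish h
  have hall : {x : Fin n | arr 0 x ≠ 0} = Set.univ := by
    ext x
    simpa using (hS.roots x (by omega)).resolve_right x.2.ne
  rcases hS.verdict with ⟨h0, hL⟩ | ⟨h0, hbad⟩
  · rw [hall] at hL
    exact iff_of_true h0 hL.good
  · exact iff_of_false (by omega) hbad

/-- The initial potential is `3 * n + 1 + 2 * ∑ v, (L v).length`; to its hundredfold come six steps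
of initialization and the final loop test. -/
theorem search_spec (hL : IsAdjacencyLists G L) (hB : (encodeLists L).length + 5 * (n + 1) ≤ B)
    (h7 : reg 7 = n) (h8 : reg 8 = 0) (h9 : reg 9 = 1) (h11 : reg 11 = 0) (h30 : reg 30 = n + 1) :
    Wp n (encodeLists L) B search (fun t reg' _ => t ≤ 300 * n + 200 * ∑ v, (L v).length + 107 ∧
      (reg' 0 = 1 ↔ G.IsChordal ∧ G.IsMDecyclable)) reg 0 := by
  unfold search
  refine Wp.seq (Wp.const (by decide) (by omega) ?_)
  refine Wp.seq (Wp.copy (by decide) (by decide) (by simp; omega) ?_)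
  refine Wp.seq (Wp.st hB (by decide) (by decide) (by decide) (by simp; omega) ?_)
  refine Wp.seq (Wp.st hB (by decide) (by decide) (by decide) (by simp; omega) ?_)
  refine (Wp.while_lt (by decide) (by decide)
    (I := fun φ reg' arr' => ∃ l, Searching G L l n reg' arr' ∧ 100 * potential L l (reg' 11) arr' = φ)
    ?_ ⟨[], ?_, rfl⟩).mono ?_
  · rintro φ reg' arr' ⟨l, hS, rfl⟩ hlt
    rw [hS.limit] at hlt
    refine (step_spec hL hB hS hlt).mono ?_
    rintro t reg'' arr'' ⟨l', hS', ht⟩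
    exact ⟨_, ⟨l', hS', rfl⟩, ht⟩
  · have hx : ∀ x : Fin n, x.val ≠ n := fun x => x.2.ne
    refine ⟨by simp [h7], by simp [h8], by simp [h9], by simp [h7, top], by simp [h11], by simp [h30],
      ⟨⟨by simp, by simp, by simp, by simp [h7, hx]⟩, by simp [h7, top], by simp [h7, h9], by simp [h7, hx],
        ?_⟩, Or.inl ⟨by simp, ?_⟩, by simp [h11], by simp [h7, hx], by simp [h11]⟩
    · intro k h2 h5 x hx
      rw [Function.update_of_ne (by omega), Function.update_of_ne (by omega)]
      exact Nat.zero_le 1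
    · simpa [h7, hx] using labelled_empty
  · rintro t reg' arr' ⟨φ, ⟨l, hS, rfl⟩, hlt, ht⟩
    have hx : ∀ x : Fin n, x.val ≠ n := fun x => x.2.ne
    have h0 := hS.root_le
    rw [hS.limit] at hlt
    refine ⟨?_, hS.verdict_iff (by omega)⟩
    simp [potential, remaining, h7, hx, h11, Finset.sum_add_distrib, ← Finset.mul_sum] at ht
    omega

/-- The whole program: unless the input is too long for an m-decyclable graph, search the graph. -/
def recognize : Program :=
  .assign 7 (.load 8) ;; .assign 9 (.const 1) ;; .assign 19 (.add 7 9) ;; .assign 30 (.copy 19) ;;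
    .assign 1 (.load 19) ;; .assign 20 (.add 7 7) ;; .assign 20 (.add 20 20) ;; .assign 20 (.add 20 9) ;;
    .assign 20 (.add 20 9) ;; .ite (.le 1 20)
      (.assign 2 (.add 1 19) ;; .assign 3 (.add 2 19) ;; .assign 4 (.add 3 19) ;; .assign 5 (.add 4 19) ;;
        search) .skip

theorem recognize_spec (hn : 1 ≤ n) (hL : IsAdjacencyLists G L)
    (hB : 7 * (encodeLists L).length ≤ B) :
    Runs B recognize (fun t s => t ≤ 1100 * n ∧ (s.reg 0 = 1 ↔ G.IsChordal ∧ G.IsMDecyclable))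
      (init (encodeLists L)) := by
  have e0 : (encodeLists L).getD 0 0 = n := encodeLists_zero L
  have en : (encodeLists L).getD (n + 1) 0 = (encodeLists L).length := by
    rw [encodeLists_start L le_rfl, length_encodeLists]
  have hl : n + 2 + ∑ v, (L v).length = (encodeLists L).length := by
    rw [length_encodeLists, listStart_last]
  unfold recognize
  -- Register `8` is still zero, so the first instruction loads `n` from cell `0`.
  refine Runs.seq (Runs.assign (by simp [Rhs.value, init, -List.getD_eq_getElem?_getD, e0]; omega) ?_)
  simp only [Rhs.value, init, e0]
  refine Runs.seq (Runs.assign (by simp [Rhs.value]; omega) ?_)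
  refine Runs.seq (Runs.assign (by simp [Rhs.value]; omega) ?_)
  refine Runs.seq (Runs.assign (by simp [Rhs.value]; omega) ?_)
  refine Runs.seq (Runs.assign (by simp [Rhs.value, -List.getD_eq_getElem?_getD, en]; omega) ?_)
  refine Runs.seq (Runs.assign (by simp [Rhs.value]; omega) ?_)
  refine Runs.seq (Runs.assign (by simp [Rhs.value]; omega) ?_)
  refine Runs.seq (Runs.assign (by simp [Rhs.value]; omega) ?_)
  refine Runs.seq (Runs.assign (by simp [Rhs.value]; omega) ?_)
  -- Cell `n + 1` holds the length of the input. More than `4 * n + 2` words mean a degree sum above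
  -- `3 * n`, and such an input is refused in constant time.
  refine Runs.ite (fun hc => ?_) (fun hc => Runs.skip ⟨by omega, ?_⟩)
  all_goals simp [Rhs.value, Test.Holds, -List.getD_eq_getElem?_getD, en] at hc
  · refine Runs.seq (Runs.assign (by simp [Rhs.value, -List.getD_eq_getElem?_getD, en]; omega) ?_)
    refine Runs.seq (Runs.assign (by simp [Rhs.value, -List.getD_eq_getElem?_getD, en]; omega) ?_)
    refine Runs.seq (Runs.assign (by simp [Rhs.value, -List.getD_eq_getElem?_getD, en]; omega) ?_)
    refine Runs.seq (Runs.assign (by simp [Rhs.value, -List.getD_eq_getElem?_getD, en]; omega) ?_)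
    refine (search_spec (B := B) hL (by omega) ?_ ?_ ?_ ?_ ?_ _
      ⟨fun _ _ => rfl, ?_, fun _ _ => rfl, ?_⟩).mono ?_
    · simp [Rhs.value]
    · simp [Rhs.value]
    · simp [Rhs.value]
    · simp [Rhs.value]
    · simp [Rhs.value]
    · intro k hk
      obtain rfl | rfl | rfl | rfl | rfl : k = 0 ∨ k = 1 ∨ k = 2 ∨ k = 3 ∨ k = 4 := by omega
      all_goals simp [Rhs.value, -List.getD_eq_getElem?_getD, en]
      all_goals ring
    · intro k hk x hx
      exact List.getD_eq_default _ _ (by omega)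
    · rintro t s ⟨reg', arr', hs, ht, hiff⟩
      rw [hs.reg_eq 0 (Or.inl rfl)]
      exact ⟨by omega, hiff⟩
  · refine iff_of_false (by simp) fun hG => ?_
    have := hL.sum_length_le hG.2
    omega

end RAM

theorem theorem5 :
    ∃ (P : RAM.Program) (C : ℕ), ∀ (n : ℕ), 1 ≤ n → ∀ (G : SimpleGraph (Fin n))
      (L : Fin n → List (Fin n)), IsAdjacencyLists G L →
      ∃ (t : ℕ) (s : RAM.State),
        RAM.Exec (C * (encodeLists L).length) P (RAM.init (encodeLists L)) t s ∧
        t ≤ C * n ∧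
        (s.reg 0 = 1 ↔ G.IsChordal ∧ G.IsMDecyclable) :=
  -- For inputs that pass the length test the search takes at most `900 * n + 107` steps, and `200 *
  -- n ≥ 200` covers the rest; for the word size the factor `7` would do.
  ⟨RAM.recognize, 1100, fun _ hn _ _ hL =>
    RAM.recognize_spec hn hL (Nat.mul_le_mul_right _ (by decide))⟩
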